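/- **Setting.** Let $\mathcal F$ (facilities) and $\mathcal D$ (clients) be finite sets in a metric space $c$ (co-located points allowed), with lower bounds $L_i\in\mathbb N$ ($i\in\mathcal F$) and bounds $k,m\in\mathbb N$; $n=|\mathcal F|+|\mathcal D|$, $c_{\max}=\max_{i\in\mathcal F,j\in\mathcal D}c(i,j)$, $B(i,r)=\{j\in\mathcal D:c(i,j)\le r\}$. Let $\mathcal L$ be the set of pairs $(i,r)$, $i\in\mathcal F$, $r\ge0$, with $|B(i,r)|\ge L_i$. Fix a non-empty $F^O\subseteq\mathcal L$ with $|F^O|\le k$, and put $R^*=\min_{(i,r)\in F^O}r$, $k'=k-|F^O|$, $\mathcal D'=\mathcal D\setminus\bigcup_{(i,r)\in F^O}B(i,r)$, and let $\mathcal L'$ be the set of pairs $(i,c(i,j))\in\mathcal L$ with $j\in\mathcal D$, $c(i,j)\le R^*$. For a finite set $P$ of pairs, $\mathrm{cost}(P)=\sum_{(i,r)\in P}r$, $\mu(P)$ is the set of its facilities, and $\mathrm{uncov}(P)=\mathcal D'\setminus\bigcup_{(i,r)\in P}B(i,r)$. Pairs $(i,r),(i',r')$ intersect if $c(i,i')\le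 r+r'$, and are non-intersecting otherwise. Let $OPT$ be the optimal value of the LP: minimize $\sum_{(i,r)\in\mathcal L'}r\,y_{i,r}$ subject to $\sum_{(i,r)\in\mathcal L':j\in B(i,r)}y_{i,r}+w_j\ge1$ for all $j\in\mathcal D'$, $\sum_{(i,r)\in\mathcal L'} y_{i,r}\le k'$, $\sum_{j\in\mathcal D'} w_j\le m$, $y,w\ge0$; the LP is assumed to be feasible. **Subroutine PD($z$)**, $z\ge0$. Start with $\alpha=0$ on $\mathcal D'$, all of $\mathcal D'$ active, $T=\emptyset$. While more than $m$ clients are active: raise $\alpha_j$ of all active clients uniformly until $\sum_{j\in B(i,r)\cap\mathcal D'}\alpha_j-z\le r$ becomes tight for some $(i,r)\in\mathcal L'\setminus T$; add $(i,r)$ to $T$ and deactivate the clients in $B(i,r)$. Let $f=(i_f,r_f)$ be the last pair added (if any). Scan $T\setminus f$ in non-increasing order of radius and keep greedily a maximal set $T_I$ of non-intersecting pairs. For $(i,r)\in T_I$ let $\mathrm{rad}(i)=r$, and let $r_i$ be the least $\rho\ge0$ such that $B(i,\rho)\supseteq B(i',r')$ for all $(i',r')\in T\setminus f$ with $r'\le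 r$ that intersect $(i,r)$. Let $F'=\{(i,r_i)\}$. If $|\mathrm{uncov}(F')|\le m$, set $F=F'$. Otherwise, if $c(i,i_f)\le2R^*$ for some $i\in\mu(F')$, increase $r_i$ for one such $i$ as little as possible so that $B(i,r_i)\supseteq B(i_f,r_f)$, and let $F$ be the updated $F'$; otherwise set $F=F'\cup\{f\}$, $\mathrm{rad}(i_f)=r_f$. Return $(F,f,\mathrm{rad})$. **Subroutine $\mathcal A$**, on the outputs $(F_p,f_p,\mathrm{rad}_p)$, $p=1,2$, of two calls of PD. Assign each $p'\in F_1$ that intersects some pair of $F_2$ to one such pair; let $S_q$ be the pairs assigned to $q\in F_2$, $Q$ the unassigned pairs, and $uc_p=\mathrm{uncov}(F_p)$. Partition $uc_1\setminus uc_2$ into sets $uc_1(q)\subseteq B(q)$ ($q\in F_2$), and $uc_2\setminus uc_1$ into sets $uc_2(p')\subseteq B(p')$ ($p'\in F_1$). Take an extreme-point optimal solution $v=(x,t)$ of the LP: minimize $\sum_{(i,r)=q\in F_2}\bigl(x_q(2r+\sum_{(i',r')\in S_q}2r')+(1-x_q)\sum_{(i',r')\in S_q}r'\bigr)+\sum_{(i',r')=p'\in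 Q}t_{p'}r'$ subject to $\sum_{q\in F_2}(x_q+|S_q|(1-x_q))+\sum_{p'\in Q}t_{p'}\le k'$, $\sum_{q\in F_2}(1-x_q)|uc_1(q)|+\sum_{p'\in Q}(1-t_{p'})|uc_2(p')|\le m-|uc_1\cap uc_2|$, $0\le x,t\le1$. If the fractional variables contribute at least $2$ to the left side of the first constraint, or at most one variable is fractional, or $x_q$ is fractional for some $q$ with $S_q\ne\emptyset$, round all variables up; otherwise round a fractional variable with largest coefficient in the second constraint ($|uc_1(q)|$ or $|uc_2(p')|$) to $1$ and the other fractional ones to $0$. Build $F''$: all $p'\in Q$ with $t_{p'}=1$; all pairs of $S_q$ if $x_q=0$; and, if $x_q=1$ and $S_q\ne\emptyset$, where $q=(i,r)$, one pair $(i',2r+r'+\max_{(i'',r'')\in S_q\setminus(i',r')}2r'')$ with $(i',r')\in S_q$; use radii $\mathrm{rad}_1$. Each $q=(i,r)\in F_2$ with $x_q=1$, $S_q=\emptyset$ is added, with radius $\mathrm{rad}_2(i)$, if it intersects no pair of $F''$; otherwise the radius of one pair of $F''$ that intersects it is increased by $2r$ (these increases add up). Return $(F_2,\mathrm{rad}_2)$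 if its cost is at most that of the resulting set, and the resulting set with its radii otherwise. **Subroutine $\mathcal B$**, on the same input. Let $M$ be the set of pairs in $F_2$ that intersect a pair of $F_1\setminus f_1$. Map each pair of $M$ by $\psi$ to such a pair, and the pairs of $F_2\setminus M$ to distinct pairs of $F_1\setminus(\{f_1\}\cup\psi(M))$. Start with $F=F_1\setminus f_1$ and radii $\mathrm{rad}_1$. In any order, for the $(i,r)\in F_2$ with $(i',r')=\psi(i,r)$, $r'<r$: replace $(i',r')$ in $F$ by $(i,r+2r')$ if $(i,r)\in M$ and by $(i,r)$ otherwise, with radius $\mathrm{rad}_2(i)$. Stop and return $F$ with its radii as soon as $|\mathrm{uncov}(F)|\le m$; if this does not happen, return $(F_2,\mathrm{rad}_2)$. **Algorithm $k$-BSAlg$^o$**, with parameter $\varepsilon>0$. If PD($0$) returns at most $k'$ pairs, return its $(F,\mathrm{rad})$. Otherwise start with $z_1=0$, $z_2=2nk'c_{\max}$, and while $z_2-z_1>\varepsilon\,OPT/(3n2^n)$ set $z=(z_1+z_2)/2$ and replace $z_1$ by $z$ if PD($z$) returns more than $k'$ pairs, and $z_2$ by $z$ if not. Let $(F_p,f_p,\mathrm{rad}_p)$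 be the output of PD($z_p$), $p=1,2$, and let $F_{\mathcal A}$, with its radii, be the output of $\mathcal A$. If $|F_1\setminus f_1|>k'$, return $F_{\mathcal A}$. Otherwise, if for some $(i,r)\in F_1\setminus f_1$ the set $F=F_1\setminus\{f_1,(i,r)\}\cup\{(i,r+12R^*)\}$ has $|\mathrm{uncov}(F)|\le m$, or if there are distinct $(i,r),(i',r')\in F_1$ with $c(i,i')\le12R^*$, in which case let $F=F_1\setminus\{(i,r),(i',r')\}\cup\{(i,r'')\}$ with $r''\ge r$ least such that $B(i',r')\subseteq B(i,r'')$, return such an $F$ with the radii $\mathrm{rad}_1$. Otherwise, if $z_1\le(1+\varepsilon)OPT$, return $F_{\mathcal A}$; if $z_1>(1+\varepsilon)OPT$, return the cheaper of $F_{\mathcal A}$ and the output $F_{\mathcal B}$ of $\mathcal B$. **Theorem.** There are absolute constants $C_1,C_2$ such that the following holds for all such instances, all $F^O$ for which the LP is feasible, all $\varepsilon>0$, and all ways of making the choices that the algorithm leaves open. PD can be carried out for every $z\ge 0$. If $OPT>0$ (so that the search has a positive target width), then, whichever choices are made inside PD, the algorithm has an output. Every output $(F,\mathrm{rad})$ consists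 of a set $F\subseteq\mathcal L$ of at most $k'$ pairs with $|\mathrm{uncov}(F)|\le m$ and $$\mathrm{cost}(F)\le(12.365+C_1\varepsilon)\,OPT+C_2R^*,$$ and of radii such that $\{(i,\mathrm{rad}(i))\}_{i\in\mu(F)}\subseteq\mathcal L'$ and these pairs are pairwise non-intersecting. -/

import Mathlib

/-!
Lower-bounded min-sum-of-radii with outliers: the residual ball-selection instance obtained from a
guess of large balls, its LP relaxation, and the modified ball-selection algorithm.

Algorithms are described as relations between inputs and outputs, so that every arbitrary choice
(order of tight pairs, ties, optimal vertex, partition, representative, ...) is quantified over.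
-/

noncomputable section

open scoped Classical

namespace LBSRO

/-- A pair `(i, r)`: a centre `i` and a radius `r`. -/
abbrev Pair (X : Type*) := X × ℝ

/-- Facilities and clients located in a (pseudo)metric space, lower bounds, the bound `k` on the
number of facilities, the bound `m` on the number of outliers. Co-located points are allowed. -/
structure Inst (X : Type*) [PseudoMetricSpace X] where
  facilities : Finset X
  clients : Finset X
  lower : X → ℕ
  k : ℕ
  m : ℕ

/-- Two pairs intersect if the distance of the centres is at most the sum of the radii. -/
def Intersects {X : Type*} [PseudoMetricSpace X] (p q : Pair X) : Prop :=
  dist p.1 q.1 ≤ p.2 + q.2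

/-- The facilities that occur in a set of pairs. -/
def centers {X : Type*} (P : Finset (Pair X)) : Finset X := P.image Prod.fst

/-- Total radius. -/
def cost {X : Type*} (P : Finset (Pair X)) : ℝ := ∑ p ∈ P, p.2

/-- The least `ρ ≥ ρ₀` such that all points of `S` are within distance `ρ` of `i`. -/
def coverRadius {X : Type*} [PseudoMetricSpace X] (i : X) (ρ₀ : ℝ) (S : Finset X) : ℝ :=
  S.fold max ρ₀ (fun j => dist i j)

theorem coverRadius_isLeast {X : Type*} [PseudoMetricSpace X] (i : X) (ρ₀ : ℝ) (S : Finset X) :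
    IsLeast {ρ : ℝ | ρ₀ ≤ ρ ∧ ∀ j ∈ S, dist i j ≤ ρ} (coverRadius i ρ₀ S) :=
  ⟨Finset.fold_max_le (coverRadius i ρ₀ S) |>.1 le_rfl,
    fun ρ hρ => (Finset.fold_max_le ρ).2 hρ⟩

/-- A set of pairs together with a radius `rad i` for each of its facilities
(only the values of `rad` on `centers F` matter). -/
structure Sol (X : Type*) where
  F : Finset (Pair X)
  rad : X → ℝ

/-- The output of the primal-dual subroutine; `f` is the last tight pair, if there is one. -/
structure PDOut (X : Type*) extends Sol X where
  f : Option (Pair X)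

/-- `F \ f`. -/
def PDOut.core {X : Type*} (o : PDOut X) : Finset (Pair X) := o.F \ o.f.toFinset

/-- Scan a list of pairs, keeping a pair if it intersects none of those kept so far. -/
def greedy {X : Type*} [PseudoMetricSpace X] (l : List (Pair X)) : Finset (Pair X) :=
  l.foldl (fun S p => if ∀ q ∈ S, ¬ Intersects p q then insert p S else S) ∅

/-- `TI` results from greedily scanning `T` in some non-increasing order of radius. -/
def IsGreedySubset {X : Type*} [PseudoMetricSpace X] (T TI : Finset (Pair X)) : Prop :=
  ∃ l : List (Pair X), l.Nodup ∧ l.toFinset = T ∧ l.Pairwise (fun p q => q.2 ≤ p.2) ∧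
    TI = greedy l

namespace Inst

variable {X : Type*} [PseudoMetricSpace X] (I : Inst X)

/-- The clients within distance `r` of `i`. -/
def ball (p : Pair X) : Finset X := I.clients.filter (fun j => dist p.1 j ≤ p.2)

/-- `(i, r)` is admissible: `i` is a facility, and the ball contains at least `L_i` clients. -/
def Admissible (p : Pair X) : Prop :=
  p.1 ∈ I.facilities ∧ 0 ≤ p.2 ∧ I.lower p.1 ≤ (I.ball p).card

/-- The largest facility-client distance (`0` if there is none). -/
def cmax : ℝ := (I.facilities ×ˢ I.clients).fold max 0 (fun ij => dist ij.1 ij.2)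

/-- `n`, the number of facilities plus the number of clients. -/
def size : ℕ := I.facilities.card + I.clients.card

end Inst

/-- A guess `F^O` of at least one and at most `k` admissible pairs. -/
structure Guess {X : Type*} [PseudoMetricSpace X] (I : Inst X) where
  pairs : Finset (Pair X)
  nonempty : pairs.Nonempty
  admissible : ∀ p ∈ pairs, I.Admissible p
  card_le : pairs.card ≤ I.k

/-- State of the dual ascent: dual variables, active clients, tight pairs chosen so far, and the
last of them. -/
structure Ascent (X : Type*) where
  α : X → ℝ
  active : Finset X
  T : Finset (Pair X)
  last : Option (Pair X)

namespace Guess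

variable {X : Type*} [PseudoMetricSpace X] {I : Inst X} (G : Guess I)

/-! ### The residual instance and its LP relaxation -/

/-- `R*`, the least guessed radius. -/
def R : ℝ := G.pairs.inf' G.nonempty Prod.snd

/-- `D'`: the clients not covered by the guess. -/
def D' : Finset X := I.clients.filter (fun j => ∀ p ∈ G.pairs, j ∉ I.ball p)

/-- `L'`: the admissible pairs `(i, c(i,j))`, for a client `j`, of radius at most `R*`. -/
def L' : Finset (Pair X) :=
  ((I.facilities ×ˢ I.clients).image (fun ij => (ij.1, dist ij.1 ij.2))).filter
    (fun p => I.Admissible p ∧ p.2 ≤ G.R)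

/-- `k' = k - |F^O|`. -/
def k' : ℕ := I.k - G.pairs.card

/-- The clients of `D'` that are in no ball of `P`. -/
def uncov (P : Finset (Pair X)) : Finset X := G.D'.filter (fun j => ∀ p ∈ P, j ∉ I.ball p)

/-- Feasibility of `(y, w)` for the LP relaxation. -/
def LPSol (y : Pair X → ℝ) (w : X → ℝ) : Prop :=
  (∀ p ∈ G.L', 0 ≤ y p) ∧ (∀ j ∈ G.D', 0 ≤ w j) ∧
  (∀ j ∈ G.D', 1 ≤ (∑ p ∈ G.L'.filter (fun p => j ∈ I.ball p), y p) + w j) ∧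
  ∑ p ∈ G.L', y p ≤ (G.k' : ℝ) ∧ ∑ j ∈ G.D', w j ≤ (I.m : ℝ)

/-- The LP relaxation is feasible. -/
def LPFeasible : Prop := ∃ y w, G.LPSol y w

/-- The optimal value of the LP relaxation. -/
def OPT : ℝ := sInf {v : ℝ | ∃ y w, G.LPSol y w ∧ v = ∑ p ∈ G.L', p.2 * y p}

/-! ### The primal-dual subroutine -/

/-- Left-hand side of the dual constraint of `p` (without `- z`). -/
def load (α : X → ℝ) (p : Pair X) : ℝ := ∑ j ∈ I.ball p ∩ G.D', α j

/-- The start of the dual ascent. -/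
def ascentInit : Ascent X := ⟨fun _ => 0, G.D', ∅, none⟩

/-- One round of the dual ascent: as long as more than `m` clients are active, raise the duals of
the active clients uniformly until a new pair is tight, add it, and deactivate its clients. -/
def AscentStep (z : ℝ) (s t : Ascent X) : Prop :=
  I.m < s.active.card ∧
  ∃ Δ : ℝ, 0 ≤ Δ ∧ ∃ p ∈ G.L', p ∉ s.T ∧
    t.α = (fun j => if j ∈ s.active then s.α j + Δ else s.α j) ∧
    (∀ q ∈ G.L', G.load t.α q - z ≤ q.2) ∧
    G.load t.α p - z = p.2 ∧
    t.active = s.active \ I.ball p ∧ t.T = insert p s.T ∧ t.last = some p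

/-- The radius to which the kept pair `p` is enlarged: the least one that covers the balls of all
pairs in `T` of no larger radius that intersect `p`. -/
def prunedRadius (T : Finset (Pair X)) (p : Pair X) : ℝ :=
  coverRadius p.1 0 ((T.filter (fun q => q.2 ≤ p.2 ∧ Intersects q p)).biUnion I.ball)

/-- `o` is a possible output of the primal-dual subroutine for the penalty `z`. -/
def IsPDOut (z : ℝ) (o : PDOut X) : Prop :=
  ∃ s : Ascent X, Relation.ReflTransGen (G.AscentStep z) G.ascentInit s ∧
    s.active.card ≤ I.m ∧ o.f = s.last ∧
    ∃ TI F' : Finset (Pair X), IsGreedySubset (s.T \ s.last.toFinset) TI ∧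
      (∀ p ∈ TI, o.rad p.1 = p.2) ∧
      F' = TI.image (fun p => (p.1, prunedRadius (I := I) (s.T \ s.last.toFinset) p)) ∧
      (((G.uncov F').card ≤ I.m ∧ o.F = F') ∨
       (I.m < (G.uncov F').card ∧ ∃ f, s.last = some f ∧
         ((∃ p ∈ F', dist p.1 f.1 ≤ 2 * G.R ∧
            o.F = insert (p.1, coverRadius p.1 p.2 (I.ball f)) (F'.erase p)) ∨
          ((∀ p ∈ F', 2 * G.R < dist p.1 f.1) ∧ o.F = insert f F' ∧ o.rad f.1 = f.2))))

/-- `pd` is an implementation of the primal-dual subroutine, with an arbitrary way of making the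
choices that the subroutine leaves open. -/
def IsPD (pd : ℝ → PDOut X) : Prop := ∀ z, 0 ≤ z → G.IsPDOut z (pd z)

/-! ### Binary search for the penalty -/

/-- The target width of the search interval. -/
def δ (ε : ℝ) : ℝ := ε * G.OPT / (3 * I.size * 2 ^ I.size)

/-- The initial search interval. -/
def searchInit : ℝ × ℝ := (0, 2 * I.size * G.k' * I.cmax)

/-- Halve the search interval `(z₁, z₂)`. -/
def searchStep (pd : ℝ → PDOut X) (z : ℝ × ℝ) : ℝ × ℝ :=
  if G.k' < (pd ((z.1 + z.2) / 2)).F.card then ((z.1 + z.2) / 2, z.2) else (z.1, (z.1 + z.2) / 2)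

/-- `z` is the interval at the first moment at which its width is at most `δ`. -/
def IsSearchResult (pd : ℝ → PDOut X) (ε : ℝ) (z : ℝ × ℝ) : Prop :=
  ∃ N : ℕ, z = (G.searchStep pd)^[N] G.searchInit ∧ z.2 - z.1 ≤ G.δ ε ∧
    ∀ n < N, G.δ ε <
      ((G.searchStep pd)^[n] G.searchInit).2 - ((G.searchStep pd)^[n] G.searchInit).1

end Guess

/-! ### First combination subroutine -/

/-- Choices made when `F₁` is clustered around `F₂`: the map `π` (value `none` for unclustered
pairs), and partitions of the clients covered by exactly one of the two solutions. -/
structure Clustering {X : Type*} [PseudoMetricSpace X] {I : Inst X} (G : Guess I)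
    (F₁ F₂ : Finset (Pair X)) where
  π : Pair X → Option (Pair X)
  π_some : ∀ p ∈ F₁, (∃ q ∈ F₂, Intersects p q) → ∃ q ∈ F₂, π p = some q ∧ Intersects p q
  π_none : ∀ p ∈ F₁, (∀ q ∈ F₂, ¬ Intersects p q) → π p = none
  uc₁ : Pair X → Finset X
  uc₁_sub : ∀ q ∈ F₂, uc₁ q ⊆ I.ball q
  uc₁_disj : (F₂ : Set (Pair X)).PairwiseDisjoint uc₁
  uc₁_union : F₂.biUnion uc₁ = G.uncov F₁ \ G.uncov F₂
  uc₂ : Pair X → Finset X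
  uc₂_sub : ∀ p ∈ F₁, uc₂ p ⊆ I.ball p
  uc₂_disj : (F₁ : Set (Pair X)).PairwiseDisjoint uc₂
  uc₂_union : F₁.biUnion uc₂ = G.uncov F₂ \ G.uncov F₁

namespace Clustering

variable {X : Type*} [PseudoMetricSpace X] {I : Inst X} {G : Guess I} {F₁ F₂ : Finset (Pair X)}
  (K : Clustering G F₁ F₂)

/-- The `F₁`-pairs clustered around `q`. -/
def star (q : Pair X) : Finset (Pair X) := F₁.filter (fun p => K.π p = some q)

/-- The unclustered `F₁`-pairs. -/
def unclustered : Finset (Pair X) := F₁.filter (fun p => K.π p = none)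

/-- Index set of the LP variables: `inl q` is `x_q` for `q ∈ F₂`, and `inr p` is `q_p` for
unclustered `p ∈ F₁`. -/
def vars : Finset (Pair X ⊕ Pair X) := F₂.disjSum K.unclustered

/-- Contribution of a variable to the number of pairs. -/
def sizeTerm (v : Pair X ⊕ Pair X → ℝ) : Pair X ⊕ Pair X → ℝ
  | .inl q => v (.inl q) + (K.star q).card * (1 - v (.inl q))
  | .inr p => v (.inr p)

/-- Number of clients that a variable at value `0` leaves uncovered. -/
def outCoef : Pair X ⊕ Pair X → ℕ
  | .inl q => (K.uc₁ q).card
  | .inr p => (K.uc₂ p).card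

/-- Contribution of a variable to the objective. -/
def costTerm (v : Pair X ⊕ Pair X → ℝ) : Pair X ⊕ Pair X → ℝ
  | .inl q => v (.inl q) * (2 * q.2 + ∑ p ∈ K.star q, 2 * p.2) +
      (1 - v (.inl q)) * ∑ p ∈ K.star q, p.2
  | .inr p => v (.inr p) * p.2

/-- The objective of the two-constraint covering-knapsack LP. -/
def obj (v : Pair X ⊕ Pair X → ℝ) : ℝ := ∑ c ∈ K.vars, K.costTerm v c

/-- The feasible region of the two-constraint covering-knapsack LP; vectors are extended by `0`
outside the index set of the variables. -/
def region : Set (Pair X ⊕ Pair X → ℝ) :=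
  {v | (∀ c ∈ K.vars, 0 ≤ v c ∧ v c ≤ 1) ∧ (∀ c, c ∉ K.vars → v c = 0) ∧
    ∑ c ∈ K.vars, K.sizeTerm v c ≤ (G.k' : ℝ) ∧
    ∑ c ∈ K.vars, (1 - v c) * K.outCoef c ≤ (I.m : ℝ) - (G.uncov F₁ ∩ G.uncov F₂).card}

/-- `v` is an extreme-point optimal solution of the LP. -/
def IsOptVertex (v : Pair X ⊕ Pair X → ℝ) : Prop :=
  v ∈ Set.extremePoints ℝ K.region ∧ ∀ u ∈ K.region, K.obj v ≤ K.obj u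

/-- The fractional variables. -/
def frac (v : Pair X ⊕ Pair X → ℝ) : Finset (Pair X ⊕ Pair X) :=
  K.vars.filter (fun c => 0 < v c ∧ v c < 1)

/-- In this case all fractional variables are rounded up. -/
def RoundsUp (v : Pair X ⊕ Pair X → ℝ) : Prop :=
  2 ≤ ∑ c ∈ K.frac v, K.sizeTerm v c ∨ (K.frac v).card ≤ 1 ∨
    ∃ q, Sum.inl q ∈ K.frac v ∧ (K.star q).Nonempty

/-- `u` is a rounding of `v`. -/
def IsRounding (v u : Pair X ⊕ Pair X → ℝ) : Prop :=
  (K.RoundsUp v ∧ ∀ c, u c = (⌈v c⌉ : ℝ)) ∨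
  (¬ K.RoundsUp v ∧ (∀ c, c ∉ K.frac v → u c = v c) ∧
    ∃ c ∈ K.frac v, (∀ d ∈ K.frac v, K.outCoef d ≤ K.outCoef c) ∧ u c = 1 ∧
      ∀ d ∈ K.frac v, d ≠ c → u d = 0)

/-- The enlarged pair that replaces the star of `q`, if its member `p` is picked. -/
def merged (q p : Pair X) : Pair X :=
  (p.1, 2 * q.2 + p.2 + ((K.star q).erase p).fold max 0 (fun p' => 2 * p'.2))

/-- The pairs selected before the `F₂`-pairs with empty star are treated; `rep q` is the member
picked from the star of `q`. -/
def selected (u : Pair X ⊕ Pair X → ℝ) (rep : Pair X → Pair X) : Finset (Pair X) :=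
  K.unclustered.filter (fun p => u (.inr p) = 1) ∪
  (F₂.filter (fun q => u (.inl q) = 0)).biUnion K.star ∪
  (F₂.filter (fun q => u (.inl q) = 1 ∧ (K.star q).Nonempty)).image (fun q => K.merged q (rep q))

/-- The `F₂`-pairs with empty star and value `1`. -/
def extra (u : Pair X ⊕ Pair X → ℝ) : Finset (Pair X) :=
  F₂.filter (fun q => u (.inl q) = 1 ∧ K.star q = ∅)

/-- Those of them that intersect no pair of `S`. -/
def isolated (u : Pair X ⊕ Pair X → ℝ) (S : Finset (Pair X)) : Finset (Pair X) :=
  (K.extra u).filter (fun q => ∀ p ∈ S, ¬ Intersects q p)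

/-- `A` is extracted from the integral vector `u`. An `F₂`-pair `q` with empty star and value `1`
is added if it intersects no pair of `S`; otherwise it is absorbed by a pair `hit q` of `S`, whose
radius grows by twice that of `q` (and again for every other pair that it absorbs). -/
def IsExtracted (rad₁ rad₂ : X → ℝ) (u : Pair X ⊕ Pair X → ℝ) (A : Sol X) : Prop :=
  ∃ rep hit : Pair X → Pair X, ∃ S : Finset (Pair X),
    (∀ q ∈ F₂, (K.star q).Nonempty → rep q ∈ K.star q) ∧
    S = K.selected u rep ∧
    (∀ q ∈ K.extra u \ K.isolated u S, hit q ∈ S ∧ Intersects q (hit q)) ∧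
    A.F = K.isolated u S ∪ S.image (fun p =>
      (p.1, p.2 + ∑ q ∈ (K.extra u \ K.isolated u S).filter (fun q => hit q = p), 2 * q.2)) ∧
    (∀ p ∈ S, A.rad p.1 = rad₁ p.1) ∧
    (∀ q ∈ K.isolated u S, A.rad q.1 = rad₂ q.1)

end Clustering

namespace Guess

variable {X : Type*} [PseudoMetricSpace X] {I : Inst X} (G : Guess I)

/-- `A` is a possible output of the first combination subroutine: the cheaper one of the second
solution and the solution extracted from the rounded LP. -/
def IsCombineA (o₁ o₂ : PDOut X) (A : Sol X) : Prop :=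
  ∃ (K : Clustering G o₁.F o₂.F) (v u : Pair X ⊕ Pair X → ℝ) (E : Sol X),
    K.IsOptVertex v ∧ K.IsRounding v u ∧ K.IsExtracted o₁.rad o₂.rad u E ∧
    A = if cost o₂.F ≤ cost E.F then o₂.toSol else E

/-! ### Second combination subroutine -/

/-- The `F₂`-pairs that intersect some pair of `F₁ \ f₁`. -/
def matched (o₁ o₂ : PDOut X) : Finset (Pair X) :=
  o₂.F.filter (fun p => ∃ p' ∈ o₁.core, Intersects p p')

/-- `ψ` maps every matched pair to a pair of `F₁ \ f₁` that it intersects, and the remaining pairs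
of `F₂` to distinct remaining pairs of `F₁ \ f₁`. -/
def IsMatching (o₁ o₂ : PDOut X) (ψ : Pair X → Pair X) : Prop :=
  (∀ p ∈ matched o₁ o₂, ψ p ∈ o₁.core ∧ Intersects p (ψ p)) ∧
  (∀ p ∈ o₂.F \ matched o₁ o₂, ψ p ∈ o₁.core \ (matched o₁ o₂).image ψ) ∧
  Set.InjOn ψ ((o₂.F \ matched o₁ o₂ : Finset (Pair X)) : Set (Pair X))

/-- Swap in the `F₂`-pair `p` for `ψ p`. -/
def swap (o₁ o₂ : PDOut X) (ψ : Pair X → Pair X) (A : Sol X) (p : Pair X) : Sol X where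
  F := insert (p.1, if p ∈ matched o₁ o₂ then p.2 + 2 * (ψ p).2 else p.2) (A.F.erase (ψ p))
  rad := Function.update A.rad p.1 (o₂.rad p.1)

/-- Swap in the pairs of a list one by one until at most `m` clients are uncovered; `none` if this
does not happen. -/
def swapLoop (o₁ o₂ : PDOut X) (ψ : Pair X → Pair X) : List (Pair X) → Sol X → Option (Sol X)
  | [], A => if (G.uncov A.F).card ≤ I.m then some A else none
  | p :: l, A => if (G.uncov A.F).card ≤ I.m then some A
      else swapLoop o₁ o₂ ψ l (swap o₁ o₂ ψ A p)

/-- `B` is a possible output of the second combination subroutine. -/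
def IsCombineB (o₁ o₂ : PDOut X) (B : Sol X) : Prop :=
  ∃ (ψ : Pair X → Pair X) (l : List (Pair X)), IsMatching o₁ o₂ ψ ∧ l.Nodup ∧
    l.toFinset = o₂.F.filter (fun p => (ψ p).2 < p.2) ∧
    B = (G.swapLoop o₁ o₂ ψ l ⟨o₁.core, o₁.rad⟩).getD o₂.toSol

/-! ### The modified ball-selection algorithm -/

/-- One of the two easy ways to get rid of a pair of `F₁`: drop `f₁` and enlarge another pair by
`12 R*`, or merge two pairs whose centres are at distance at most `12 R*`. -/
def IsShortcut (o₁ : PDOut X) (A : Sol X) : Prop :=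
  A.rad = o₁.rad ∧
  ((∃ p ∈ o₁.core, A.F = insert (p.1, p.2 + 12 * G.R) (o₁.core.erase p) ∧
      (G.uncov A.F).card ≤ I.m) ∨
   (∃ p ∈ o₁.F, ∃ p' ∈ o₁.F, p ≠ p' ∧ dist p.1 p'.1 ≤ 12 * G.R ∧
      A.F = insert (p.1, coverRadius p.1 p.2 (I.ball p')) ((o₁.F.erase p).erase p')))

/-- `A` is a possible output of the modified ball-selection algorithm with parameter `ε`, run with
the implementation `pd` of the primal-dual subroutine. The second combination subroutine is
specified, and called, only for `z₁ > (1 + ε) OPT`. -/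
def IsOutput (pd : ℝ → PDOut X) (ε : ℝ) (A : Sol X) : Prop :=
  ((pd 0).F.card ≤ G.k' ∧ A = (pd 0).toSol) ∨
  (G.k' < (pd 0).F.card ∧ ∃ (z : ℝ × ℝ) (FA : Sol X),
    G.IsSearchResult pd ε z ∧ G.IsCombineA (pd z.1) (pd z.2) FA ∧
    ((G.k' < (pd z.1).core.card ∧ A = FA) ∨
     ((pd z.1).core.card ≤ G.k' ∧
      (G.IsShortcut (pd z.1) A ∨
       ((¬ ∃ A', G.IsShortcut (pd z.1) A') ∧
        ((z.1 ≤ (1 + ε) * G.OPT ∧ A = FA) ∨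
         ((1 + ε) * G.OPT < z.1 ∧ ∃ FB : Sol X, G.IsCombineB (pd z.1) (pd z.2) FB ∧
            A = if cost FA.F ≤ cost FB.F then FA else FB)))))))

end Guess

end LBSRO

end

noncomputable section

open scoped Classical

namespace LBSRO

variable {X : Type*} [PseudoMetricSpace X] {I : Inst X}

/-! ### Balls and radii -/

/-! A run of the dual ascent with penalty `z` per pair yields a dual solution of the LP in which the
kept balls are disjoint and tight, while more than `m` clients outside these balls (those active
before the last round) carry the maximal value `γ`. Adding up the tight constraints and comparing
with weak duality cancels the outlier term, so `t` kept radii sum to at most `OPT + (k' - t) z`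
(`PDCert.sum_TI_le_OPT`). Pruning enlarges each kept ball at most threefold, and the last pair `f`
costs `O(R*)`. The dual does not pay the penalty of `f`, so the number of output pairs may exceed
the number of paid ones by one; the rest of the argument deals with this off-by-one.

The search ends with two runs of nearly equal penalty, one with more than `k'` pairs and one with at
most `k'`. Their average with `k'` pairs costs about `3 OPT + 3 z₁`, the `3 z₁` being the unpaid `f`
(`weighted_cost_le`). This average is feasible for the two-constraint LP of the first combination,
whose extreme points have at most two fractional variables, so rounding loses `O(R*)`. Taking the
better of the rounded and the second solution loses a factor `2.0608` (`le_mul_of_le_of_le`). For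
`z₁ ≤ (1 + ε) OPT` the result is `6 * 2.0608 < 12.365`.

For larger `z₁` the first solution consists of exactly `k'` pruned pairs and `f₁`. Here the two
duals are compared: they differ by at most `2 ^ |D'| * δ` per client (`near_of_γ_le`), so disjoint
balls, each tight in one of the runs, can be packed into a single dual solution (`packing_two`).
Having `k' + 1` such balls that avoid more than `m` clients would force `z₁ ≤ (1 + ε) OPT`. If no
shortcut applies, this makes the matching between the two solutions injective. Every swap state that
still leaves more than `m` clients uncovered has `k'` such balls, so it weighs at most `9 OPT` up to
`O(ε OPT + R*)` (`SwapHyp.weight_le`). The next swap costs only `O(R*)`, and if no state becomes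
feasible then the second solution is itself that cheap. -/

theorem Intersects.symm {p q : Pair X} (h : Intersects p q) : Intersects q p := by
  unfold Intersects at *
  rw [dist_comm, add_comm]; exact h

theorem Intersects.mono {p q p' q' : Pair X} (h : Intersects p q) (hp : p.1 = p'.1)
    (hq : q.1 = q'.1) (hp' : p.2 ≤ p'.2) (hq' : q.2 ≤ q'.2) : Intersects p' q' := by
  unfold Intersects at *
  rw [← hp, ← hq]; linarith

theorem intersects_of_fst_eq {p q : Pair X} (h : p.1 = q.1) (hp : 0 ≤ p.2) (hq : 0 ≤ q.2) :
    Intersects p q := by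
  unfold Intersects
  rw [h, dist_self]; positivity

theorem mem_centers {Y : Type*} {P : Finset (Pair Y)} {i : Y} :
    i ∈ centers P ↔ ∃ p ∈ P, p.1 = i :=
  Finset.mem_image

theorem mem_ball {p : Pair X} {j : X} : j ∈ I.ball p ↔ j ∈ I.clients ∧ dist p.1 j ≤ p.2 := by
  simp [Inst.ball]

theorem intersects_of_mem_ball {p q : Pair X} {j : X} (hp : j ∈ I.ball p) (hq : j ∈ I.ball q) :
    Intersects p q := by
  have h1 := (mem_ball.1 hp).2
  have h2 := (mem_ball.1 hq).2
  have := dist_triangle_right p.1 q.1 j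
  unfold Intersects; linarith

theorem ball_subset_ball {p q : Pair X} (h : dist p.1 q.1 + p.2 ≤ q.2) : I.ball p ⊆ I.ball q := by
  intro j hj
  obtain ⟨h1, h2⟩ := mem_ball.1 hj
  refine mem_ball.2 ⟨h1, ?_⟩
  have := dist_triangle_left q.1 j p.1
  linarith

theorem ball_subset_of_fst_eq {p q : Pair X} (h : p.1 = q.1) (h2 : p.2 ≤ q.2) :
    I.ball p ⊆ I.ball q :=
  ball_subset_ball (by rw [h, dist_self]; linarith)

theorem le_coverRadius (i : X) (ρ : ℝ) (S : Finset X) : ρ ≤ coverRadius i ρ S :=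
  (coverRadius_isLeast i ρ S).1.1

theorem dist_le_coverRadius {i j : X} {ρ : ℝ} {S : Finset X} (hj : j ∈ S) :
    dist i j ≤ coverRadius i ρ S :=
  (coverRadius_isLeast i ρ S).1.2 j hj

theorem coverRadius_le {i : X} {ρ r : ℝ} {S : Finset X} (h : ρ ≤ r) (h' : ∀ j ∈ S, dist i j ≤ r) :
    coverRadius i ρ S ≤ r :=
  (coverRadius_isLeast i ρ S).2 ⟨h, h'⟩

theorem Inst.Admissible.mono {p q : Pair X} (h : I.Admissible p) (h1 : p.1 = q.1)
    (h2 : p.2 ≤ q.2) : I.Admissible q := by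
  obtain ⟨a, b, c⟩ := h
  exact ⟨h1 ▸ a, b.trans h2, h1 ▸ c.trans (Finset.card_le_card (ball_subset_of_fst_eq h1 h2))⟩

theorem dist_le_cmax {i j : X} (hi : i ∈ I.facilities) (hj : j ∈ I.clients) :
    dist i j ≤ I.cmax :=
  (Finset.fold_max_le (f := fun ij : X × X => dist ij.1 ij.2) I.cmax).1 le_rfl |>.2 (i, j)
    (Finset.mem_product.2 ⟨hi, hj⟩)

theorem cmax_nonneg : 0 ≤ I.cmax :=
  (Finset.fold_max_le (f := fun ij : X × X => dist ij.1 ij.2) I.cmax).1 le_rfl |>.1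

namespace Guess

variable {G : Guess I}

theorem R_nonneg : 0 ≤ G.R :=
  (Finset.le_inf'_iff _ _).2 fun p hp => (G.admissible p hp).2.1

theorem admissible_of_mem_L' {p : Pair X} (h : p ∈ G.L') : I.Admissible p :=
  (Finset.mem_filter.1 h).2.1

theorem le_R_of_mem_L' {p : Pair X} (h : p ∈ G.L') : p.2 ≤ G.R :=
  (Finset.mem_filter.1 h).2.2

theorem nonneg_of_mem_L' {p : Pair X} (h : p ∈ G.L') : 0 ≤ p.2 :=
  (admissible_of_mem_L' h).2.1

theorem exists_client_of_mem_L' {p : Pair X} (h : p ∈ G.L') :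
    ∃ j ∈ I.clients, p.2 = dist p.1 j := by
  obtain ⟨⟨i, j⟩, hij, rfl⟩ := Finset.mem_image.1 (Finset.mem_filter.1 h).1
  exact ⟨j, (Finset.mem_product.1 hij).2, rfl⟩

theorem D'_subset : G.D' ⊆ I.clients := Finset.filter_subset _ _

/-- A non-empty guess forces at least one facility. The spare unit later absorbs a factor 2 in `2 ^
I.size`. -/
theorem card_D'_lt_size : G.D'.card + 1 ≤ I.size := by
  obtain ⟨p, hp⟩ := G.nonempty
  have h1 : 0 < I.facilities.card := Finset.card_pos.2 ⟨p.1, (G.admissible p hp).1⟩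
  have h2 := Finset.card_le_card (D'_subset (G := G))
  unfold Inst.size; omega

theorem mem_uncov {P : Finset (Pair X)} {j : X} :
    j ∈ G.uncov P ↔ j ∈ G.D' ∧ ∀ p ∈ P, j ∉ I.ball p := by
  simp [uncov]

theorem uncov_subset_of_cover {P Q : Finset (Pair X)}
    (h : ∀ p ∈ P, ∃ q ∈ Q, I.ball p ⊆ I.ball q) : G.uncov Q ⊆ G.uncov P := by
  intro j hj
  rw [mem_uncov] at hj ⊢
  refine ⟨hj.1, fun p hp hjp => ?_⟩
  obtain ⟨q, hq, hpq⟩ := h p hp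
  exact hj.2 q hq (hpq hjp)

/-! ### The dual ascent -/

/-- Invariants of the dual ascent; `τ` is the common value of the active duals. -/
structure AscentInv (G : Guess I) (z : ℝ) (s : Ascent X) (τ : ℝ) : Prop where
  active_sub : s.active ⊆ G.D'
  T_sub : s.T ⊆ G.L'
  nonneg : ∀ j, 0 ≤ s.α j
  le : ∀ j, s.α j ≤ τ
  eq : ∀ j ∈ s.active, s.α j = τ
  feas : ∀ q ∈ G.L', G.load s.α q - z ≤ q.2
  tight : ∀ p ∈ s.T, G.load s.α p - z = p.2
  sep : ∀ p ∈ s.T, ∀ j ∈ s.active, j ∉ I.ball p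
  frozen : ∀ j ∈ G.D', j ∉ s.active →
    ∃ p ∈ s.T, j ∈ I.ball p ∧ ∀ j' ∈ I.ball p ∩ G.D', s.α j' ≤ s.α j

theorem AscentInv.init {z : ℝ} (hz : 0 ≤ z) : G.AscentInv z G.ascentInit 0 := by
  refine ⟨subset_rfl, by simp [ascentInit], by simp [ascentInit], by simp [ascentInit],
    by simp [ascentInit], ?_, by simp [ascentInit], by simp [ascentInit], ?_⟩
  · intro q hq
    have := nonneg_of_mem_L' hq
    simp only [load, ascentInit, Finset.sum_const_zero]; linarith
  · intro j hj hj'; exact absurd hj hj'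

/-- Tight pairs contain no active client, so raising active duals does not change their load and
they stay tight. A client freezes when its value is the current maximum, and the other values in the
ball that freezes it do not move afterwards; this gives `frozen`. -/
theorem AscentInv.step {z τ : ℝ} {s t : Ascent X} (h : G.AscentInv z s τ)
    (hst : G.AscentStep z s t) : ∃ τ', G.AscentInv z t τ' := by
  obtain ⟨-, Δ, hΔ, p, hp, hpT, hα, hfeas, htight, hact, hT, -⟩ := hst
  have hα_act : ∀ j ∈ s.active, t.α j = τ + Δ := fun j hj => by simp [hα, hj, h.eq j hj]
  have hα_in : ∀ j, j ∉ s.active → t.α j = s.α j := fun j hj => by simp [hα, hj]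
  have hα_le : ∀ j, t.α j ≤ τ + Δ := fun j => by
    by_cases hj : j ∈ s.active
    · exact (hα_act j hj).le
    · rw [hα_in j hj]; linarith [h.le j]
  refine ⟨τ + Δ, ?_, ?_, ?_, hα_le, ?_, hfeas, ?_, ?_, ?_⟩
  · rw [hact]; exact Finset.sdiff_subset.trans h.active_sub
  · rw [hT]; exact Finset.insert_subset hp h.T_sub
  · intro j
    by_cases hj : j ∈ s.active
    · rw [hα_act j hj, ← h.eq j hj]; linarith [h.nonneg j]
    · rw [hα_in j hj]; exact h.nonneg j
  · intro j hj
    rw [hact] at hj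
    exact hα_act j (Finset.mem_sdiff.1 hj).1
  · intro q hq
    rw [hT, Finset.mem_insert] at hq
    rcases hq with rfl | hq
    · exact htight
    · rw [← h.tight q hq]
      congr 1
      refine Finset.sum_congr rfl fun j hj => hα_in j fun hj' => ?_
      exact h.sep q hq j hj' (Finset.mem_inter.1 hj).1
  · intro q hq j hj
    rw [hact, Finset.mem_sdiff] at hj
    rw [hT, Finset.mem_insert] at hq
    rcases hq with rfl | hq
    · exact hj.2
    · exact h.sep q hq j hj.1
  · intro j hj hj'
    rw [hT]
    by_cases hja : j ∈ s.active
    · have hjp : j ∈ I.ball p := by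
        by_contra hc
        exact hj' (by rw [hact]; exact Finset.mem_sdiff.2 ⟨hja, hc⟩)
      refine ⟨p, Finset.mem_insert_self _ _, hjp, fun j' _ => ?_⟩
      rw [hα_act j hja]; exact hα_le j'
    · obtain ⟨q, hq, hjq, hle⟩ := h.frozen j hj hja
      refine ⟨q, Finset.mem_insert_of_mem hq, hjq, fun j' hj'q => ?_⟩
      rw [hα_in j hja, hα_in j']
      · exact hle j' hj'q
      · exact fun hc => h.sep q hq j' hc (Finset.mem_inter.1 hj'q).1

theorem AscentInv.of_reachable {z : ℝ} (hz : 0 ≤ z) {s : Ascent X}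
    (hs : Relation.ReflTransGen (G.AscentStep z) G.ascentInit s) : ∃ τ, G.AscentInv z s τ := by
  induction hs with
  | refl => exact ⟨0, AscentInv.init hz⟩
  | tail _ hst ih =>
    obtain ⟨τ, h⟩ := ih
    exact h.step hst

/-- If no ball of `G.L'` met the active set, every active client would have `w j ≥ 1` in a feasible
LP solution, exceeding the outlier budget. So some ball meets it, and the raise is the least ratio
of slack to number of active clients. -/
theorem AscentInv.exists_step {z τ : ℝ} {s : Ascent X} (h : G.AscentInv z s τ)
    (hG : G.LPFeasible) (hm : I.m < s.active.card) : ∃ t, G.AscentStep z s t := by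
  obtain ⟨y, w, hy, hw, hcov, -, hwm⟩ := hG
  set Q := G.L'.filter (fun p => (I.ball p ∩ s.active).Nonempty) with hQ
  have hQne : Q.Nonempty := by
    by_contra hne
    rw [Finset.not_nonempty_iff_eq_empty] at hne
    have h1 : ∀ j ∈ s.active, (1 : ℝ) ≤ w j := by
      intro j hj
      have h2 := hcov j (h.active_sub hj)
      have h3 : G.L'.filter (fun p => j ∈ I.ball p) = ∅ := by
        rw [Finset.filter_eq_empty_iff]
        intro p hp hjp
        have : p ∈ Q := Finset.mem_filter.2 ⟨hp, j, Finset.mem_inter.2 ⟨hjp, hj⟩⟩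
        rw [hne] at this
        exact absurd this (Finset.notMem_empty _)
      rw [h3] at h2
      simpa using h2
    have h4 : (s.active.card : ℝ) ≤ ∑ j ∈ G.D', w j := by
      calc (s.active.card : ℝ) = ∑ j ∈ s.active, (1 : ℝ) := by simp
        _ ≤ ∑ j ∈ s.active, w j := Finset.sum_le_sum h1
        _ ≤ ∑ j ∈ G.D', w j :=
          Finset.sum_le_sum_of_subset_of_nonneg h.active_sub fun j hj _ => hw j hj
    have : (s.active.card : ℝ) ≤ I.m := h4.trans hwm
    have : s.active.card ≤ I.m := by exact_mod_cast this
    omega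
  obtain ⟨p, hpQ, hpmin⟩ := Finset.exists_min_image Q
    (fun p => (p.2 + z - G.load s.α p) / ((I.ball p ∩ s.active).card : ℝ)) hQne
  set Δ := (p.2 + z - G.load s.α p) / ((I.ball p ∩ s.active).card : ℝ) with hΔ
  obtain ⟨hpL, hpne⟩ := Finset.mem_filter.1 hpQ
  have hΔ0 : 0 ≤ Δ := div_nonneg (by linarith [h.feas p hpL]) (by positivity)
  have hload : ∀ q, G.load (fun j => if j ∈ s.active then s.α j + Δ else s.α j) q =
      G.load s.α q + (I.ball q ∩ s.active).card * Δ := by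
    intro q
    have h1 : ∀ j, (if j ∈ s.active then s.α j + Δ else s.α j) =
        s.α j + if j ∈ s.active then Δ else 0 := by intro j; split_ifs <;> simp
    have h2 : (I.ball q ∩ G.D').filter (fun j => j ∈ s.active) = I.ball q ∩ s.active := by
      ext j
      simp only [Finset.mem_filter, Finset.mem_inter]
      exact ⟨fun h => ⟨h.1.1, h.2⟩, fun hj => ⟨⟨hj.1, h.active_sub hj.2⟩, hj.2⟩⟩
    simp only [load, h1, Finset.sum_add_distrib, ← Finset.sum_filter, h2, Finset.sum_const,
      nsmul_eq_mul]
  have hpos : ∀ q ∈ Q, (0 : ℝ) < (I.ball q ∩ s.active).card := fun q hq => by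
    exact_mod_cast Finset.card_pos.2 (Finset.mem_filter.1 hq).2
  refine ⟨⟨_, s.active \ I.ball p, insert p s.T, some p⟩, hm, Δ, hΔ0, p, hpL, ?_, rfl, ?_, ?_,
    rfl, rfl, rfl⟩
  · intro hpT
    obtain ⟨j, hj⟩ := hpne
    rw [Finset.mem_inter] at hj
    exact h.sep p hpT j hj.2 hj.1
  · intro q hq
    change G.load (fun j => if j ∈ s.active then s.α j + Δ else s.α j) q - z ≤ q.2
    rw [hload]
    by_cases hne : (I.ball q ∩ s.active).Nonempty
    · have hqQ : q ∈ Q := Finset.mem_filter.2 ⟨hq, hne⟩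
      have h1 := hpmin q hqQ
      rw [le_div_iff₀ (hpos q hqQ)] at h1
      linarith
    · rw [Finset.not_nonempty_iff_eq_empty] at hne
      rw [hne]
      simpa using h.feas q hq
  · change G.load (fun j => if j ∈ s.active then s.α j + Δ else s.α j) p - z = p.2
    rw [hload, hΔ, mul_div_cancel₀ _ (hpos p hpQ).ne']
    ring

/-- Each round adds a new pair of the finite set `G.L'`, so the number of missing pairs is a
termination measure. -/
theorem exists_ascent_end {z : ℝ} (hz : 0 ≤ z) (hG : G.LPFeasible) :
    ∃ s, Relation.ReflTransGen (G.AscentStep z) G.ascentInit s ∧ s.active.card ≤ I.m := by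
  have key : ∀ n : ℕ, ∀ s, Relation.ReflTransGen (G.AscentStep z) G.ascentInit s →
      G.L'.card - s.T.card ≤ n →
      ∃ s, Relation.ReflTransGen (G.AscentStep z) G.ascentInit s ∧ s.active.card ≤ I.m := by
    intro n
    induction n with
    | zero =>
      intro s hs hn
      by_cases hm : s.active.card ≤ I.m
      · exact ⟨s, hs, hm⟩
      · obtain ⟨τ, h⟩ := AscentInv.of_reachable hz hs
        obtain ⟨t, -, -, -, p, hp, hpT, -⟩ := h.exists_step hG (not_le.1 hm)
        have := Finset.card_lt_card
          (Finset.ssubset_iff_of_subset h.T_sub |>.2 ⟨p, hp, hpT⟩)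
        omega
    | succ n ih =>
      intro s hs hn
      by_cases hm : s.active.card ≤ I.m
      · exact ⟨s, hs, hm⟩
      · obtain ⟨τ, h⟩ := AscentInv.of_reachable hz hs
        obtain ⟨t, hst⟩ := h.exists_step hG (not_le.1 hm)
        refine ih t (hs.tail hst) ?_
        obtain ⟨-, -, -, p, hp, hpT, -, -, -, -, hT, -⟩ := hst
        have := Finset.card_lt_card
          (Finset.ssubset_iff_of_subset h.T_sub |>.2 ⟨p, hp, hpT⟩)
        rw [hT, Finset.card_insert_of_notMem hpT]
        omega
  exact key _ _ .refl le_rfl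

/-- What the dual ascent provides when it performs at least one round: `act` is the set of active
clients before the last round, `f` the pair of the last round and `T` the set of earlier ones. -/
structure DualCert (G : Guess I) (z : ℝ) where
  α : X → ℝ
  γ : ℝ
  act : Finset X
  T : Finset (Pair X)
  f : Pair X
  nonneg : ∀ j, 0 ≤ α j
  le : ∀ j, α j ≤ γ
  feas : ∀ q ∈ G.L', G.load α q ≤ q.2 + z
  act_sub : act ⊆ G.D'
  act_card : I.m < act.card
  act_eq : ∀ j ∈ act, α j = γ
  T_sub : T ⊆ G.L'
  f_mem : f ∈ G.L'
  T_tight : ∀ p ∈ T, G.load α p = p.2 + z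
  f_tight : G.load α f = f.2 + z
  T_sep : ∀ p ∈ T, ∀ j ∈ act, j ∉ I.ball p
  T_cover : ∀ j ∈ G.D', j ∉ act → ∃ p ∈ T, j ∈ I.ball p ∧ ∀ j' ∈ I.ball p ∩ G.D', α j' ≤ α j
  f_last : (act \ I.ball f).card ≤ I.m

/-- The certificate straddles the last round: duals and `γ` are taken after it, the active set and
`T` before it. Thus more than `m` clients have value `γ` and avoid all of `T`, while `f` brings the
number of active clients down to at most `m`. -/
theorem dualCert_of_ascent {z : ℝ} (hz : 0 ≤ z) {s : Ascent X}
    (hs : Relation.ReflTransGen (G.AscentStep z) G.ascentInit s) (hm : s.active.card ≤ I.m) :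
    (s = G.ascentInit ∧ G.D'.card ≤ I.m) ∨
      ∃ c : G.DualCert z, s.last = some c.f ∧ s.T \ s.last.toFinset = c.T := by
  rcases Relation.ReflTransGen.cases_tail hs with h | ⟨s', hs', hstep⟩
  · left
    refine ⟨h, ?_⟩
    rw [h] at hm
    exact hm
  · right
    obtain ⟨τ, h'⟩ := AscentInv.of_reachable hz hs'
    obtain ⟨hm', Δ, hΔ, p, hp, hpT, hα, hfeas, htight, hact, hT, hlast⟩ := hstep
    have hα_in : ∀ j, j ∉ s'.active → s.α j = s'.α j := fun j hj => by simp [hα, hj]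
    have hα_act : ∀ j ∈ s'.active, s.α j = τ + Δ := fun j hj => by simp [hα, hj, h'.eq j hj]
    refine ⟨⟨s.α, τ + Δ, s'.active, s'.T, p, ?_, ?_, ?_, h'.active_sub, hm', hα_act, h'.T_sub, hp,
      ?_, by linarith, h'.sep, ?_, hact ▸ hm⟩, hlast, ?_⟩
    · intro j
      by_cases hj : j ∈ s'.active
      · rw [hα_act j hj, ← h'.eq j hj]; linarith [h'.nonneg j]
      · rw [hα_in j hj]; exact h'.nonneg j
    · intro j
      by_cases hj : j ∈ s'.active
      · exact (hα_act j hj).le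
      · rw [hα_in j hj]; linarith [h'.le j]
    · intro q hq; linarith [hfeas q hq]
    · intro q hq
      have h1 : G.load s.α q = G.load s'.α q :=
        Finset.sum_congr rfl fun j hj => hα_in j fun hj' =>
          h'.sep q hq j hj' (Finset.mem_inter.1 hj).1
      rw [h1]; linarith [h'.tight q hq]
    · intro j hj hja
      obtain ⟨q, hq, hjq, hle⟩ := h'.frozen j hj hja
      refine ⟨q, hq, hjq, fun j' hj'q => ?_⟩
      rw [hα_in j hja, hα_in j']
      · exact hle j' hj'q
      · exact fun hc => h'.sep q hq j' hc (Finset.mem_inter.1 hj'q).1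
    · rw [hT, hlast]
      ext q
      simp only [Option.toFinset_some, Finset.mem_sdiff, Finset.mem_insert, Finset.mem_singleton]
      constructor
      · rintro ⟨h1 | h1, h2⟩
        · exact absurd h1 h2
        · exact h1
      · intro h1
        exact ⟨Or.inr h1, fun h2 => hpT (h2 ▸ h1)⟩

/-! ### Weak duality and packing of tight balls. -/

namespace DualCert

variable {z : ℝ} (c : G.DualCert z)

/-- The dual objective, without the term `- k' z`. -/
def val : ℝ := ∑ j ∈ G.D', c.α j - I.m * c.γ

theorem γ_nonneg : 0 ≤ c.γ := by
  obtain ⟨j, hj⟩ := Finset.card_pos.1 (Nat.zero_lt_of_lt c.act_card)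
  exact (c.nonneg j).trans (c.le j)

/-- The covering constraints are weighted by `α` and the sums exchanged; the outlier variables are
paid for by `α ≤ γ`. -/
theorem weak_duality (hz : 0 ≤ z) {y : Pair X → ℝ} {w : X → ℝ} (h : G.LPSol y w) :
    c.val - G.k' * z ≤ ∑ p ∈ G.L', p.2 * y p := by
  obtain ⟨hy, hw, hcov, hk, hm⟩ := h
  have h1 : ∑ p ∈ G.L', (G.load c.α p - z) * y p ≤ ∑ p ∈ G.L', p.2 * y p :=
    Finset.sum_le_sum fun p hp =>
      mul_le_mul_of_nonneg_right (by linarith [c.feas p hp]) (hy p hp)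
  have h2 : ∑ p ∈ G.L', G.load c.α p * y p =
      ∑ j ∈ G.D', c.α j * ∑ p ∈ G.L'.filter (fun p => j ∈ I.ball p), y p := by
    have : ∀ p, G.load c.α p = ∑ j ∈ G.D', if j ∈ I.ball p then c.α j else 0 := by
      intro p
      rw [← Finset.sum_filter]
      refine Finset.sum_congr ?_ fun _ _ => rfl
      ext j; simp [and_comm]
    simp only [this, Finset.sum_mul, Finset.mul_sum, Finset.sum_filter]
    rw [Finset.sum_comm]
    refine Finset.sum_congr rfl fun j _ => Finset.sum_congr rfl fun p _ => ?_
    split_ifs <;> simp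
  have h3 : ∑ j ∈ G.D', c.α j - c.γ * ∑ j ∈ G.D', w j ≤
      ∑ j ∈ G.D', c.α j * ∑ p ∈ G.L'.filter (fun p => j ∈ I.ball p), y p := by
    rw [Finset.mul_sum, ← Finset.sum_sub_distrib]
    refine Finset.sum_le_sum fun j hj => ?_
    have a1 := hcov j hj
    have a2 := c.le j
    have a3 := mul_le_mul_of_nonneg_left a1 (c.nonneg j)
    have a4 := mul_le_mul_of_nonneg_right a2 (hw j hj)
    linarith
  have h4 : ∑ p ∈ G.L', (G.load c.α p - z) * y p =
      ∑ p ∈ G.L', G.load c.α p * y p - z * ∑ p ∈ G.L', y p := by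
    rw [Finset.mul_sum, ← Finset.sum_sub_distrib]
    exact Finset.sum_congr rfl fun _ _ => by ring
  have h5 := mul_le_mul_of_nonneg_left hk hz
  have h6 := mul_le_mul_of_nonneg_left hm c.γ_nonneg
  unfold val
  linarith

theorem val_le (hz : 0 ≤ z) (hG : G.LPFeasible) : c.val ≤ G.OPT + G.k' * z := by
  obtain ⟨y, w, h⟩ := hG
  have : c.val - G.k' * z ≤ G.OPT := by
    refine le_csInf ⟨_, y, w, h, rfl⟩ ?_
    rintro v ⟨y, w, h, rfl⟩
    exact c.weak_duality hz h
  linarith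

/-- Disjoint nearly tight balls that avoid enough clients of nearly maximal dual value bound the
dual objective from below. -/
theorem packing {ι : Type*} (s : Finset ι) (B : ι → Pair X) {η : ℝ} (hη : 0 ≤ η)
    (htight : ∀ i ∈ s, (B i).2 + z ≤ ∑ j ∈ I.ball (B i) ∩ G.D', (c.α j + η))
    (hdisj : ∀ i ∈ s, ∀ i' ∈ s, i ≠ i' → ¬ Intersects (B i) (B i'))
    (U : Finset X) (hU : U ⊆ G.D') (hsep : ∀ i ∈ s, ∀ j ∈ U, j ∉ I.ball (B i))
    (hγ : ∀ j ∈ U, c.γ ≤ c.α j + η) :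
    ∑ i ∈ s, (B i).2 + s.card * z + U.card * c.γ ≤ ∑ j ∈ G.D', c.α j + G.D'.card * η := by
  have hd : (s : Set ι).PairwiseDisjoint (fun i => I.ball (B i) ∩ G.D') := by
    intro i hi i' hi' hne
    refine Finset.disjoint_left.2 fun j hj hj' => ?_
    exact hdisj i hi i' hi' hne
      (intersects_of_mem_ball (Finset.mem_inter.1 hj).1 (Finset.mem_inter.1 hj').1)
  have hd2 : Disjoint (s.biUnion (fun i => I.ball (B i) ∩ G.D')) U := by
    refine Finset.disjoint_left.2 fun j hj hj' => ?_
    obtain ⟨i, hi, hji⟩ := Finset.mem_biUnion.1 hj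
    exact hsep i hi j hj' (Finset.mem_inter.1 hji).1
  have h1 : ∑ i ∈ s, (B i).2 + s.card * z ≤
      ∑ j ∈ s.biUnion (fun i => I.ball (B i) ∩ G.D'), (c.α j + η) := by
    rw [Finset.sum_biUnion hd]
    calc ∑ i ∈ s, (B i).2 + s.card * z = ∑ i ∈ s, ((B i).2 + z) := by
          rw [Finset.sum_add_distrib]; simp
      _ ≤ _ := Finset.sum_le_sum htight
  have h2 : U.card * c.γ ≤ ∑ j ∈ U, (c.α j + η) := by
    calc U.card * c.γ = ∑ j ∈ U, c.γ := by simp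
      _ ≤ _ := Finset.sum_le_sum hγ
  calc ∑ i ∈ s, (B i).2 + s.card * z + U.card * c.γ
      ≤ ∑ j ∈ s.biUnion (fun i => I.ball (B i) ∩ G.D'), (c.α j + η) + ∑ j ∈ U, (c.α j + η) :=
        add_le_add h1 h2
    _ = ∑ j ∈ s.biUnion (fun i => I.ball (B i) ∩ G.D') ∪ U, (c.α j + η) :=
        (Finset.sum_union hd2).symm
    _ ≤ ∑ j ∈ G.D', (c.α j + η) := by
        refine Finset.sum_le_sum_of_subset_of_nonneg ?_ fun j _ _ => add_nonneg (c.nonneg j) hη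
        exact Finset.union_subset
          (Finset.biUnion_subset.2 fun i _ => Finset.inter_subset_right) hU
    _ = _ := by rw [Finset.sum_add_distrib]; simp

/-- For clients deactivated in the last round the witness is `f`, since they have the maximal value
`γ`. All but at most `m` clients thus lie in a tight ball in which their dual is largest; this
drives the comparison of two runs. -/
theorem exists_frozen {j : X} (hj : j ∈ G.D') (hj' : j ∉ c.act \ I.ball c.f) :
    ∃ p ∈ G.L', G.load c.α p = p.2 + z ∧ j ∈ I.ball p ∧
      ∀ j' ∈ I.ball p ∩ G.D', c.α j' ≤ c.α j := by
  by_cases hja : j ∈ c.act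
  · have hjf : j ∈ I.ball c.f := by
      by_contra hc
      exact hj' (Finset.mem_sdiff.2 ⟨hja, hc⟩)
    refine ⟨c.f, c.f_mem, c.f_tight, hjf, fun j' _ => ?_⟩
    rw [c.act_eq j hja]; exact c.le j'
  · obtain ⟨p, hp, h⟩ := c.T_cover j hj hja
    exact ⟨p, c.T_sub hp, c.T_tight p hp, h⟩

end DualCert

end Guess

/-! ### The greedy scan -/

/-- Generalised over the accumulator for the induction. By the sorting, a pair that blocks a later
one has at least its radius. -/
theorem greedy_foldl_spec (l : List (Pair X)) (S : Finset (Pair X))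
    (hl : ∀ p ∈ l, 0 ≤ p.2) (hsort : l.Pairwise (fun p q => q.2 ≤ p.2))
    (hS : ∀ q ∈ S, ∀ p ∈ l, p.2 ≤ q.2)
    (hdisj : ∀ p ∈ S, ∀ q ∈ S, p ≠ q → ¬ Intersects p q) :
    let R := l.foldl (fun S p => if ∀ q ∈ S, ¬ Intersects p q then insert p S else S) S
    S ⊆ R ∧ R ⊆ S ∪ l.toFinset ∧ (∀ p ∈ R, ∀ q ∈ R, p ≠ q → ¬ Intersects p q) ∧
      ∀ p ∈ l, ∃ q ∈ R, p.2 ≤ q.2 ∧ Intersects p q := by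
  induction l generalizing S with
  | nil => exact ⟨subset_rfl, by simp, hdisj, by simp⟩
  | cons a l ih =>
    intro R
    rw [List.pairwise_cons] at hsort
    have hl' : ∀ p ∈ l, 0 ≤ p.2 := fun p hp => hl p (List.mem_cons_of_mem _ hp)
    by_cases hc : ∀ q ∈ S, ¬ Intersects a q
    · have hR : R = l.foldl (fun S p => if ∀ q ∈ S, ¬ Intersects p q then insert p S else S)
          (insert a S) := by
        simp only [R, List.foldl_cons, if_pos hc]
      obtain ⟨h1, h2, h3, h4⟩ := ih (insert a S) hl' hsort.2
        (by
          intro q hq p hp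
          rcases Finset.mem_insert.1 hq with rfl | hq
          · exact hsort.1 p hp
          · exact hS q hq p (List.mem_cons_of_mem _ hp))
        (by
          intro p hp q hq hne
          rcases Finset.mem_insert.1 hp with rfl | hp' <;>
            rcases Finset.mem_insert.1 hq with rfl | hq'
          · exact absurd rfl hne
          · exact hc q hq'
          · exact fun h => hc p hp' h.symm
          · exact hdisj p hp' q hq' hne)
      rw [hR]
      refine ⟨(Finset.subset_insert _ _).trans h1, h2.trans ?_, h3, ?_⟩
      · intro x hx
        simp only [Finset.mem_union, Finset.mem_insert, List.mem_toFinset, List.mem_cons] at hx ⊢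
        tauto
      · intro p hp
        rcases List.mem_cons.1 hp with rfl | hp
        · exact ⟨p, h1 (Finset.mem_insert_self _ _), le_rfl,
            intersects_of_fst_eq rfl (hl p hp) (hl p hp)⟩
        · exact h4 p hp
    · have hR : R = l.foldl (fun S p => if ∀ q ∈ S, ¬ Intersects p q then insert p S else S) S := by
        simp only [R, List.foldl_cons, if_neg hc]
      obtain ⟨h1, h2, h3, h4⟩ := ih S hl' hsort.2
        (fun q hq p hp => hS q hq p (List.mem_cons_of_mem _ hp)) hdisj
      rw [hR]
      refine ⟨h1, h2.trans ?_, h3, ?_⟩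
      · intro x hx
        simp only [Finset.mem_union, List.mem_toFinset, List.mem_cons] at hx ⊢
        tauto
      · intro p hp
        rcases List.mem_cons.1 hp with rfl | hp
        · push Not at hc
          obtain ⟨q, hq, hpq⟩ := hc
          exact ⟨q, h1 hq, hS q hq p (List.mem_cons_self ..), hpq⟩
        · exact h4 p hp

theorem IsGreedySubset.spec {T TI : Finset (Pair X)} (h : IsGreedySubset T TI)
    (hT : ∀ p ∈ T, 0 ≤ p.2) :
    TI ⊆ T ∧ (∀ p ∈ TI, ∀ q ∈ TI, p ≠ q → ¬ Intersects p q) ∧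
      ∀ p ∈ T, ∃ q ∈ TI, p.2 ≤ q.2 ∧ Intersects p q := by
  obtain ⟨l, -, rfl, hsort, rfl⟩ := h
  obtain ⟨-, h2, h3, h4⟩ := greedy_foldl_spec l ∅ (fun p hp => hT p (List.mem_toFinset.2 hp)) hsort
    (by simp) (by simp)
  refine ⟨h2.trans (by simp), h3, fun p hp => h4 p (List.mem_toFinset.1 hp)⟩

theorem exists_isGreedySubset (T : Finset (Pair X)) : ∃ TI, IsGreedySubset T TI := by
  set r : Pair X → Pair X → Bool := fun p q => decide (q.2 ≤ p.2) with hr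
  refine ⟨_, T.toList.mergeSort r, (List.mergeSort_perm _ _).nodup_iff.2 T.nodup_toList, ?_, ?_,
    rfl⟩
  · ext p; simp
  · have := List.pairwise_mergeSort (le := r)
      (fun a b c hab hbc => by simp [hr] at hab hbc ⊢; exact hbc.trans hab)
      (fun a b => by simpa [hr] using le_total b.2 a.2) T.toList
    exact this.imp (by simp [hr])

theorem cost_insert_le {Y : Type*} {S : Finset (Pair Y)} {a : Pair Y} (ha : 0 ≤ a.2) :
    cost (insert a S) ≤ a.2 + cost S := by
  unfold cost
  by_cases h : a ∈ S
  · rw [Finset.insert_eq_of_mem h]; linarith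
  · rw [Finset.sum_insert h]

theorem cost_erase {Y : Type*} {S : Finset (Pair Y)} {a : Pair Y} (ha : a ∈ S) :
    cost (S.erase a) = cost S - a.2 := by
  unfold cost
  rw [← Finset.add_sum_erase S _ ha]; ring

theorem cost_mono {Y : Type*} {S T : Finset (Pair Y)} (h : S ⊆ T) (hT : ∀ p ∈ T, 0 ≤ p.2) :
    cost S ≤ cost T :=
  Finset.sum_le_sum_of_subset_of_nonneg h fun p hp _ => hT p hp

namespace Guess

variable {G : Guess I}

/-! ### Outputs of the primal-dual subroutine -/

/-- The record of a run of the primal-dual subroutine in which at least one pair became tight. -/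
structure PDCert (G : Guess I) (z : ℝ) (o : PDOut X) extends DualCert G z where
  TI : Finset (Pair X)
  o_f : o.f = some f
  TI_sub : TI ⊆ T
  TI_disj : ∀ p ∈ TI, ∀ q ∈ TI, p ≠ q → ¬ Intersects p q
  TI_dom : ∀ p ∈ T, ∃ q ∈ TI, p.2 ≤ q.2 ∧ Intersects p q
  rad_TI : ∀ p ∈ TI, o.rad p.1 = p.2
  pruned : Finset (Pair X)
  pruned_eq : pruned = TI.image (fun p => (p.1, prunedRadius (I := I) T p))
  branch : ((G.uncov pruned).card ≤ I.m ∧ o.F = pruned) ∨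
    (∃ p ∈ pruned, dist p.1 f.1 ≤ 2 * G.R ∧
        o.F = insert (p.1, coverRadius p.1 p.2 (I.ball f)) (pruned.erase p)) ∨
    (I.m < (G.uncov pruned).card ∧ (∀ p ∈ pruned, 2 * G.R < dist p.1 f.1) ∧
        o.F = insert f pruned ∧ o.rad f.1 = f.2)

theorem IsPDOut.trivial_or_cert {z : ℝ} (hz : 0 ≤ z) {o : PDOut X} (h : G.IsPDOut z o) :
    (o.F = ∅ ∧ G.D'.card ≤ I.m) ∨ Nonempty (G.PDCert z o) := by
  obtain ⟨s, hs, hm, hf, TI, F', hTI, hrad, hF', hbr⟩ := h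
  rcases dualCert_of_ascent hz hs hm with ⟨rfl, hD⟩ | ⟨c, hlast, hT⟩
  · left
    refine ⟨?_, hD⟩
    have hTI' : TI = ∅ := by
      have := (hTI.spec (by simp [ascentInit])).1
      simpa [ascentInit] using this
    have hF'' : F' = ∅ := by rw [hF', hTI', Finset.image_empty]
    rcases hbr with ⟨-, h⟩ | ⟨-, f, hf', -⟩
    · rw [h, hF'']
    · simp [ascentInit] at hf'
  · right
    rw [hT] at hTI hF'
    obtain ⟨h1, h2, h3⟩ := hTI.spec fun p hp => nonneg_of_mem_L' (c.T_sub hp)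
    refine ⟨⟨c, TI, hf.trans hlast, h1, h2, h3, hrad, F', hF', ?_⟩⟩
    rcases hbr with h | ⟨hm', f, hf', h⟩
    · exact Or.inl h
    · have : f = c.f := by rw [hlast] at hf'; exact (Option.some.inj hf').symm
      subst this
      rcases h with h | h
      · exact Or.inr (Or.inl h)
      · exact Or.inr (Or.inr ⟨hm', h⟩)

theorem exists_isPDOut {z : ℝ} (hz : 0 ≤ z) (hG : G.LPFeasible) : ∃ o, G.IsPDOut z o := by
  obtain ⟨s, hs, hm⟩ := exists_ascent_end hz hG
  obtain ⟨TI, hTI⟩ := exists_isGreedySubset (s.T \ s.last.toFinset)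
  set F' := TI.image (fun p => (p.1, prunedRadius (I := I) (s.T \ s.last.toFinset) p)) with hF'
  obtain ⟨τ, hinv⟩ := AscentInv.of_reachable hz hs
  have hnn : ∀ p ∈ s.T \ s.last.toFinset, 0 ≤ p.2 := fun p hp =>
    nonneg_of_mem_L' (hinv.T_sub (Finset.mem_sdiff.1 hp).1)
  obtain ⟨hTIsub, hTId, -⟩ := hTI.spec hnn
  -- Kept pairs do not intersect, hence have distinct centres, so one radius per facility is well
  -- defined. The default is the radius of `f`, needed when `f` is added as a separate pair.
  set rad : X → ℝ := fun i => if h : ∃ p ∈ TI, p.1 = i then h.choose.2 else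
    (s.last.elim 0 Prod.snd) with hrad
  have hradTI : ∀ p ∈ TI, rad p.1 = p.2 := by
    intro p hp
    have h : ∃ q ∈ TI, q.1 = p.1 := ⟨p, hp, rfl⟩
    have h2 : rad p.1 = h.choose.2 := dif_pos h
    have h3 := h.choose_spec
    have h4 : h.choose = p := by
      by_contra hne
      exact hTId _ h3.1 p hp hne
        (intersects_of_fst_eq h3.2 (hnn _ (hTIsub h3.1)) (hnn _ (hTIsub hp)))
    rw [h2, h4]
  by_cases hu : (G.uncov F').card ≤ I.m
  · exact ⟨⟨⟨F', rad⟩, s.last⟩, s, hs, hm, rfl, TI, F', hTI, hradTI, hF', Or.inl ⟨hu, rfl⟩⟩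
  · rcases dualCert_of_ascent hz hs hm with ⟨-, hD⟩ | ⟨c, hlast, hT⟩
    · exact absurd ((Finset.card_le_card (Finset.filter_subset _ _)).trans hD) hu
    · by_cases hf : ∃ p ∈ F', dist p.1 c.f.1 ≤ 2 * G.R
      · obtain ⟨p, hp, hpf⟩ := hf
        exact ⟨⟨⟨insert (p.1, coverRadius p.1 p.2 (I.ball c.f)) (F'.erase p), rad⟩, s.last⟩,
          s, hs, hm, rfl, TI, F', hTI, hradTI, hF',
          Or.inr ⟨not_le.1 hu, c.f, hlast, Or.inl ⟨p, hp, hpf, rfl⟩⟩⟩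
      · push Not at hf
        refine ⟨⟨⟨insert c.f F', rad⟩, s.last⟩, s, hs, hm, rfl, TI, F', hTI, hradTI, hF',
          Or.inr ⟨not_le.1 hu, c.f, hlast, Or.inr ⟨hf, rfl, ?_⟩⟩⟩
        -- In this branch `f` is farther than `2 * G.R ≥ 0` from every kept centre, so `rad` takes
        -- its default value at `f`.
        have : ¬ ∃ p ∈ TI, p.1 = c.f.1 := by
          rintro ⟨p, hp, hpf⟩
          have h1 := hf _ (Finset.mem_image_of_mem _ hp)
          simp only [hpf, dist_self] at h1
          linarith [R_nonneg (G := G)]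
        change rad c.f.1 = c.f.2
        rw [hrad]
        simp only [dif_neg this, hlast, Option.elim_some]

/-! ### Radii, coverage, cardinality and cost of a single run. -/

namespace PDCert

variable {z : ℝ} {o : PDOut X}

/-- A client of an intersecting ball of radius `r' ≤ r` is at distance at most `r + r' + r'`. -/
theorem prunedRadius_le (c : G.PDCert z o) {p : Pair X} (hp : p ∈ c.TI) :
    prunedRadius (I := I) c.T p ≤ 3 * p.2 := by
  have hp0 : 0 ≤ p.2 := nonneg_of_mem_L' (c.T_sub (c.TI_sub hp))
  refine coverRadius_le (by linarith) fun j hj => ?_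
  obtain ⟨q, hq, hjq⟩ := Finset.mem_biUnion.1 hj
  obtain ⟨-, hqp, hint⟩ := Finset.mem_filter.1 hq
  have h1 := (mem_ball.1 hjq).2
  have h2 := dist_triangle_left p.1 j q.1
  unfold Intersects at hint
  linarith

theorem ball_subset_prunedRadius (c : G.PDCert z o) {p q : Pair X} (hq : q ∈ c.T) (hqp : q.2 ≤ p.2)
    (h : Intersects q p) : I.ball q ⊆ I.ball (p.1, prunedRadius (I := I) c.T p) := fun _ hj =>
  mem_ball.2 ⟨(mem_ball.1 hj).1, dist_le_coverRadius
    (Finset.mem_biUnion.2 ⟨q, Finset.mem_filter.2 ⟨hq, hqp, h⟩, hj⟩)⟩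

/-- Radii in `G.L'` are facility-client distances, so the pair has a client on its boundary and
covering its own ball already needs the full radius. -/
theorem le_prunedRadius (c : G.PDCert z o) {p : Pair X} (hp : p ∈ c.TI) :
    p.2 ≤ prunedRadius (I := I) c.T p := by
  have hpL := c.T_sub (c.TI_sub hp)
  have hp0 : 0 ≤ p.2 := nonneg_of_mem_L' hpL
  obtain ⟨j, hj, hpj⟩ := exists_client_of_mem_L' hpL
  have h1 : j ∈ I.ball p := mem_ball.2 ⟨hj, hpj.ge⟩
  rw [hpj]
  exact (mem_ball.1 (c.ball_subset_prunedRadius (c.TI_sub hp) le_rfl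
    (intersects_of_fst_eq rfl hp0 hp0) h1)).2

theorem TI_eq_of_fst_eq (c : G.PDCert z o) {p q : Pair X} (hp : p ∈ c.TI) (hq : q ∈ c.TI) (h : p.1 = q.1) :
    p = q := by
  by_contra hne
  exact c.TI_disj p hp q hq hne (intersects_of_fst_eq h
    (nonneg_of_mem_L' (c.T_sub (c.TI_sub hp))) (nonneg_of_mem_L' (c.T_sub (c.TI_sub hq))))

theorem card_pruned (c : G.PDCert z o) : c.pruned.card = c.TI.card := by
  rw [c.pruned_eq]
  refine Finset.card_image_of_injOn fun p hp q hq h => ?_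
  exact c.TI_eq_of_fst_eq hp hq (Prod.ext_iff.1 h).1

theorem cost_pruned (c : G.PDCert z o) : cost c.pruned ≤ 3 * ∑ p ∈ c.TI, p.2 := by
  rw [c.pruned_eq, cost, Finset.sum_image, Finset.mul_sum]
  · exact Finset.sum_le_sum fun p hp => c.prunedRadius_le hp
  · intro p hp q hq h
    exact c.TI_eq_of_fst_eq hp hq (Prod.ext_iff.1 h).1

theorem pruned_spec (c : G.PDCert z o) {p : Pair X} (hp : p ∈ c.pruned) :
    (p.1, o.rad p.1) ∈ c.TI ∧ o.rad p.1 ≤ p.2 ∧ p.2 ≤ 3 * o.rad p.1 := by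
  rw [c.pruned_eq] at hp
  obtain ⟨q, hq, rfl⟩ := Finset.mem_image.1 hp
  simp only [c.rad_TI q hq]
  exact ⟨hq, c.le_prunedRadius hq, c.prunedRadius_le hq⟩

theorem pruned_eq_of_fst_eq (c : G.PDCert z o) {p q : Pair X} (hp : p ∈ c.pruned) (hq : q ∈ c.pruned)
    (h : p.1 = q.1) : p = q := by
  rw [c.pruned_eq] at hp hq
  obtain ⟨p', hp', rfl⟩ := Finset.mem_image.1 hp
  obtain ⟨q', hq', rfl⟩ := Finset.mem_image.1 hq
  rw [c.TI_eq_of_fst_eq hp' hq' h]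

theorem pruned_cover (c : G.PDCert z o) {q : Pair X} (hq : q ∈ c.T) : ∃ p ∈ c.pruned, I.ball q ⊆ I.ball p := by
  obtain ⟨p, hp, hqp, h⟩ := c.TI_dom q hq
  refine ⟨(p.1, prunedRadius (I := I) c.T p), ?_, c.ball_subset_prunedRadius hq hqp h⟩
  rw [c.pruned_eq]
  exact Finset.mem_image_of_mem _ hp

/-- Clients inactive before the last round lie in a ball of `T`, and each of these is swallowed by
the kept pair that dominates it. -/
theorem uncov_pruned (c : G.PDCert z o) : G.uncov c.pruned ⊆ c.act := by
  intro j hj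
  rw [mem_uncov] at hj
  by_contra hja
  obtain ⟨q, hq, hjq, -⟩ := c.T_cover j hj.1 hja
  obtain ⟨p, hp, hqp⟩ := c.pruned_cover hq
  exact hj.2 p hp (hqp hjq)

theorem coverRadius_f_le (c : G.PDCert z o) {p : Pair X} (hp : p ∈ c.pruned) (h : dist p.1 c.f.1 ≤ 2 * G.R) :
    coverRadius p.1 p.2 (I.ball c.f) ≤ 3 * G.R := by
  obtain ⟨h1, -, h2⟩ := c.pruned_spec hp
  have h3 := le_R_of_mem_L' (c.T_sub (c.TI_sub h1))
  simp only at h3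
  refine coverRadius_le (by linarith) fun j hj => ?_
  have h4 := (mem_ball.1 hj).2
  have h5 := le_R_of_mem_L' c.f_mem
  have h6 := dist_triangle p.1 c.f.1 j
  linarith

/-- Every output pair extends its recorded radius, and comes from a pruned pair or is `f`. -/
theorem mem_F (c : G.PDCert z o) {p : Pair X} (hp : p ∈ o.F) :
    (p.1, o.rad p.1) ∈ insert c.f c.TI ∧ o.rad p.1 ≤ p.2 ∧ p.2 ≤ 3 * G.R := by
  have hpr : ∀ q ∈ c.pruned, (q.1, o.rad q.1) ∈ insert c.f c.TI ∧ o.rad q.1 ≤ q.2 ∧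
      q.2 ≤ 3 * G.R := by
    intro q hq
    obtain ⟨h1, h2, h3⟩ := c.pruned_spec hq
    have h4 := le_R_of_mem_L' (c.T_sub (c.TI_sub h1))
    simp only at h4
    exact ⟨Finset.mem_insert_of_mem h1, h2, by linarith⟩
  rcases c.branch with ⟨-, h⟩ | ⟨q, hq, hqf, h⟩ | ⟨-, -, h, hrad⟩
  · rw [h] at hp; exact hpr p hp
  · rw [h, Finset.mem_insert] at hp
    rcases hp with rfl | hp
    · obtain ⟨h1, h2, h3⟩ := hpr q hq
      exact ⟨h1, h2.trans (le_coverRadius _ _ _), c.coverRadius_f_le hq hqf⟩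
    · exact hpr p (Finset.mem_of_mem_erase hp)
  · rw [h, Finset.mem_insert] at hp
    rcases hp with rfl | hp
    · rw [hrad]
      refine ⟨Finset.mem_insert_self _ _, le_rfl, ?_⟩
      linarith [le_R_of_mem_L' c.f_mem, R_nonneg (G := G)]
    · exact hpr p hp

theorem rad_mem_L' (c : G.PDCert z o) {p : Pair X} (hp : p ∈ o.F) : (p.1, o.rad p.1) ∈ G.L' := by
  rcases Finset.mem_insert.1 (c.mem_F hp).1 with h | h
  · rw [h]; exact c.f_mem
  · exact c.T_sub (c.TI_sub h)

theorem rad_tight (c : G.PDCert z o) {p : Pair X} (hp : p ∈ o.F) :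
    G.load c.α (p.1, o.rad p.1) = o.rad p.1 + z := by
  rcases Finset.mem_insert.1 (c.mem_F hp).1 with h | h
  · have : o.rad p.1 = c.f.2 := congrArg Prod.snd h
    rw [h, c.f_tight, this]
  · exact c.T_tight _ (c.TI_sub h)

/-- The only new case is an added `f`: its centre is more than `2 * G.R` away from the others, and
recorded radii are at most `G.R`. -/
theorem rad_disj (c : G.PDCert z o) {p q : Pair X} (hp : p ∈ o.F) (hq : q ∈ o.F) (hne : p ≠ q) :
    ¬ Intersects (p.1, o.rad p.1) (q.1, o.rad q.1) := by
  have hpr : ∀ p ∈ c.pruned, ∀ q ∈ c.pruned, p ≠ q →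
      ¬ Intersects (p.1, o.rad p.1) (q.1, o.rad q.1) := by
    intro p hp q hq hne
    refine c.TI_disj _ (c.pruned_spec hp).1 _ (c.pruned_spec hq).1 fun h => ?_
    exact hne (c.pruned_eq_of_fst_eq hp hq (Prod.ext_iff.1 h).1)
  rcases c.branch with ⟨-, h⟩ | ⟨r, hr, -, h⟩ | ⟨-, hfar, h, hrad⟩
  · rw [h] at hp hq; exact hpr p hp q hq hne
  · rw [h, Finset.mem_insert, Finset.mem_erase] at hp hq
    rcases hp with rfl | hp <;> rcases hq with rfl | hq
    · exact absurd rfl hne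
    · exact hpr r hr q hq.2 hq.1.symm
    · exact hpr p hp.2 r hr hp.1
    · exact hpr p hp.2 q hq.2 hne
  · have hf : ∀ p ∈ c.pruned, ¬ Intersects (p.1, o.rad p.1) (c.f.1, o.rad c.f.1) := by
      intro p hp hint
      have h1 := hfar p hp
      have h2 := le_R_of_mem_L' (c.T_sub (c.TI_sub (c.pruned_spec hp).1))
      have h3 := le_R_of_mem_L' c.f_mem
      unfold Intersects at hint
      simp only [hrad] at hint h2
      linarith
    rw [h, Finset.mem_insert] at hp hq
    rcases hp with rfl | hp <;> rcases hq with rfl | hq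
    · exact absurd rfl hne
    · exact fun h => hf q hq h.symm
    · exact hf p hp
    · exact hpr p hp q hq hne

theorem uncov_F_subset (c : G.PDCert z o) : G.uncov o.F ⊆ c.act := by
  refine Finset.Subset.trans (uncov_subset_of_cover fun p hp => ?_) c.uncov_pruned
  rcases c.branch with ⟨-, h⟩ | ⟨r, hr, -, h⟩ | ⟨-, -, h, -⟩
  · exact ⟨p, h ▸ hp, subset_rfl⟩
  · by_cases hpr : p = r
    · subst hpr
      exact ⟨(p.1, coverRadius p.1 p.2 (I.ball c.f)), by rw [h]; exact Finset.mem_insert_self _ _,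
        ball_subset_of_fst_eq rfl (le_coverRadius _ _ _)⟩
    · exact ⟨p, by rw [h]; exact Finset.mem_insert_of_mem (Finset.mem_erase.2 ⟨hpr, hp⟩),
        subset_rfl⟩
  · exact ⟨p, by rw [h]; exact Finset.mem_insert_of_mem hp, subset_rfl⟩

/-- Whenever the pruned pairs do not suffice, the ball of `f` gets covered, and outside it at most
`m` of the formerly active clients remain. -/
theorem card_uncov_F (c : G.PDCert z o) : (G.uncov o.F).card ≤ I.m := by
  have hf : (∃ p ∈ o.F, I.ball c.f ⊆ I.ball p) → (G.uncov o.F).card ≤ I.m := by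
    rintro ⟨p, hp, hfp⟩
    refine (Finset.card_le_card fun j hj => ?_).trans c.f_last
    refine Finset.mem_sdiff.2 ⟨c.uncov_F_subset hj, fun hjf => ?_⟩
    exact (mem_uncov.1 hj).2 p hp (hfp hjf)
  rcases c.branch with ⟨h', h⟩ | ⟨r, hr, -, h⟩ | ⟨-, -, h, -⟩
  · rw [h]; exact h'
  · refine hf ⟨_, by rw [h]; exact Finset.mem_insert_self _ _, fun j hj => ?_⟩
    exact mem_ball.2 ⟨(mem_ball.1 hj).1, dist_le_coverRadius hj⟩
  · exact hf ⟨_, by rw [h]; exact Finset.mem_insert_self _ _, subset_rfl⟩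

theorem pruned_nonneg (c : G.PDCert z o) {p : Pair X} (hp : p ∈ c.pruned) : 0 ≤ p.2 :=
  (nonneg_of_mem_L' (c.T_sub (c.TI_sub (c.pruned_spec hp).1))).trans (c.pruned_spec hp).2.1

theorem cost_F (c : G.PDCert z o) : cost o.F ≤ 3 * ∑ p ∈ c.TI, p.2 + 3 * G.R := by
  have h1 := c.cost_pruned
  have hR := R_nonneg (G := G)
  rcases c.branch with ⟨-, h⟩ | ⟨r, hr, hrf, h⟩ | ⟨-, -, h, -⟩
  · rw [h]; linarith
  · have h2 := c.coverRadius_f_le hr hrf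
    have h3 := c.pruned_nonneg hr
    rw [h]
    refine (cost_insert_le ((c.pruned_nonneg hr).trans (le_coverRadius _ _ _))).trans ?_
    rw [cost_erase hr]
    simp only
    linarith
  · rw [h]
    refine (cost_insert_le (nonneg_of_mem_L' c.f_mem)).trans ?_
    linarith [le_R_of_mem_L' c.f_mem]

/-- Only the pair enlarged to reach `f` can exceed three times its recorded radius. In the other
branches `c.f` is merely a convenient witness. -/
theorem exists_exceptional (c : G.PDCert z o) : ∃ e, ∀ p ∈ o.F, p ≠ e → p.2 ≤ 3 * o.rad p.1 := by
  rcases c.branch with ⟨-, h⟩ | ⟨r, hr, hrf, h⟩ | ⟨-, -, h, hrad⟩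
  · exact ⟨c.f, fun p hp _ => (c.pruned_spec (h ▸ hp)).2.2⟩
  · refine ⟨(r.1, coverRadius r.1 r.2 (I.ball c.f)), fun p hp hne => ?_⟩
    rw [h, Finset.mem_insert] at hp
    exact (c.pruned_spec (Finset.mem_of_mem_erase (hp.resolve_left hne))).2.2
  · refine ⟨c.f, fun p hp hne => ?_⟩
    rw [h, Finset.mem_insert] at hp
    exact (c.pruned_spec (hp.resolve_left hne)).2.2

theorem core_eq (c : G.PDCert z o) : o.core = o.F.erase c.f := by
  unfold PDOut.core
  rw [c.o_f, Option.toFinset_some, Finset.sdiff_singleton_eq_erase]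

/-- Either there are at most as many output pairs as kept ones, or `f` was added. -/
theorem card_F_le_or (c : G.PDCert z o) : o.F.card ≤ c.TI.card ∨
    (o.F.card = c.TI.card + 1 ∧ o.core = c.pruned ∧ o.F = insert c.f c.pruned ∧
      I.m < (G.uncov c.pruned).card) := by
  rcases c.branch with ⟨-, h⟩ | ⟨r, hr, hrf, h⟩ | ⟨hm, hfar, h, -⟩
  · left; rw [h, c.card_pruned]
  · left
    rw [h, ← c.card_pruned, ← Finset.card_erase_add_one hr]
    exact Finset.card_insert_le _ _
  · right
    have hf : c.f ∉ c.pruned := fun hf => by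
      have := hfar _ hf
      rw [dist_self] at this
      linarith [R_nonneg (G := G)]
    refine ⟨by rw [h, Finset.card_insert_of_notMem hf, c.card_pruned], ?_, h, hm⟩
    rw [c.core_eq, h, Finset.erase_insert hf]

theorem card_F_le (c : G.PDCert z o) : o.F.card ≤ c.TI.card + 1 := by
  rcases c.card_F_le_or with h | ⟨h, -⟩ <;> omega

theorem card_core_le (c : G.PDCert z o) : o.core.card ≤ c.TI.card := by
  rcases c.card_F_le_or with h | ⟨-, h, -⟩
  · refine le_trans ?_ h
    rw [c.core_eq]; exact Finset.card_le_card (Finset.erase_subset _ _)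
  · rw [h, c.card_pruned]

theorem card_F_le_core (c : G.PDCert z o) : o.F.card ≤ o.core.card + 1 := by
  rw [c.core_eq]
  have := Finset.pred_card_le_card_erase (s := o.F) (a := c.f)
  omega

/-- Packing with zero error. The set `U` is left free: it will be all of `act`, or the clients
missed by the pruned pairs. -/
theorem sum_TI_le (c : G.PDCert z o) {U : Finset X} (hU : U ⊆ c.act) :
    ∑ p ∈ c.TI, p.2 + c.TI.card * z + U.card * c.γ ≤ ∑ j ∈ G.D', c.α j := by
  have := c.packing c.TI id le_rfl (fun p hp => ?_) c.TI_disj U (hU.trans c.act_sub) ?_ ?_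
  · simpa using this
  · simp only [add_zero, id]
    exact (c.T_tight p (c.TI_sub hp)).ge
  · exact fun p hp j hj => c.T_sep p (c.TI_sub hp) j (hU hj)
  · intro j hj; rw [c.act_eq j (hU hj), add_zero]

/-- With `U = act` the left side contains more than `m` copies of `γ`, which cancel the term `m * γ`
of the dual objective. -/
theorem sum_TI_le_OPT (c : G.PDCert z o) (hz : 0 ≤ z) (hG : G.LPFeasible) :
    ∑ p ∈ c.TI, p.2 + c.TI.card * z ≤ G.OPT + G.k' * z := by
  have h1 := c.sum_TI_le subset_rfl
  have h2 := c.val_le hz hG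
  have h3 : (I.m : ℝ) * c.γ ≤ c.act.card * c.γ :=
    mul_le_mul_of_nonneg_right (by exact_mod_cast c.act_card.le) c.γ_nonneg
  unfold DualCert.val at h2
  linarith

theorem sum_TI_nonneg (c : G.PDCert z o) : 0 ≤ ∑ p ∈ c.TI, p.2 :=
  Finset.sum_nonneg fun _ hp => nonneg_of_mem_L' (c.T_sub (c.TI_sub hp))

theorem le_OPT_of_card_TI (c : G.PDCert z o) (hz : 0 ≤ z) (hG : G.LPFeasible) (h : G.k' < c.TI.card) :
    z ≤ G.OPT := by
  have h1 := c.sum_TI_le_OPT hz hG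
  have h2 := c.sum_TI_nonneg
  have h3 : (G.k' : ℝ) + 1 ≤ c.TI.card := by exact_mod_cast h
  have h4 := mul_le_mul_of_nonneg_right h3 hz
  linarith

theorem cost_F_le_of_card_TI (c : G.PDCert z o) (hz : 0 ≤ z) (hG : G.LPFeasible) (h : G.k' ≤ c.TI.card) :
    cost o.F ≤ 3 * G.OPT + 3 * G.R := by
  have h1 := c.sum_TI_le_OPT hz hG
  have h2 := c.cost_F
  have h3 : (G.k' : ℝ) ≤ c.TI.card := by exact_mod_cast h
  have h4 := mul_le_mul_of_nonneg_right h3 hz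
  linarith

theorem card_F_le_facilities (c : G.PDCert z o) : o.F.card ≤ I.facilities.card := by
  refine Finset.card_le_card_of_injOn Prod.fst (fun p hp => ?_) fun p hp q hq h => ?_
  · exact (admissible_of_mem_L' (c.rad_mem_L' hp)).1
  · by_contra hne
    refine c.rad_disj hp hq hne (intersects_of_fst_eq h ?_ ?_)
    · exact nonneg_of_mem_L' (c.rad_mem_L' hp)
    · exact nonneg_of_mem_L' (c.rad_mem_L' hq)

/-- If only `f` pushes the count above `k'`, exactly `k'` pairs were kept and at least `m + 1`
clients of value `γ` are missed. The extra one gives `γ ≤ OPT`, and tightness of `f` bounds `z` by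
the total dual `|D'| * γ`. -/
theorem le_card_mul_OPT (c : G.PDCert z o) (hz : 0 ≤ z) (hG : G.LPFeasible) (h : G.k' < o.F.card) :
    z ≤ G.D'.card * G.OPT := by
  have hD1 : (1 : ℝ) ≤ G.D'.card := by
    have := Finset.card_le_card c.act_sub
    have := c.act_card
    exact_mod_cast (by omega : 1 ≤ G.D'.card)
  by_cases hTI : G.k' < c.TI.card
  · have h1 := c.le_OPT_of_card_TI hz hG hTI
    have h2 : 0 ≤ G.OPT := hz.trans h1
    nlinarith
  · rcases c.card_F_le_or with h' | ⟨h1, -, -, h2⟩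
    · omega
    · have hk : (c.TI.card : ℝ) = G.k' := by exact_mod_cast (by omega : c.TI.card = G.k')
      have h3 := c.sum_TI_le c.uncov_pruned
      have h4 := c.val_le hz hG
      have h5 : ((I.m : ℝ) + 1) * c.γ ≤ (G.uncov c.pruned).card * c.γ :=
        mul_le_mul_of_nonneg_right (by exact_mod_cast h2) c.γ_nonneg
      have h6 := c.sum_TI_nonneg
      unfold DualCert.val at h4
      rw [hk] at h3
      have h7 : c.γ ≤ G.OPT := by linarith
      have h8 : G.load c.α c.f ≤ G.D'.card * c.γ := by
        calc G.load c.α c.f ≤ ∑ j ∈ G.D', c.α j :=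
              Finset.sum_le_sum_of_subset_of_nonneg Finset.inter_subset_right
                fun j _ _ => c.nonneg j
          _ ≤ ∑ j ∈ G.D', c.γ := Finset.sum_le_sum fun j _ => c.le j
          _ = _ := by simp
      have h9 := nonneg_of_mem_L' c.f_mem
      have h10 := mul_le_mul_of_nonneg_left h7 (by positivity : (0 : ℝ) ≤ G.D'.card)
      linarith [c.f_tight]

end PDCert

/-! ### Bounds on the optimum and the upper end of the search interval. -/

theorem OPT_nonneg : 0 ≤ G.OPT := by
  refine Real.sInf_nonneg ?_
  rintro v ⟨y, w, h, rfl⟩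
  exact Finset.sum_nonneg fun p hp => mul_nonneg (nonneg_of_mem_L' hp) (h.1 p hp)

theorem OPT_le (hG : G.LPFeasible) : G.OPT ≤ G.k' * I.cmax := by
  obtain ⟨y, w, h⟩ := hG
  have h1 : G.OPT ≤ ∑ p ∈ G.L', p.2 * y p := by
    refine csInf_le ⟨0, ?_⟩ ⟨y, w, h, rfl⟩
    rintro v ⟨y, w, h, rfl⟩
    exact Finset.sum_nonneg fun p hp => mul_nonneg (nonneg_of_mem_L' hp) (h.1 p hp)
  refine h1.trans ?_
  calc ∑ p ∈ G.L', p.2 * y p ≤ ∑ p ∈ G.L', I.cmax * y p := by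
        refine Finset.sum_le_sum fun p hp => mul_le_mul_of_nonneg_right ?_ (h.1 p hp)
        obtain ⟨j, hj, hpj⟩ := exists_client_of_mem_L' hp
        rw [hpj]
        exact dist_le_cmax (admissible_of_mem_L' hp).1 hj
    _ = (∑ p ∈ G.L', y p) * I.cmax := by rw [← Finset.mul_sum, mul_comm]
    _ ≤ _ := mul_le_mul_of_nonneg_right h.2.2.2.1 cmax_nonneg

/-- If no further pair may be selected, then the LP relaxation leaves no client to be covered. -/
theorem card_D'_le (hG : G.LPFeasible) (hk : G.k' = 0) : G.D'.card ≤ I.m := by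
  obtain ⟨y, w, hy, hw, hcov, hyk, hwm⟩ := hG
  rw [hk, Nat.cast_zero] at hyk
  have h1 : ∀ j ∈ G.D', (1 : ℝ) ≤ w j := by
    intro j hj
    have h2 : ∑ p ∈ G.L'.filter (fun p => j ∈ I.ball p), y p ≤ 0 :=
      (Finset.sum_le_sum_of_subset_of_nonneg (Finset.filter_subset _ _)
        fun p hp _ => hy p hp).trans hyk
    linarith [hcov j hj]
  have h3 : (G.D'.card : ℝ) ≤ I.m :=
    calc (G.D'.card : ℝ) = ∑ j ∈ G.D', (1 : ℝ) := by simp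
      _ ≤ _ := Finset.sum_le_sum h1
      _ ≤ _ := hwm
  exact_mod_cast h3

/-- For the initial upper end of the search interval, at most `k'` pairs are returned. -/
theorem IsPDOut.card_le_of_searchInit (hG : G.LPFeasible) {o : PDOut X}
    (h : G.IsPDOut G.searchInit.2 o) : o.F.card ≤ G.k' := by
  have hc0 := cmax_nonneg (I := I)
  have hz : 0 ≤ G.searchInit.2 := by unfold searchInit; positivity
  rcases h.trivial_or_cert hz with ⟨h, -⟩ | ⟨⟨c⟩⟩
  · simp [h]
  by_contra hlt
  rw [not_le] at hlt
  have h1 := c.le_card_mul_OPT hz hG hlt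
  have h2 := OPT_le hG
  have h3 : (G.D'.card : ℝ) ≤ I.size := by exact_mod_cast (by have := card_D'_lt_size (G := G); omega)
  have h4 : (1 : ℝ) ≤ I.size := by exact_mod_cast (by have := card_D'_lt_size (G := G); omega)
  have hkc : 0 ≤ (G.k' : ℝ) * I.cmax := by positivity
  have h5 : (G.D'.card : ℝ) * G.OPT ≤ I.size * (G.k' * I.cmax) :=
    mul_le_mul h3 h2 OPT_nonneg (by positivity)
  -- The initial penalty is `2 * n * k' * cmax`, but more than `k'` pairs would force it to be at
  -- most `n * k' * cmax`; only the degenerate case `k' * cmax = 0` is left.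
  have h6 : (G.k' : ℝ) * I.cmax ≤ 0 := by
    simp only [searchInit] at h1
    nlinarith
  have hact : 0 < c.act.card := Nat.zero_lt_of_lt c.act_card
  rcases mul_eq_zero.1 (le_antisymm h6 hkc) with hk | hc
  · have h7 := card_D'_le hG (by exact_mod_cast hk)
    have := Finset.card_le_card c.act_sub
    have := c.act_card
    omega
  -- With `cmax = 0` every ball contains all clients, so a kept ball would contain an active client.
  -- If nothing was kept, the output has at most one pair, hence `k' = 0`, and then the LP forces
  -- `|D'| ≤ m`.
  · by_cases hTI : c.TI.Nonempty
    · obtain ⟨p, hp⟩ := hTI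
      obtain ⟨j, hj⟩ := Finset.card_pos.1 hact
      have hpL := c.T_sub (c.TI_sub hp)
      refine c.T_sep p (c.TI_sub hp) j hj (mem_ball.2 ⟨D'_subset (c.act_sub hj), ?_⟩)
      have := dist_le_cmax (admissible_of_mem_L' hpL).1 (D'_subset (c.act_sub hj))
      rw [hc] at this
      exact this.trans (nonneg_of_mem_L' hpL)
    · rw [Finset.not_nonempty_iff_eq_empty] at hTI
      have h7 := c.card_F_le
      rw [hTI, Finset.card_empty] at h7
      have hk0 : G.k' = 0 := by omega
      have h8 := card_D'_le hG hk0
      have := Finset.card_le_card c.act_sub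
      have := c.act_card
      omega

end Guess

/-! ### Dependence of the dual solution on the penalty -/

/-- The excess at `j` is the total excess minus that of the other points; those can offset it only
by deficits, which are charged to `e` on `U`. -/
theorem sub_le_of_sum_sub_le {Y : Type*} {S U : Finset Y} {a b e : Y → ℝ} {δ : ℝ} {j : Y}
    (hj : j ∈ S) (hS : ∑ i ∈ S, (b i - a i) ≤ δ) (he : ∀ i ∈ U, 0 ≤ e i)
    (h : ∀ i ∈ S, i ≠ j → a i - b i ≤ 0 ∨ (i ∈ U ∧ a i - b i ≤ e i)) :
    b j - a j ≤ δ + ∑ i ∈ U, e i := by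
  rw [← Finset.add_sum_erase S _ hj] at hS
  have h1 : ∑ i ∈ S.erase j, (a i - b i) ≤ ∑ i ∈ U, e i := by
    calc ∑ i ∈ S.erase j, (a i - b i)
        ≤ ∑ i ∈ S.erase j, if i ∈ U then e i else 0 := by
          refine Finset.sum_le_sum fun i hi => ?_
          rw [Finset.mem_erase] at hi
          split_ifs with hiU
          · rcases h i hi.2 hi.1 with h | h
            · exact h.trans (he i hiU)
            · exact h.2
          · rcases h i hi.2 hi.1 with h | h
            · exact h
            · exact absurd h.1 hiU
      _ = ∑ i ∈ (S.erase j).filter (· ∈ U), e i := (Finset.sum_filter _ _).symm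
      _ ≤ _ := Finset.sum_le_sum_of_subset_of_nonneg
          (fun i hi => (Finset.mem_filter.1 hi).2) fun i hi _ => he i hi
  have h2 : ∑ i ∈ S.erase j, (a i - b i) = -∑ i ∈ S.erase j, (b i - a i) := by
    rw [← Finset.sum_neg_distrib]
    exact Finset.sum_congr rfl fun _ _ => by ring
  linarith

/-- If any excess of `b` over `a`, or of `a` over `b`, is explained by a set of points of no larger
value on which the total excess is at most `δ`, then `a` and `b` are close. -/
theorem sum_abs_sub_le {Y : Type*} {D : Finset Y} {a b : Y → ℝ} {δ : ℝ} (hδ : 0 ≤ δ)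
    (hab : ∀ j ∈ D, a j < b j →
      ∃ S ⊆ D, j ∈ S ∧ (∀ i ∈ S, a i ≤ a j) ∧ ∑ i ∈ S, (b i - a i) ≤ δ)
    (hba : ∀ j ∈ D, b j < a j →
      ∃ S ⊆ D, j ∈ S ∧ (∀ i ∈ S, b i ≤ b j) ∧ ∑ i ∈ S, (a i - b i) ≤ δ) :
    ∑ j ∈ D, |a j - b j| ≤ (2 ^ D.card - 1) * δ := by
  -- The induction runs over sets closed downwards with respect to `min (a j) (b j)`, adding a point
  -- of largest minimum each time.
  have key : ∀ U : Finset Y, U ⊆ D →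
      (∀ j ∈ U, ∀ i ∈ D, min (a i) (b i) < min (a j) (b j) → i ∈ U) →
      ∑ j ∈ U, |a j - b j| ≤ (2 ^ U.card - 1) * δ := by
    intro U
    induction U using Finset.induction_on_max_value (fun j => min (a j) (b j)) with
    | empty => simp
    | insert j U hjU hmax ih =>
      intro hUD hlow
      have hjD : j ∈ D := hUD (Finset.mem_insert_self _ _)
      have hU := ih ((Finset.subset_insert _ _).trans hUD) (by
        intro x hx i hi hlt
        rcases Finset.mem_insert.1 (hlow x (Finset.mem_insert_of_mem hx) i hi hlt) with rfl | h
        · exact absurd (hmax x hx) (not_le.2 hlt)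
        · exact h)
      have hj : |a j - b j| ≤ δ + ∑ i ∈ U, |a i - b i| := by
        have hsum : 0 ≤ ∑ i ∈ U, |a i - b i| := Finset.sum_nonneg fun _ _ => abs_nonneg _
        rcases lt_trichotomy (a j) (b j) with hlt | heq | hlt
        · obtain ⟨S, hSD, hjS, hle, hS⟩ := hab j hjD hlt
          rw [abs_sub_comm, abs_of_pos (by linarith)]
          refine sub_le_of_sum_sub_le hjS hS (fun _ _ => abs_nonneg _) fun i hi hne => ?_
          rcases le_or_gt (a i) (b i) with h | h
          · left; linarith
          · right
            -- Such an `i` has strictly smaller minimum than `j`, as `b i < a i ≤ a j`, so it was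
            -- treated before `j`.
            refine ⟨?_, le_abs_self _⟩
            refine (Finset.mem_insert.1 (hlow j (Finset.mem_insert_self _ _) i (hSD hi) ?_)).resolve_left hne
            rw [min_eq_left hlt.le, min_eq_right h.le]
            exact h.trans_le (hle i hi)
        · rw [heq, sub_self, abs_zero]; linarith
        · obtain ⟨S, hSD, hjS, hle, hS⟩ := hba j hjD hlt
          rw [abs_of_pos (by linarith)]
          refine sub_le_of_sum_sub_le hjS hS (fun _ _ => abs_nonneg _) fun i hi hne => ?_
          rcases le_or_gt (b i) (a i) with h | h
          · left; linarith
          · right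
            refine ⟨?_, by rw [abs_sub_comm]; exact le_abs_self _⟩
            refine (Finset.mem_insert.1 (hlow j (Finset.mem_insert_self _ _) i (hSD hi) ?_)).resolve_left hne
            rw [min_eq_right hlt.le, min_eq_left h.le]
            exact h.trans_le (hle i hi)
      -- The new term is at most `δ` plus the previous total, and `1 + 2 * (2 ^ n - 1) = 2 ^ (n + 1)
      -- - 1`.
      rw [Finset.sum_insert hjU, Finset.card_insert_of_notMem hjU, pow_succ]
      linarith
  exact key D subset_rfl fun _ _ i hi _ => hi

namespace Guess

variable {G : Guess I}

namespace DualCert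

theorem load_sub {α β : X → ℝ} (p : Pair X) :
    ∑ j ∈ I.ball p ∩ G.D', (α j - β j) = G.load α p - G.load β p :=
  Finset.sum_sub_distrib _ _

/-- Below the smaller maximum `c₁.γ` both runs freeze their clients in tight balls in which they
have the largest dual. Such a ball is also a constraint of the other run, so on it the other dual
exceeds the frozen one by at most `|z₁ - z₂|` in total; this is the hypothesis of `sum_abs_sub_le`.
The truncation of the second dual at `c₁.γ` is removed afterwards. -/
theorem near_of_γ_le {z₁ z₂ δ : ℝ} (c₁ : G.DualCert z₁) (c₂ : G.DualCert z₂) (hδ : |z₁ - z₂| ≤ δ)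
    (hγ : c₁.γ ≤ c₂.γ) :
    (∀ j ∈ G.D', |c₁.α j - c₂.α j| ≤ 2 ^ G.D'.card * δ) ∧
      c₂.γ ≤ c₁.γ + 2 ^ G.D'.card * δ := by
  have hδ0 : 0 ≤ δ := (abs_nonneg _).trans hδ
  obtain ⟨hδ1, hδ2⟩ := abs_le.1 hδ
  set b : X → ℝ := fun j => min (c₂.α j) c₁.γ with hb
  have hsum : ∑ j ∈ G.D', |c₁.α j - b j| ≤ (2 ^ G.D'.card - 1) * δ := by
    refine sum_abs_sub_le hδ0 ?_ ?_
    · intro j hj hlt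
      have h1 : c₁.α j < c₁.γ := hlt.trans_le (min_le_right _ _)
      obtain ⟨p, hp, hpt, hjp, hle⟩ := c₁.exists_frozen hj fun h =>
        h1.ne (c₁.act_eq j (Finset.mem_sdiff.1 h).1)
      refine ⟨I.ball p ∩ G.D', Finset.inter_subset_right, Finset.mem_inter.2 ⟨hjp, hj⟩, hle, ?_⟩
      calc ∑ i ∈ I.ball p ∩ G.D', (b i - c₁.α i)
          ≤ ∑ i ∈ I.ball p ∩ G.D', (c₂.α i - c₁.α i) :=
            Finset.sum_le_sum fun i _ => sub_le_sub_right (min_le_left _ _) _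
        _ = G.load c₂.α p - G.load c₁.α p := load_sub p
        _ ≤ δ := by linarith [c₂.feas p hp]
    · intro j hj hlt
      have h1 : c₂.α j < c₁.γ := by
        rcases min_lt_iff.1 (hlt.trans_le (c₁.le j)) with h | h
        · exact h
        · exact absurd h (lt_irrefl _)
      have hbj : b j = c₂.α j := min_eq_left h1.le
      obtain ⟨p, hp, hpt, hjp, hle⟩ := c₂.exists_frozen hj fun h =>
        (h1.trans_le hγ).ne (c₂.act_eq j (Finset.mem_sdiff.1 h).1)
      have hbi : ∀ i ∈ I.ball p ∩ G.D', b i = c₂.α i := fun i hi =>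
        min_eq_left ((hle i hi).trans h1.le)
      refine ⟨I.ball p ∩ G.D', Finset.inter_subset_right, Finset.mem_inter.2 ⟨hjp, hj⟩,
        fun i hi => by rw [hbi i hi, hbj]; exact hle i hi, ?_⟩
      calc ∑ i ∈ I.ball p ∩ G.D', (c₁.α i - b i)
          = ∑ i ∈ I.ball p ∩ G.D', (c₁.α i - c₂.α i) :=
            Finset.sum_congr rfl fun i hi => by rw [hbi i hi]
        _ = G.load c₁.α p - G.load c₂.α p := load_sub p
        _ ≤ δ := by linarith [c₁.feas p hp]
  have hab : ∀ i, c₁.α i - c₂.α i ≤ |c₁.α i - b i| := fun i =>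
    (sub_le_sub_left (min_le_left _ _) _).trans (le_abs_self _)
  -- One more use of a tight ball of the first run handles the untruncated dual: excess at most `δ`
  -- plus the deficits `(2 ^ |D'| - 1) * δ` already bounded.
  have hfroz : ∀ j ∈ G.D', j ∉ c₁.act \ I.ball c₁.f →
      c₂.α j - c₁.α j ≤ 2 ^ G.D'.card * δ := by
    intro j hj hja
    obtain ⟨p, hp, hpt, hjp, hle⟩ := c₁.exists_frozen hj hja
    have h1 : ∑ i ∈ I.ball p ∩ G.D', (c₂.α i - c₁.α i) ≤ δ := by
      rw [load_sub]; linarith [c₂.feas p hp]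
    have h2 := sub_le_of_sum_sub_le (U := G.D') (e := fun i => |c₁.α i - b i|)
      (Finset.mem_inter.2 ⟨hjp, hj⟩) h1 (fun _ _ => abs_nonneg _)
      fun i hi _ => Or.inr ⟨(Finset.mem_inter.1 hi).2, hab i⟩
    linarith
  have hγ2 : c₂.γ ≤ c₁.γ + 2 ^ G.D'.card * δ := by
    -- Pigeonhole: more than `m` clients have value `c₂.γ`, but at most `m` are still active at the
    -- end of the first run.
    have : ∃ j ∈ c₂.act, j ∉ c₁.act \ I.ball c₁.f := by
      by_contra hcon
      push Not at hcon
      have h1 := Finset.card_le_card (fun j hj => hcon j hj : c₂.act ⊆ c₁.act \ I.ball c₁.f)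
      have h2 := c₁.f_last
      have h3 := c₂.act_card
      omega
    obtain ⟨j, hj, hj'⟩ := this
    have h1 := hfroz j (c₂.act_sub hj) hj'
    rw [c₂.act_eq j hj] at h1
    linarith [c₁.le j]
  refine ⟨fun j hj => abs_le.2 ⟨?_, ?_⟩, hγ2⟩
  · by_cases hja : j ∈ c₁.act \ I.ball c₁.f
    · rw [c₁.act_eq j (Finset.mem_sdiff.1 hja).1]
      linarith [c₂.le j]
    · linarith [hfroz j hj hja]
  · have h1 := Finset.single_le_sum (f := fun i => |c₁.α i - b i|) (fun _ _ => abs_nonneg _) hj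
    linarith [hab j]

theorem near {z₁ z₂ δ : ℝ} (c₁ : G.DualCert z₁) (c₂ : G.DualCert z₂) (hδ : |z₁ - z₂| ≤ δ) :
    (∀ j ∈ G.D', |c₁.α j - c₂.α j| ≤ 2 ^ G.D'.card * δ) ∧
      c₁.γ ≤ c₂.γ + 2 ^ G.D'.card * δ := by
  have hδ0 : 0 ≤ δ := (abs_nonneg _).trans hδ
  rcases le_total c₁.γ c₂.γ with h | h
  · refine ⟨(near_of_γ_le c₁ c₂ hδ h).1, ?_⟩
    have : 0 ≤ 2 ^ G.D'.card * δ := by positivity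
    linarith
  · obtain ⟨h1, h2⟩ := near_of_γ_le c₂ c₁ (abs_sub_comm z₁ z₂ ▸ hδ) h
    exact ⟨fun j hj => by rw [abs_sub_comm]; exact h1 j hj, h2⟩

/-- Disjoint balls that are tight in one of two runs with nearly equal penalties, and avoid more
than `m` clients of maximal dual value in one of the runs. -/
theorem packing_two (hG : G.LPFeasible) {z₁ z₂ δ : ℝ} (hz₁ : 0 ≤ z₁) (hz : z₁ ≤ z₂)
    (hδ : z₂ - z₁ ≤ δ) (c₁ : G.DualCert z₁) (c₂ : G.DualCert z₂) {ι : Type*} (s : Finset ι)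
    (B : ι → Pair X)
    (htight : ∀ i ∈ s, G.load c₁.α (B i) = (B i).2 + z₁ ∨ G.load c₂.α (B i) = (B i).2 + z₂)
    (hdisj : ∀ i ∈ s, ∀ i' ∈ s, i ≠ i' → ¬ Intersects (B i) (B i'))
    (U : Finset X) (hU : ∀ j ∈ U, j ∈ c₁.act ∨ j ∈ c₂.act) (hUm : I.m < U.card)
    (hsep : ∀ i ∈ s, ∀ j ∈ U, j ∉ I.ball (B i)) :
    ∑ i ∈ s, (B i).2 + s.card * z₁ ≤
      G.OPT + G.k' * z₁ + 2 * G.D'.card * (2 ^ G.D'.card * δ) := by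
  have hδ0 : 0 ≤ δ := by linarith
  obtain ⟨hα, hγ⟩ := near c₁ c₂ (δ := δ) (by rw [abs_le]; constructor <;> linarith)
  set η := 2 ^ G.D'.card * δ with hη
  have hη0 : 0 ≤ η := by positivity
  have hUD : U ⊆ G.D' := fun j hj => (hU j hj).elim (fun h => c₁.act_sub h) fun h => c₂.act_sub h
  -- The error is doubled because a client of value `c₂.γ` may lose `η` when passing from `c₂.α` to
  -- `c₁.α` and another `η` when passing from `c₂.γ` to `c₁.γ`.
  have h1 := c₁.packing s B (η := 2 * η) (by linarith) ?_ hdisj U hUD hsep ?_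
  · have h2 := c₁.val_le hz₁ hG
    have h3 : (I.m : ℝ) * c₁.γ ≤ U.card * c₁.γ :=
      mul_le_mul_of_nonneg_right (by exact_mod_cast hUm.le) c₁.γ_nonneg
    unfold val at h2
    linarith
  · intro i hi
    rcases htight i hi with h | h
    · rw [← h]
      exact Finset.sum_le_sum fun j _ => by linarith
    · calc (B i).2 + z₁ ≤ (B i).2 + z₂ := by linarith
        _ = G.load c₂.α (B i) := h.symm
        _ ≤ _ := Finset.sum_le_sum fun j hj => by
          have := (abs_le.1 (hα j (Finset.mem_inter.1 hj).2)).1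
          linarith
  · intro j hj
    rcases hU j hj with h | h
    · rw [c₁.act_eq j h]; linarith
    · have := (abs_le.1 (hα j (hUD hj))).1
      rw [c₂.act_eq j h] at this
      linarith

end DualCert

theorem δ_nonneg {ε : ℝ} (hε : 0 < ε) : 0 ≤ G.δ ε := by
  have := OPT_nonneg (G := G)
  unfold δ; positivity

/-- The width `δ` is chosen for this: `2 * |D'| * 2 ^ |D'| ≤ n * 2 ^ n` because `|D'| + 1 ≤ n`. -/
theorem card_mul_pow_mul_δ_le {ε : ℝ} (hε : 0 < ε) :
    2 * G.D'.card * (2 ^ G.D'.card * G.δ ε) ≤ ε / 3 * G.OPT := by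
  have h1 := card_D'_lt_size (G := G)
  have hO := OPT_nonneg (G := G)
  have hs : (0 : ℝ) < I.size := by exact_mod_cast (by omega : 0 < I.size)
  have h2 : (G.D'.card : ℝ) * 2 ^ (G.D'.card + 1) ≤ I.size * 2 ^ I.size := by
    refine mul_le_mul (by exact_mod_cast (by omega)) ?_ (by positivity) hs.le
    exact pow_le_pow_right₀ (by norm_num) h1
  have h3 : (I.size * 2 ^ I.size : ℝ) * G.δ ε = ε / 3 * G.OPT := by
    unfold δ; field_simp
  rw [← h3]
  calc 2 * G.D'.card * (2 ^ G.D'.card * G.δ ε)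
      = (G.D'.card * 2 ^ (G.D'.card + 1) : ℝ) * G.δ ε := by ring
    _ ≤ _ := mul_le_mul_of_nonneg_right h2 (δ_nonneg hε)

theorem size_mul_δ_le {ε : ℝ} (hε : 0 < ε) : I.size * G.δ ε ≤ ε / 3 * G.OPT := by
  have h1 := card_D'_lt_size (G := G)
  have hO := OPT_nonneg (G := G)
  have hs : (0 : ℝ) < I.size := by exact_mod_cast (by omega : 0 < I.size)
  have h3 : (I.size * 2 ^ I.size : ℝ) * G.δ ε = ε / 3 * G.OPT := by
    unfold δ; field_simp
  rw [← h3]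
  refine mul_le_mul_of_nonneg_right ?_ (δ_nonneg hε)
  have : (1 : ℝ) ≤ 2 ^ I.size := one_le_pow₀ (by norm_num)
  nlinarith

end Guess

/-! ### Subadditivity of the cost, and valid solutions. -/

theorem cost_union_le {Y : Type*} {S T : Finset (Pair Y)} (hS : ∀ p ∈ S, 0 ≤ p.2) :
    cost (S ∪ T) ≤ cost S + cost T := by
  unfold cost
  rw [← Finset.sum_union_inter]
  have : 0 ≤ ∑ p ∈ S ∩ T, p.2 :=
    Finset.sum_nonneg fun p hp => hS p (Finset.mem_inter.1 hp).1
  linarith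

theorem cost_image_le {Y ι : Type*} (s : Finset ι) (f : ι → Pair Y) (hf : ∀ i ∈ s, 0 ≤ (f i).2) :
    cost (s.image f) ≤ ∑ i ∈ s, (f i).2 := by
  induction s using Finset.induction_on with
  | empty => simp [cost]
  | insert i s hi ih =>
    rw [Finset.image_insert, Finset.sum_insert hi]
    refine (cost_insert_le (hf i (Finset.mem_insert_self _ _))).trans ?_
    linarith [ih fun j hj => hf j (Finset.mem_insert_of_mem hj)]

theorem cost_biUnion_le {Y ι : Type*} (s : Finset ι) (f : ι → Finset (Pair Y))
    (hf : ∀ i ∈ s, ∀ p ∈ f i, 0 ≤ p.2) : cost (s.biUnion f) ≤ ∑ i ∈ s, cost (f i) := by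
  induction s using Finset.induction_on with
  | empty => simp [cost]
  | insert i s hi ih =>
    rw [Finset.biUnion_insert, Finset.sum_insert hi]
    refine (cost_union_le (hf i (Finset.mem_insert_self _ _))).trans ?_
    linarith [ih fun j hj => hf j (Finset.mem_insert_of_mem hj)]

namespace Guess

/-- The recorded radii lie in `L'`, are not larger than those of the pairs, and give pairwise
non-intersecting pairs. -/
def IsValid (G : Guess I) (A : Sol X) : Prop :=
  (∀ p ∈ A.F, (p.1, A.rad p.1) ∈ G.L' ∧ A.rad p.1 ≤ p.2) ∧
    ∀ p ∈ A.F, ∀ q ∈ A.F, p.1 ≠ q.1 → ¬ Intersects (p.1, A.rad p.1) (q.1, A.rad q.1)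

variable {G : Guess I}

theorem IsValid.nonneg {A : Sol X} (h : G.IsValid A) {p : Pair X} (hp : p ∈ A.F) : 0 ≤ p.2 :=
  (nonneg_of_mem_L' (h.1 p hp).1).trans (h.1 p hp).2

theorem IsPDOut.isValid {z : ℝ} (hz : 0 ≤ z) {o : PDOut X} (h : G.IsPDOut z o) :
    G.IsValid o.toSol := by
  rcases h.trivial_or_cert hz with ⟨h, -⟩ | ⟨⟨c⟩⟩
  · exact ⟨by simp [h], by simp [h]⟩
  · exact ⟨fun p hp => ⟨c.rad_mem_L' hp, (c.mem_F hp).2.1⟩,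
      fun p hp q hq hne => c.rad_disj hp hq fun h => hne (h ▸ rfl)⟩

theorem IsPDOut.card_uncov {z : ℝ} (hz : 0 ≤ z) {o : PDOut X} (h : G.IsPDOut z o) :
    (G.uncov o.F).card ≤ I.m := by
  rcases h.trivial_or_cert hz with ⟨h, h'⟩ | ⟨⟨c⟩⟩
  · exact (Finset.card_le_card (Finset.filter_subset _ _)).trans h'
  · exact c.card_uncov_F

theorem IsPDOut.le_R {z : ℝ} (hz : 0 ≤ z) {o : PDOut X} (h : G.IsPDOut z o) :
    ∀ p ∈ o.F, p.2 ≤ 3 * G.R := by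
  rcases h.trivial_or_cert hz with ⟨h, -⟩ | ⟨⟨c⟩⟩
  · simp [h]
  · exact fun p hp => (c.mem_F hp).2.2

end Guess

/-! ### Stars and the solution extracted from an integral vector. -/

namespace Clustering

variable {G : Guess I} {F₁ F₂ : Finset (Pair X)} (K : Clustering G F₁ F₂)

theorem mem_star {p q : Pair X} : p ∈ K.star q ↔ p ∈ F₁ ∧ K.π p = some q := by
  simp [star]

theorem intersects_of_mem_star {p q : Pair X} (hp : p ∈ K.star q) : q ∈ F₂ ∧ Intersects p q := by
  obtain ⟨hp1, hπ⟩ := K.mem_star.1 hp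
  by_cases h : ∃ q ∈ F₂, Intersects p q
  · obtain ⟨q', hq', h1, h2⟩ := K.π_some p hp1 h
    have : q' = q := by rw [hπ] at h1; exact (Option.some.inj h1).symm
    exact this ▸ ⟨hq', h2⟩
  · push Not at h
    rw [K.π_none p hp1 h] at hπ
    exact absurd hπ (by simp)

theorem not_intersects_of_unclustered {p q : Pair X} (hp : p ∈ K.unclustered) (hq : q ∈ F₂) :
    ¬ Intersects p q := by
  intro h
  obtain ⟨hp1, hπ⟩ := Finset.mem_filter.1 hp
  obtain ⟨q', -, h1, -⟩ := K.π_some p hp1 ⟨q, hq, h⟩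
  rw [hπ] at h1
  exact absurd h1 (by simp)

theorem star_or_unclustered {p : Pair X} (hp : p ∈ F₁) :
    (∃ q ∈ F₂, p ∈ K.star q) ∨ p ∈ K.unclustered := by
  by_cases h : ∃ q ∈ F₂, Intersects p q
  · obtain ⟨q', hq', h1, -⟩ := K.π_some p hp h
    exact Or.inl ⟨q', hq', K.mem_star.2 ⟨hp, h1⟩⟩
  · push Not at h
    exact Or.inr (Finset.mem_filter.2 ⟨hp, K.π_none p hp h⟩)

theorem sum_star_add_sum_unclustered (g : Pair X → ℝ) :
    ∑ q ∈ F₂, ∑ p ∈ K.star q, g p + ∑ p ∈ K.unclustered, g p = ∑ p ∈ F₁, g p := by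
  have hd : (F₂ : Set (Pair X)).PairwiseDisjoint K.star := by
    intro q _ q' _ hne
    refine Finset.disjoint_left.2 fun p hp hp' => hne ?_
    have h1 := (K.mem_star.1 hp).2
    rw [(K.mem_star.1 hp').2] at h1
    exact (Option.some.inj h1).symm
  have hd2 : Disjoint (F₂.biUnion K.star) K.unclustered := by
    refine Finset.disjoint_left.2 fun p hp hp' => ?_
    obtain ⟨q, -, hq⟩ := Finset.mem_biUnion.1 hp
    have h1 := (K.mem_star.1 hq).2
    rw [(Finset.mem_filter.1 hp').2] at h1
    exact absurd h1 (by simp)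
  rw [← Finset.sum_biUnion hd, ← Finset.sum_union hd2]
  refine Finset.sum_congr ?_ fun _ _ => rfl
  ext p
  simp only [Finset.mem_union, Finset.mem_biUnion]
  constructor
  · rintro (⟨q, -, hq⟩ | h)
    · exact (K.mem_star.1 hq).1
    · exact (Finset.mem_filter.1 h).1
  · exact fun hp => K.star_or_unclustered hp

theorem fold_max_nonneg {Y : Type*} (s : Finset (Pair Y)) : 0 ≤ s.fold max 0 (fun p => 2 * p.2) :=
  (Finset.fold_max_le (b := (0 : ℝ)) (f := fun p : Pair Y => 2 * p.2) _).1 le_rfl |>.1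

theorem le_fold_max {Y : Type*} {s : Finset (Pair Y)} {p : Pair Y} (hp : p ∈ s) :
    2 * p.2 ≤ s.fold max 0 (fun p => 2 * p.2) :=
  ((Finset.fold_max_le (b := (0 : ℝ)) (f := fun p : Pair Y => 2 * p.2) _).1 le_rfl).2 p hp

/-- The enlarged pair covers the balls of all pairs in the star. -/
theorem ball_subset_merged {q p p' : Pair X} (hq : 0 ≤ q.2) (hp : p ∈ K.star q)
    (hp' : p' ∈ K.star q) : I.ball p' ⊆ I.ball (K.merged q p) := by
  have h0 := fold_max_nonneg ((K.star q).erase p)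
  by_cases h : p' = p
  · subst h
    refine ball_subset_of_fst_eq rfl ?_
    simp only [merged]; linarith
  · have h1 := le_fold_max (Finset.mem_erase.2 ⟨h, hp'⟩)
    have h2 := (K.intersects_of_mem_star hp).2
    have h3 := (K.intersects_of_mem_star hp').2
    refine ball_subset_ball ?_
    simp only [merged]
    unfold Intersects at h2 h3
    have h4 := dist_triangle_right p'.1 p.1 q.1
    linarith

theorem ball_center_subset_merged {q p : Pair X} (hp : p ∈ K.star q) :
    I.ball q ⊆ I.ball (K.merged q p) := by
  have h0 := fold_max_nonneg ((K.star q).erase p)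
  have h2 := (K.intersects_of_mem_star hp).2
  refine ball_subset_ball ?_
  simp only [merged]
  unfold Intersects at h2
  rw [dist_comm]
  linarith

/-- The radius that the integral variable `c` contributes to an extracted solution. -/
def extractCost (u : Pair X ⊕ Pair X → ℝ) (rep : Pair X → Pair X) : Pair X ⊕ Pair X → ℝ
  | .inl q => if u (.inl q) = 0 then ∑ p ∈ K.star q, p.2 else
      if K.star q = ∅ then 2 * q.2 else (K.merged q (rep q)).2
  | .inr p => u (.inr p) * p.2

theorem vars_inl {q : Pair X} (hq : q ∈ F₂) : Sum.inl q ∈ K.vars :=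
  Finset.inl_mem_disjSum.2 hq

theorem vars_inr {p : Pair X} (hp : p ∈ K.unclustered) : Sum.inr p ∈ K.vars :=
  Finset.inr_mem_disjSum.2 hp

section Extraction

variable {rad₁ rad₂ : X → ℝ} {u : Pair X ⊕ Pair X → ℝ} {rep hit : Pair X → Pair X}
  {S : Finset (Pair X)} {A : Sol X}

/-- Selected pairs only enlarge pairs of `F₁`, which is why the recorded radii `rad₁` remain
meaningful for them. -/
theorem origin_of_mem_selected (h₂ : ∀ q ∈ F₂, 0 ≤ q.2)
    (hrep : ∀ q ∈ F₂, (K.star q).Nonempty → rep q ∈ K.star q)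
    {p : Pair X} (hp : p ∈ K.selected u rep) : ∃ p' ∈ F₁, p'.1 = p.1 ∧ p'.2 ≤ p.2 := by
  simp only [selected, Finset.mem_union, Finset.mem_filter, Finset.mem_biUnion,
    Finset.mem_image] at hp
  rcases hp with (⟨hp, -⟩ | ⟨q, -, hp⟩) | ⟨q, ⟨hq, -, hne⟩, rfl⟩
  · exact ⟨p, (Finset.mem_filter.1 hp).1, rfl, le_rfl⟩
  · exact ⟨p, (K.mem_star.1 hp).1, rfl, le_rfl⟩
  · refine ⟨rep q, (K.mem_star.1 (hrep q hq hne)).1, rfl, ?_⟩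
    have h0 := fold_max_nonneg ((K.star q).erase (rep q))
    simp only [merged]
    linarith [h₂ q hq]

/-- On integral vectors `sizeTerm` counts exactly: the whole star at value `0`, a single pair at
value `1`. -/
theorem card_selected_add_extra_le (hu : ∀ c ∈ K.vars, u c = 0 ∨ u c = 1) :
    ((K.extra u).card + (K.selected u rep).card : ℝ) ≤ ∑ c ∈ K.vars, K.sizeTerm u c := by
  have h1 : (K.selected u rep).card ≤ (K.unclustered.filter (fun p => u (.inr p) = 1)).card +
      ∑ q ∈ F₂.filter (fun q => u (.inl q) = 0), (K.star q).card +
      (F₂.filter (fun q => u (.inl q) = 1 ∧ (K.star q).Nonempty)).card := by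
    refine (Finset.card_union_le _ _).trans (add_le_add ((Finset.card_union_le _ _).trans
      (add_le_add le_rfl Finset.card_biUnion_le)) Finset.card_image_le)
  have h2 : ((K.selected u rep).card : ℝ) ≤
      (K.unclustered.filter (fun p => u (.inr p) = 1)).card +
      ∑ q ∈ F₂.filter (fun q => u (.inl q) = 0), ((K.star q).card : ℝ) +
      (F₂.filter (fun q => u (.inl q) = 1 ∧ (K.star q).Nonempty)).card := by exact_mod_cast h1
  have h3 : ∑ p ∈ K.unclustered, u (.inr p) =
      (K.unclustered.filter (fun p => u (.inr p) = 1)).card := by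
    rw [Finset.natCast_card_filter]
    refine Finset.sum_congr rfl fun p hp => ?_
    rcases hu _ (K.vars_inr hp) with h | h <;> simp [h]
  have h4 : ((K.extra u).card : ℝ) + ∑ q ∈ F₂.filter (fun q => u (.inl q) = 0),
      ((K.star q).card : ℝ) + (F₂.filter (fun q => u (.inl q) = 1 ∧ (K.star q).Nonempty)).card =
      ∑ q ∈ F₂, (u (.inl q) + (K.star q).card * (1 - u (.inl q))) := by
    rw [extra, Finset.natCast_card_filter, Finset.natCast_card_filter, Finset.sum_filter,
      ← Finset.sum_add_distrib, ← Finset.sum_add_distrib]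
    refine Finset.sum_congr rfl fun q hq => ?_
    rcases hu _ (K.vars_inl hq) with h | h
    · simp [h]
    · by_cases hs : K.star q = ∅
      · simp [h, hs]
      · simp [h, hs, Finset.nonempty_iff_ne_empty]
  rw [vars, Finset.sum_disjSum]
  simp only [sizeTerm]
  linarith

theorem cost_selected_add_extra_le (h₁ : ∀ p ∈ F₁, 0 ≤ p.2) (h₂ : ∀ q ∈ F₂, 0 ≤ q.2)
    (hrep : ∀ q ∈ F₂, (K.star q).Nonempty → rep q ∈ K.star q)
    (hu : ∀ c ∈ K.vars, u c = 0 ∨ u c = 1) :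
    ∑ q ∈ K.extra u, 2 * q.2 + cost (K.selected u rep) ≤ ∑ c ∈ K.vars, K.extractCost u rep c := by
  have hn1 : ∀ p ∈ K.unclustered.filter (fun p => u (.inr p) = 1), 0 ≤ p.2 := fun p hp =>
    h₁ p (Finset.mem_filter.1 (Finset.mem_filter.1 hp).1).1
  have hn2 : ∀ q ∈ F₂.filter (fun q => u (.inl q) = 0), ∀ p ∈ K.star q, 0 ≤ p.2 := fun q _ p hp =>
    h₁ p (K.mem_star.1 hp).1
  have hn3 : ∀ q ∈ F₂.filter (fun q => u (.inl q) = 1 ∧ (K.star q).Nonempty),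
      0 ≤ (K.merged q (rep q)).2 := by
    intro q hq
    obtain ⟨hq, -, hne⟩ := Finset.mem_filter.1 hq
    have a1 := h₂ q hq
    have a2 := h₁ _ (K.mem_star.1 (hrep q hq hne)).1
    have a3 := fold_max_nonneg ((K.star q).erase (rep q))
    simp only [merged]; linarith
  have h2 : cost (K.selected u rep) ≤ cost (K.unclustered.filter (fun p => u (.inr p) = 1)) +
      ∑ q ∈ F₂.filter (fun q => u (.inl q) = 0), cost (K.star q) +
      ∑ q ∈ F₂.filter (fun q => u (.inl q) = 1 ∧ (K.star q).Nonempty),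
        (K.merged q (rep q)).2 := by
    refine (cost_union_le ?_).trans (add_le_add ((cost_union_le hn1).trans
      (add_le_add le_rfl (cost_biUnion_le _ _ hn2))) (cost_image_le _ _ hn3))
    intro p hp
    rcases Finset.mem_union.1 hp with hp | hp
    · exact hn1 p hp
    · obtain ⟨q, hq, hpq⟩ := Finset.mem_biUnion.1 hp
      exact hn2 q hq p hpq
  have h3 : ∑ p ∈ K.unclustered, u (.inr p) * p.2 =
      cost (K.unclustered.filter (fun p => u (.inr p) = 1)) := by
    rw [cost, Finset.sum_filter]
    refine Finset.sum_congr rfl fun p hp => ?_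
    rcases hu _ (K.vars_inr hp) with h | h <;> simp [h]
  have h4 : ∑ q ∈ K.extra u, 2 * q.2 + ∑ q ∈ F₂.filter (fun q => u (.inl q) = 0),
      cost (K.star q) + ∑ q ∈ F₂.filter (fun q => u (.inl q) = 1 ∧ (K.star q).Nonempty),
        (K.merged q (rep q)).2 = ∑ q ∈ F₂, K.extractCost u rep (.inl q) := by
    rw [extra, Finset.sum_filter, Finset.sum_filter, Finset.sum_filter,
      ← Finset.sum_add_distrib, ← Finset.sum_add_distrib]
    refine Finset.sum_congr rfl fun q hq => ?_
    rcases hu _ (K.vars_inl hq) with h | h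
    · simp [h, extractCost, cost]
    · by_cases hs : K.star q = ∅
      · simp [h, hs, extractCost]
      · simp [h, hs, Finset.nonempty_iff_ne_empty, extractCost]
  rw [vars, Finset.sum_disjSum]
  have h5 : ∑ p ∈ K.unclustered, K.extractCost u rep (.inr p) =
      ∑ p ∈ K.unclustered, u (.inr p) * p.2 := rfl
  linarith

theorem IsExtracted.card_le (hu : ∀ c ∈ K.vars, u c = 0 ∨ u c = 1)
    (h : K.IsExtracted rad₁ rad₂ u A) : (A.F.card : ℝ) ≤ ∑ c ∈ K.vars, K.sizeTerm u c := by
  obtain ⟨rep, hit, S, -, rfl, -, hF, -, -⟩ := h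
  refine le_trans ?_ (K.card_selected_add_extra_le (rep := rep) hu)
  rw [hF]
  have h1 := Finset.card_union_le (K.isolated u (K.selected u rep))
    ((K.selected u rep).image (fun p => (p.1, p.2 + ∑ q ∈ (K.extra u \
      K.isolated u (K.selected u rep)).filter (fun q => hit q = p), 2 * q.2)))
  have h2 : (K.isolated u (K.selected u rep)).card ≤ (K.extra u).card :=
    Finset.card_le_card (Finset.filter_subset _ _)
  have h3 := (h1.trans (add_le_add h2 Finset.card_image_le))
  exact_mod_cast h3

theorem IsExtracted.cost_le (h₁ : ∀ p ∈ F₁, 0 ≤ p.2) (h₂ : ∀ q ∈ F₂, 0 ≤ q.2)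
    (hu : ∀ c ∈ K.vars, u c = 0 ∨ u c = 1) (h : K.IsExtracted rad₁ rad₂ u A) :
    ∃ rep : Pair X → Pair X, (∀ q ∈ F₂, (K.star q).Nonempty → rep q ∈ K.star q) ∧
      cost A.F ≤ ∑ c ∈ K.vars, K.extractCost u rep c := by
  obtain ⟨rep, hit, S, hrep, rfl, hhit, hF, -, -⟩ := h
  refine ⟨rep, hrep, le_trans ?_ (K.cost_selected_add_extra_le h₁ h₂ hrep hu)⟩
  set S := K.selected u rep with hS
  set J := K.isolated u S with hJ
  have hS0 : ∀ p ∈ S, 0 ≤ p.2 := fun p hp => by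
    obtain ⟨p', hp', -, hle⟩ := K.origin_of_mem_selected h₂ hrep hp
    exact (h₁ p' hp').trans hle
  have hE0 : ∀ q ∈ K.extra u, 0 ≤ q.2 := fun q hq => h₂ q (Finset.mem_filter.1 hq).1
  have hJE : J ⊆ K.extra u := Finset.filter_subset _ _
  rw [hF]
  have h1 : cost (S.image (fun p => (p.1, p.2 + ∑ q ∈ (K.extra u \ J).filter
      (fun q => hit q = p), 2 * q.2))) ≤ cost S + ∑ q ∈ K.extra u \ J, 2 * q.2 := by
    refine (cost_image_le _ _ fun p hp => add_nonneg (hS0 p hp) (Finset.sum_nonneg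
      fun q hq => ?_)).trans ?_
    · have := hE0 q (Finset.mem_sdiff.1 (Finset.mem_filter.1 hq).1).1
      positivity
    · simp only
      -- Each absorbed pair has one absorber, so the increases, grouped by absorber, add up to twice
      -- the absorbed radii.
      rw [Finset.sum_add_distrib,
        Finset.sum_fiberwise_of_maps_to (fun q hq => (hhit q hq).1) (fun q => 2 * q.2)]
      rfl
  have h2 := cost_union_le (S := J) (T := S.image (fun p => (p.1, p.2 + ∑ q ∈
    (K.extra u \ J).filter (fun q => hit q = p), 2 * q.2))) fun q hq => hE0 q (hJE hq)
  have h3 : cost J ≤ ∑ q ∈ J, 2 * q.2 :=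
    Finset.sum_le_sum fun q hq => by linarith [hE0 q (hJE hq)]
  have h4 := Finset.sum_sdiff (f := fun q : Pair X => 2 * q.2) hJE
  linarith

/-- Clustered `F₁`-balls are always covered, by themselves or by the merged pair. Hence only
`F₂`-pairs and unclustered `F₁`-pairs of value `0` can lose clients covered by one solution alone. A
client covered by both solutions is never lost: its `F₁`-ball meets an `F₂`-ball and is therefore
clustered. -/
theorem IsExtracted.card_uncov_le (h₂ : ∀ q ∈ F₂, 0 ≤ q.2)
    (hu : ∀ c ∈ K.vars, u c = 0 ∨ u c = 1) (h : K.IsExtracted rad₁ rad₂ u A) :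
    ((G.uncov A.F).card : ℝ) ≤
      (G.uncov F₁ ∩ G.uncov F₂).card + ∑ c ∈ K.vars, (1 - u c) * K.outCoef c := by
  obtain ⟨rep, hit, S, hrep, hSdef, hhit, hF, -, -⟩ := h
  have hS : ∀ p ∈ S, ∃ p' ∈ A.F, p'.1 = p.1 ∧ p.2 ≤ p'.2 ∧
      p.2 + ∑ q ∈ (K.extra u \ K.isolated u S).filter (fun q => hit q = p), 2 * q.2 ≤ p'.2 := by
    intro p hp
    refine ⟨(p.1, p.2 + ∑ q ∈ (K.extra u \ K.isolated u S).filter (fun q => hit q = p), 2 * q.2),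
      by rw [hF]; exact Finset.mem_union_right _ (Finset.mem_image.2 ⟨p, hp, rfl⟩), rfl, ?_,
      le_rfl⟩
    refine le_add_of_nonneg_right (Finset.sum_nonneg fun q hq => ?_)
    have := h₂ q (Finset.mem_filter.1 (Finset.mem_sdiff.1 (Finset.mem_filter.1 hq).1).1).1
    positivity
  have hcovS : ∀ p ∈ S, ∃ p' ∈ A.F, I.ball p ⊆ I.ball p' := by
    intro p hp
    obtain ⟨p', hp', h1, h2, -⟩ := hS p hp
    exact ⟨p', hp', ball_subset_of_fst_eq h1.symm h2⟩
  have hmerged : ∀ q ∈ F₂, u (.inl q) = 1 → (K.star q).Nonempty → K.merged q (rep q) ∈ S := by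
    intro q hq huq hne
    rw [hSdef]
    exact Finset.mem_union_right _ (Finset.mem_image_of_mem _ (Finset.mem_filter.2 ⟨hq, huq, hne⟩))
  have hstar : ∀ q ∈ F₂, ∀ p ∈ K.star q, ∃ p' ∈ A.F, I.ball p ⊆ I.ball p' := by
    intro q hq p hp
    rcases hu _ (K.vars_inl hq) with h | h
    · refine hcovS p ?_
      rw [hSdef]
      exact Finset.mem_union_left _ (Finset.mem_union_right _
        (Finset.mem_biUnion.2 ⟨q, Finset.mem_filter.2 ⟨hq, h⟩, hp⟩))
    · obtain ⟨p', hp', hsub⟩ := hcovS _ (hmerged q hq h ⟨p, hp⟩)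
      exact ⟨p', hp', (K.ball_subset_merged (h₂ q hq) (hrep q hq ⟨p, hp⟩) hp).trans hsub⟩
  have hun : ∀ p ∈ K.unclustered, u (.inr p) = 1 → ∃ p' ∈ A.F, I.ball p ⊆ I.ball p' := by
    intro p hp h
    refine hcovS p ?_
    rw [hSdef]
    exact Finset.mem_union_left _ (Finset.mem_union_left _ (Finset.mem_filter.2 ⟨hp, h⟩))
  have hF₂ : ∀ q ∈ F₂, u (.inl q) = 1 → ∃ p' ∈ A.F, I.ball q ⊆ I.ball p' := by
    intro q hq h
    by_cases hne : (K.star q).Nonempty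
    · obtain ⟨p', hp', hsub⟩ := hcovS _ (hmerged q hq h hne)
      exact ⟨p', hp', (K.ball_center_subset_merged (hrep q hq hne)).trans hsub⟩
    · have hqE : q ∈ K.extra u :=
        Finset.mem_filter.2 ⟨hq, h, Finset.not_nonempty_iff_eq_empty.1 hne⟩
      by_cases hqI : q ∈ K.isolated u S
      · exact ⟨q, by rw [hF]; exact Finset.mem_union_left _ hqI, subset_rfl⟩
      · have hqd : q ∈ K.extra u \ K.isolated u S := Finset.mem_sdiff.2 ⟨hqE, hqI⟩
        obtain ⟨hhS, hint⟩ := hhit q hqd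
        obtain ⟨p', hp', h1, -, h3⟩ := hS _ hhS
        refine ⟨p', hp', ball_subset_ball ?_⟩
        have h4 : 2 * q.2 ≤ ∑ q' ∈ (K.extra u \ K.isolated u S).filter
            (fun q' => hit q' = hit q), 2 * q'.2 :=
          Finset.single_le_sum (f := fun q' : Pair X => 2 * q'.2)
            (fun q' hq' => by
              have := h₂ q' (Finset.mem_filter.1
                (Finset.mem_sdiff.1 (Finset.mem_filter.1 hq').1).1).1
              positivity)
            (Finset.mem_filter.2 ⟨hqd, rfl⟩)
        unfold Intersects at hint
        rw [h1]
        linarith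
  have hsub : G.uncov A.F ⊆ (G.uncov F₁ ∩ G.uncov F₂) ∪
      ((F₂.filter (fun q => u (.inl q) = 0)).biUnion K.uc₁ ∪
        (K.unclustered.filter (fun p => u (.inr p) = 0)).biUnion K.uc₂) := by
    intro j hj
    obtain ⟨hjD, hjA⟩ := Guess.mem_uncov.1 hj
    have hno : ∀ p, (∃ p' ∈ A.F, I.ball p ⊆ I.ball p') → j ∉ I.ball p := by
      rintro p ⟨p', hp', hsub⟩ hjp
      exact hjA p' hp' (hsub hjp)
    rw [Finset.mem_union, Finset.mem_union]
    by_cases hj1 : j ∈ G.uncov F₁ <;> by_cases hj2 : j ∈ G.uncov F₂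
    · exact Or.inl (Finset.mem_inter.2 ⟨hj1, hj2⟩)
    · have : j ∈ F₂.biUnion K.uc₁ := by
        rw [K.uc₁_union]; exact Finset.mem_sdiff.2 ⟨hj1, hj2⟩
      obtain ⟨q, hq, hjq⟩ := Finset.mem_biUnion.1 this
      rcases hu _ (K.vars_inl hq) with h | h
      · exact Or.inr (Or.inl (Finset.mem_biUnion.2 ⟨q, Finset.mem_filter.2 ⟨hq, h⟩, hjq⟩))
      · exact absurd (K.uc₁_sub q hq hjq) (hno q (hF₂ q hq h))
    · have : j ∈ F₁.biUnion K.uc₂ := by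
        rw [K.uc₂_union]; exact Finset.mem_sdiff.2 ⟨hj2, hj1⟩
      obtain ⟨p, hp, hjp⟩ := Finset.mem_biUnion.1 this
      rcases K.star_or_unclustered hp with ⟨q, hq, hpq⟩ | hpu
      · exact absurd (K.uc₂_sub p hp hjp) (hno p (hstar q hq p hpq))
      · rcases hu _ (K.vars_inr hpu) with h | h
        · exact Or.inr (Or.inr (Finset.mem_biUnion.2 ⟨p, Finset.mem_filter.2 ⟨hpu, h⟩, hjp⟩))
        · exact absurd (K.uc₂_sub p hp hjp) (hno p (hun p hpu h))
    · rw [Guess.mem_uncov] at hj1 hj2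
      push Not at hj1 hj2
      obtain ⟨p, hp, hjp⟩ := hj1 hjD
      obtain ⟨q, hq, hjq⟩ := hj2 hjD
      rcases K.star_or_unclustered hp with ⟨q', hq', hpq'⟩ | hpu
      · exact absurd hjp (hno p (hstar q' hq' p hpq'))
      · exact absurd (intersects_of_mem_ball hjp hjq) (K.not_intersects_of_unclustered hpu hq)
  have h1 := (Finset.card_le_card hsub).trans ((Finset.card_union_le _ _).trans
    (add_le_add le_rfl ((Finset.card_union_le _ _).trans
      (add_le_add Finset.card_biUnion_le Finset.card_biUnion_le))))
  have h2 : ((G.uncov A.F).card : ℝ) ≤ (G.uncov F₁ ∩ G.uncov F₂).card +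
      (∑ q ∈ F₂.filter (fun q => u (.inl q) = 0), ((K.uc₁ q).card : ℝ) +
        ∑ p ∈ K.unclustered.filter (fun p => u (.inr p) = 0), ((K.uc₂ p).card : ℝ)) := by
    exact_mod_cast h1
  refine h2.trans_eq ?_
  rw [vars, Finset.sum_disjSum, Finset.sum_filter, Finset.sum_filter]
  congr 2
  · refine Finset.sum_congr rfl fun q hq => ?_
    rcases hu _ (K.vars_inl hq) with h | h <;> simp [h, outCoef]
  · refine Finset.sum_congr rfl fun p hp => ?_
    rcases hu _ (K.vars_inr hp) with h | h <;> simp [h, outCoef]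

/-- Isolated pairs avoid even the enlarged selected pairs, hence their recorded balls. Within each
group, disjointness is inherited from the respective given solution. -/
theorem IsExtracted.isValid (h₁ : G.IsValid ⟨F₁, rad₁⟩) (h₂ : G.IsValid ⟨F₂, rad₂⟩)
    (h : K.IsExtracted rad₁ rad₂ u A) : G.IsValid A := by
  obtain ⟨rep, hit, S, hrep, hSdef, hhit, hF, hr1, hr2⟩ := h
  have hF₂0 : ∀ q ∈ F₂, 0 ≤ q.2 := fun q hq => h₂.nonneg hq
  have hS : ∀ p ∈ S, ∃ p' ∈ F₁, p'.1 = p.1 ∧ p'.2 ≤ p.2 := by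
    intro p hp
    rw [hSdef] at hp
    exact K.origin_of_mem_selected hF₂0 hrep hp
  have hcase : ∀ x ∈ A.F, x ∈ K.isolated u S ∨ ∃ p ∈ S, p.1 = x.1 ∧ p.2 ≤ x.2 := by
    intro x hx
    rw [hF, Finset.mem_union] at hx
    rcases hx with hx | hx
    · exact Or.inl hx
    · obtain ⟨p, hp, rfl⟩ := Finset.mem_image.1 hx
      refine Or.inr ⟨p, hp, rfl, ?_⟩
      refine le_add_of_nonneg_right (Finset.sum_nonneg fun q hq => ?_)
      have := hF₂0 q (Finset.mem_filter.1 (Finset.mem_sdiff.1 (Finset.mem_filter.1 hq).1).1).1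
      positivity
  have hiso : ∀ q ∈ K.isolated u S, q ∈ F₂ ∧ ∀ p ∈ S, ¬ Intersects q p := by
    intro q hq
    obtain ⟨hq1, hq2⟩ := Finset.mem_filter.1 hq
    exact ⟨(Finset.mem_filter.1 hq1).1, hq2⟩
  have hmix : ∀ q ∈ K.isolated u S, ∀ p ∈ S,
      ¬ Intersects (q.1, A.rad q.1) (p.1, A.rad p.1) := by
    intro q hq p hp hint
    obtain ⟨hq2, hno⟩ := hiso q hq
    obtain ⟨p', hp', h1, h2⟩ := hS p hp
    refine hno p hp (hint.mono rfl rfl ?_ ?_)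
    · simp only [hr2 q hq]; exact (h₂.1 q hq2).2
    · rw [hr1 p hp, ← h1]; exact ((h₁.1 p' hp').2).trans h2
  refine ⟨fun x hx => ?_, fun x hx y hy hne => ?_⟩
  · rcases hcase x hx with h | ⟨p, hp, hpx, hle⟩
    · rw [hr2 x h]; exact h₂.1 x (hiso x h).1
    · obtain ⟨p', hp', h1, h2⟩ := hS p hp
      rw [← hpx, hr1 p hp, ← h1]
      exact ⟨(h₁.1 p' hp').1, ((h₁.1 p' hp').2.trans h2).trans hle⟩
  · rcases hcase x hx with hx' | ⟨p, hp, hpx, -⟩ <;> rcases hcase y hy with hy' | ⟨q, hq, hqy, -⟩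
    · rw [hr2 x hx', hr2 y hy']
      exact h₂.2 x (hiso x hx').1 y (hiso y hy').1 hne
    · rw [← hqy]; exact hmix x hx' q hq
    · rw [← hpx]; exact fun h => hmix y hy' p hp h.symm
    · obtain ⟨p', hp', h1, -⟩ := hS p hp
      obtain ⟨q', hq', h2, -⟩ := hS q hq
      rw [← hpx, ← hqy, hr1 p hp, hr1 q hq, ← h1, ← h2]
      refine h₁.2 p' hp' q' hq' ?_
      rw [h1, h2, hpx, hqy]; exact hne

end Extraction

end Clustering

/-- More unknowns than homogeneous equations. The rows will be the LP constraints that a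
perturbation supported on the fractional variables must preserve. -/
theorem exists_kernel_vector {ι : Type*} {m : ℕ} (a : Fin m → ι → ℝ) (s : Finset ι)
    (hs : m < s.card) :
    ∃ d : ι → ℝ, d ≠ 0 ∧ (∀ i, i ∉ s → d i = 0) ∧ ∀ k, ∑ i ∈ s, a k i * d i = 0 := by
  set L : (s → ℝ) →ₗ[ℝ] (Fin m → ℝ) :=
    Matrix.mulVecLin (Matrix.of fun k (i : s) => a k i) with hL
  have hker : LinearMap.ker L ≠ ⊥ := LinearMap.ker_ne_bot_of_finrank_lt (by simpa using hs)
  obtain ⟨x, hx, hx0⟩ := Submodule.exists_mem_ne_zero_of_ne_bot hker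
  refine ⟨fun i => if h : i ∈ s then x ⟨i, h⟩ else 0, ?_, fun i hi => by simp [hi], fun k => ?_⟩
  · intro h
    apply hx0
    funext i
    have := congrFun h i
    simpa using this
  · have h1 : L x k = 0 := by rw [LinearMap.mem_ker.1 hx]; rfl
    have h2 : L x k = ∑ i : s, a k i * x i := rfl
    rw [← h1, h2, ← Finset.sum_coe_sort s]
    exact Finset.sum_congr rfl fun i _ => by simp

namespace Clustering

variable {G : Guess I} {F₁ F₂ : Finset (Pair X)} (K : Clustering G F₁ F₂)

/-! ### Extreme points of the two-constraint LP -/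

/-- The slope of `sizeTerm`. -/
def sizeCoef : Pair X ⊕ Pair X → ℝ
  | .inl q => 1 - (K.star q).card
  | .inr _ => 1

theorem sizeTerm_add_smul (v d : Pair X ⊕ Pair X → ℝ) (t : ℝ) (c : Pair X ⊕ Pair X) :
    K.sizeTerm (v + t • d) c = K.sizeTerm v c + t * (K.sizeCoef c * d c) := by
  rcases c with q | p
  · simp [sizeTerm, sizeCoef]; ring
  · simp [sizeTerm, sizeCoef]

theorem mem_frac {v : Pair X ⊕ Pair X → ℝ} {c : Pair X ⊕ Pair X} :
    c ∈ K.frac v ↔ c ∈ K.vars ∧ 0 < v c ∧ v c < 1 := by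
  simp [frac]

/-- Fractional coordinates have room on both sides, the outlier row does not change at all, and the
size row is either unchanged or slack. -/
theorem eventually_mem_region {v d : Pair X ⊕ Pair X → ℝ} (hv : v ∈ K.region)
    (hd : ∀ c, c ∉ K.frac v → d c = 0) (hout : ∑ c ∈ K.vars, K.outCoef c * d c = 0)
    (hsize : ∑ c ∈ K.vars, K.sizeCoef c * d c = 0 ∨ ∑ c ∈ K.vars, K.sizeTerm v c < G.k') :
    ∀ᶠ t in nhds (0 : ℝ), v + t • d ∈ K.region := by
  obtain ⟨h1, h2, h3, h4⟩ := hv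
  have hbox : ∀ᶠ t in nhds (0 : ℝ), ∀ c ∈ K.frac v, 0 < v c + t * d c ∧ v c + t * d c < 1 := by
    rw [Filter.eventually_all_finset]
    intro c hc
    obtain ⟨-, hc0, hc1⟩ := K.mem_frac.1 hc
    have hcont : Filter.Tendsto (fun t : ℝ => v c + t * d c) (nhds 0) (nhds (v c)) := by
      have : Continuous fun t : ℝ => v c + t * d c := by fun_prop
      simpa using this.tendsto 0
    exact (hcont.eventually (lt_mem_nhds hc0)).and (hcont.eventually (gt_mem_nhds hc1))
  have hsz : ∀ᶠ t in nhds (0 : ℝ), ∑ c ∈ K.vars, K.sizeTerm (v + t • d) c ≤ (G.k' : ℝ) := by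
    have heq : ∀ t : ℝ, ∑ c ∈ K.vars, K.sizeTerm (v + t • d) c =
        ∑ c ∈ K.vars, K.sizeTerm v c + t * ∑ c ∈ K.vars, K.sizeCoef c * d c := by
      intro t
      simp only [sizeTerm_add_smul, Finset.sum_add_distrib, Finset.mul_sum]
    rcases hsize with h | h
    · refine Filter.Eventually.of_forall fun t => ?_
      rw [heq, h]; linarith
    · have hcont : Filter.Tendsto (fun t : ℝ => ∑ c ∈ K.vars, K.sizeTerm v c +
          t * ∑ c ∈ K.vars, K.sizeCoef c * d c) (nhds 0)
          (nhds (∑ c ∈ K.vars, K.sizeTerm v c)) := by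
        have : Continuous fun t : ℝ => ∑ c ∈ K.vars, K.sizeTerm v c +
          t * ∑ c ∈ K.vars, K.sizeCoef c * d c := by fun_prop
        simpa using this.tendsto 0
      filter_upwards [hcont.eventually (gt_mem_nhds h)] with t ht
      rw [heq]; exact ht.le
  filter_upwards [hbox, hsz] with t ht1 ht2
  refine ⟨fun c hc => ?_, fun c hc => ?_, ht2, ?_⟩
  · by_cases hcf : c ∈ K.frac v
    · have := ht1 c hcf
      simp only [Pi.add_apply, Pi.smul_apply, smul_eq_mul]
      exact ⟨this.1.le, this.2.le⟩
    · simpa [hd c hcf] using h1 c hc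
  · have hcf : c ∉ K.frac v := fun h => hc (K.mem_frac.1 h).1
    simpa [hd c hcf] using h2 c hc
  · refine le_trans (le_of_eq ?_) h4
    have : ∀ c, (1 - (v + t • d) c) * (K.outCoef c : ℝ) =
        (1 - v c) * K.outCoef c - t * (K.outCoef c * d c) := fun c => by
      simp only [Pi.add_apply, Pi.smul_apply, smul_eq_mul]; ring
    simp only [this, Finset.sum_sub_distrib, ← Finset.mul_sum, hout]
    ring

theorem not_extreme {v d : Pair X ⊕ Pair X → ℝ} (hv : v ∈ Set.extremePoints ℝ K.region)
    (hd0 : d ≠ 0) (hd : ∀ c, c ∉ K.frac v → d c = 0)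
    (hout : ∑ c ∈ K.vars, K.outCoef c * d c = 0)
    (hsize : ∑ c ∈ K.vars, K.sizeCoef c * d c = 0 ∨ ∑ c ∈ K.vars, K.sizeTerm v c < G.k') :
    False := by
  rw [mem_extremePoints_iff_left] at hv
  have h1 := K.eventually_mem_region hv.1 hd hout hsize
  have h2 : ∀ᶠ t in nhds (0 : ℝ), v + (-t) • d ∈ K.region := by
    have : Filter.Tendsto (fun t : ℝ => -t) (nhds 0) (nhds 0) := by
      simpa using (continuous_neg (G := ℝ)).tendsto 0
    exact this.eventually h1
  have h3 : ∀ᶠ t in nhdsWithin (0 : ℝ) (Set.Ioi 0),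
      (v + t • d ∈ K.region ∧ v + (-t) • d ∈ K.region) ∧ t ∈ Set.Ioi (0 : ℝ) :=
    ((h1.and h2).filter_mono nhdsWithin_le_nhds).and self_mem_nhdsWithin
  obtain ⟨t, ⟨ht1, ht2⟩, ht⟩ := h3.exists
  have h4 := hv.2 _ ht1 _ ht2
    ⟨1 / 2, 1 / 2, by norm_num, by norm_num, by norm_num, by
      funext c; simp only [Pi.add_apply, Pi.smul_apply, smul_eq_mul]; ring⟩
  have h5 : t • d = 0 := by simpa using h4
  rcases smul_eq_zero.1 h5 with h | h
  · exact (ne_of_gt ht) h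
  · exact hd0 h

theorem sum_vars_eq_sum_frac {v d : Pair X ⊕ Pair X → ℝ} (hd : ∀ c, c ∉ K.frac v → d c = 0)
    (a : Pair X ⊕ Pair X → ℝ) : ∑ c ∈ K.vars, a c * d c = ∑ c ∈ K.frac v, a c * d c :=
  (Finset.sum_subset (Finset.filter_subset _ _) fun c _ hc => by rw [hd c hc, mul_zero]).symm

/-- Three fractional variables against two rows leave a direction that preserves both constraints.
-/
theorem card_frac_le_two {v : Pair X ⊕ Pair X → ℝ} (hv : v ∈ Set.extremePoints ℝ K.region) :
    (K.frac v).card ≤ 2 := by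
  by_contra hc
  obtain ⟨d, hd0, hd, h⟩ := exists_kernel_vector
    ![K.sizeCoef, fun c => (K.outCoef c : ℝ)] (K.frac v) (not_le.1 hc)
  refine K.not_extreme hv hd0 hd ?_ (Or.inl ?_)
  · rw [K.sum_vars_eq_sum_frac hd]; exact h 1
  · rw [K.sum_vars_eq_sum_frac hd]; exact h 0

/-- Were the size row slack, only the outlier row would have to be preserved, and two fractional
variables would suffice for a perturbation. -/
theorem size_eq_of_card_frac {v : Pair X ⊕ Pair X → ℝ} (hv : v ∈ Set.extremePoints ℝ K.region)
    (h2 : 1 < (K.frac v).card) : ∑ c ∈ K.vars, K.sizeTerm v c = G.k' := by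
  have hreg := (mem_extremePoints_iff_left.1 hv).1
  refine le_antisymm hreg.2.2.1 ?_
  by_contra hlt
  obtain ⟨d, hd0, hd, h⟩ := exists_kernel_vector
    ![fun c => (K.outCoef c : ℝ)] (K.frac v) h2
  refine K.not_extreme hv hd0 hd ?_ (Or.inr (not_le.1 hlt))
  rw [K.sum_vars_eq_sum_frac hd]; exact h 0

/-! ### Rounding -/

theorem sizeTerm_pos {v : Pair X ⊕ Pair X → ℝ} {c : Pair X ⊕ Pair X} (hc : c ∈ K.frac v) :
    0 < K.sizeTerm v c := by
  obtain ⟨-, h0, h1⟩ := K.mem_frac.1 hc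
  rcases c with q | p
  · have : (0 : ℝ) ≤ (K.star q).card * (1 - v (.inl q)) :=
      mul_nonneg (by positivity) (by linarith)
    simp only [sizeTerm]; linarith
  · exact h0

theorem sizeTerm_of_eq_one {u : Pair X ⊕ Pair X → ℝ} {c : Pair X ⊕ Pair X} (hc : u c = 1) :
    K.sizeTerm u c = 1 := by
  rcases c with q | p <;> simp [sizeTerm, hc]

theorem eq_zero_or_one_of_notMem_frac {v : Pair X ⊕ Pair X → ℝ} (hv : v ∈ K.region)
    {c : Pair X ⊕ Pair X} (hc : c ∈ K.vars) (hcf : c ∉ K.frac v) : v c = 0 ∨ v c = 1 := by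
  obtain ⟨h0, h1⟩ := hv.1 c hc
  by_contra hcon
  push Not at hcon
  exact hcf (K.mem_frac.2 ⟨hc, lt_of_le_of_ne h0 hcon.1.symm, lt_of_le_of_ne h1 hcon.2⟩)

theorem exists_nat_eq_integral_size {v : Pair X ⊕ Pair X → ℝ} (hv : v ∈ K.region) :
    ∃ n : ℕ, ∑ c ∈ K.vars \ K.frac v, K.sizeTerm v c = n := by
  have : ∑ c ∈ K.vars \ K.frac v, K.sizeTerm v c ∈ AddMonoidHom.mrange (Nat.castAddMonoidHom ℝ) := by
    refine sum_mem fun c hc => ?_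
    obtain ⟨hc1, hc2⟩ := Finset.mem_sdiff.1 hc
    rcases K.eq_zero_or_one_of_notMem_frac hv hc1 hc2 with h | h
    · rcases c with q | p
      · exact ⟨(K.star q).card, by simp [sizeTerm, h]⟩
      · exact ⟨0, by simp [sizeTerm, h]⟩
    · exact ⟨1, by simp [K.sizeTerm_of_eq_one h]⟩
  obtain ⟨n, hn⟩ := this
  exact ⟨n, hn.symm⟩

/-- What a rounded vector satisfies. -/
structure RoundSpec (v u : Pair X ⊕ Pair X → ℝ) : Prop where
  zero_or_one : ∀ c ∈ K.vars, u c = 0 ∨ u c = 1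
  eq_of_notMem_frac : ∀ c ∈ K.vars, c ∉ K.frac v → u c = v c
  star_eq_empty : ∀ q, Sum.inl q ∈ K.frac v → u (.inl q) = 0 → K.star q = ∅
  size_le : ∑ c ∈ K.vars, K.sizeTerm u c ≤ G.k'
  out_le : (G.uncov F₁ ∩ G.uncov F₂).card + ∑ c ∈ K.vars, (1 - u c) * K.outCoef c ≤ (I.m : ℝ)

theorem sizeTerm_congr {v u : Pair X ⊕ Pair X → ℝ} {c : Pair X ⊕ Pair X} (h : u c = v c) :
    K.sizeTerm u c = K.sizeTerm v c := by
  rcases c with q | p <;> simp [sizeTerm, h]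

theorem sum_vars_split (v : Pair X ⊕ Pair X → ℝ) (g : Pair X ⊕ Pair X → ℝ) :
    ∑ c ∈ K.vars, g c = ∑ c ∈ K.vars \ K.frac v, g c + ∑ c ∈ K.frac v, g c :=
  (Finset.sum_sdiff (Finset.filter_subset _ _)).symm

/-- Rounding up can only help the outlier row. For the size row, each of the at most two fractional
variables becomes `1`. Either they contributed that much already, or integrality of the remaining
sum makes up for it: a positive fractional contribution frees one unit. -/
theorem roundSpec_of_roundsUp {v u : Pair X ⊕ Pair X → ℝ}
    (hv : v ∈ Set.extremePoints ℝ K.region) (hup : K.RoundsUp v) (hu : ∀ c, u c = (⌈v c⌉ : ℝ)) :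
    K.RoundSpec v u := by
  have hreg := (mem_extremePoints_iff_left.1 hv).1
  have hint : ∀ c ∈ K.vars, c ∉ K.frac v → u c = v c := by
    intro c hc hcf
    rw [hu]
    rcases K.eq_zero_or_one_of_notMem_frac hreg hc hcf with h | h <;> simp [h]
  have hfrac : ∀ c ∈ K.frac v, u c = 1 := by
    intro c hc
    obtain ⟨-, h0, h1⟩ := K.mem_frac.1 hc
    rw [hu]
    have : ⌈v c⌉ = 1 := by
      rw [Int.ceil_eq_iff]; constructor <;> push_cast <;> linarith
    rw [this]; norm_num
  have hle : ∀ c ∈ K.vars, v c ≤ u c := fun c _ => by rw [hu]; exact Int.le_ceil _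
  refine ⟨?_, hint, ?_, ?_, ?_⟩
  · intro c hc
    by_cases hcf : c ∈ K.frac v
    · exact Or.inr (hfrac c hcf)
    · rw [hint c hc hcf]; exact K.eq_zero_or_one_of_notMem_frac hreg hc hcf
  · intro q hq h
    rw [hfrac _ hq] at h
    exact absurd h one_ne_zero
  · have hs := hreg.2.2.1
    rw [K.sum_vars_split v] at hs ⊢
    obtain ⟨n, hn⟩ := K.exists_nat_eq_integral_size hreg
    have h1 : ∑ c ∈ K.vars \ K.frac v, K.sizeTerm u c = n := by
      rw [← hn]
      refine Finset.sum_congr rfl fun c hc => ?_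
      obtain ⟨hc1, hc2⟩ := Finset.mem_sdiff.1 hc
      exact K.sizeTerm_congr (hint c hc1 hc2)
    have h2 : ∑ c ∈ K.frac v, K.sizeTerm u c = (K.frac v).card := by
      rw [Finset.sum_congr rfl fun c hc => K.sizeTerm_of_eq_one (hfrac c hc)]
      simp
    rw [h1, h2]
    rw [hn] at hs
    have hcard := K.card_frac_le_two hv
    have hcard' : ((K.frac v).card : ℝ) ≤ 2 := by exact_mod_cast hcard
    rcases hup with h | h | ⟨q, hq, hne⟩
    · linarith
    · rcases Finset.eq_empty_or_nonempty (K.frac v) with h0 | h0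
      · rw [h0] at hs ⊢; simpa using hs
      · have hpos : 0 < ∑ c ∈ K.frac v, K.sizeTerm v c :=
          Finset.sum_pos (fun c hc => K.sizeTerm_pos hc) h0
        have h3 : (n : ℝ) < G.k' := by linarith
        have h4 : n < G.k' := by exact_mod_cast h3
        exact_mod_cast (by omega : n + (K.frac v).card ≤ G.k')
    -- With a non-empty star, `x + s * (1 - x) ≥ 1`. A second fractional variable contributes
    -- something positive, so integrality frees a second unit.
    · have hq1 : 1 ≤ K.sizeTerm v (.inl q) := by
        obtain ⟨-, h0, h1⟩ := K.mem_frac.1 hq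
        have : (1 : ℝ) ≤ (K.star q).card := by exact_mod_cast Finset.card_pos.2 hne
        simp only [sizeTerm]
        nlinarith
      have hsum := Finset.add_sum_erase (K.frac v) (K.sizeTerm v) hq
      have hce := Finset.card_erase_add_one hq
      rcases Finset.eq_empty_or_nonempty ((K.frac v).erase (.inl q)) with h0 | h0
      · rw [h0, Finset.card_empty] at hce
        rw [h0, Finset.sum_empty] at hsum
        rw [← hce]; push_cast; linarith
      · have hpos : 0 < ∑ c ∈ (K.frac v).erase (.inl q), K.sizeTerm v c :=
          Finset.sum_pos (fun c hc => K.sizeTerm_pos (Finset.mem_of_mem_erase hc)) h0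
        have h3 : (n : ℝ) + 1 < G.k' := by linarith
        have h4 : n + 1 < G.k' := by exact_mod_cast h3
        exact_mod_cast (by omega : n + (K.frac v).card ≤ G.k')
  · have h4 := hreg.2.2.2
    have : ∑ c ∈ K.vars, (1 - u c) * (K.outCoef c : ℝ) ≤
        ∑ c ∈ K.vars, (1 - v c) * K.outCoef c :=
      Finset.sum_le_sum fun c hc =>
        mul_le_mul_of_nonneg_right (by linarith [hle c hc]) (by positivity)
    linarith

/-- Exactly two variables are fractional and neither has a star, so each contributes its own value.
The tight size row makes their sum an integer strictly between `0` and `2`, hence `1`. Moving all of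
it to the variable with the larger outlier coefficient keeps the size and does not increase the
number of outliers. -/
theorem roundSpec_of_not_roundsUp {v u : Pair X ⊕ Pair X → ℝ}
    (hv : v ∈ Set.extremePoints ℝ K.region) (hup : ¬ K.RoundsUp v)
    (hu : ∀ c, c ∉ K.frac v → u c = v c) {a : Pair X ⊕ Pair X} (ha : a ∈ K.frac v)
    (hmax : ∀ d ∈ K.frac v, K.outCoef d ≤ K.outCoef a) (hua : u a = 1)
    (hud : ∀ d ∈ K.frac v, d ≠ a → u d = 0) : K.RoundSpec v u := by
  have hreg := (mem_extremePoints_iff_left.1 hv).1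
  unfold RoundsUp at hup
  push Not at hup
  obtain ⟨hup1, hup2, hup3⟩ := hup
  have hcard : (K.frac v).card = 2 := le_antisymm (K.card_frac_le_two hv) hup2
  have hsize := K.size_eq_of_card_frac hv hup2
  have hstar : ∀ q, Sum.inl q ∈ K.frac v → K.star q = ∅ := hup3
  have hterm : ∀ w : Pair X ⊕ Pair X → ℝ, ∀ c ∈ K.frac v, K.sizeTerm w c = w c := by
    intro w c hc
    rcases c with q | p
    · simp [sizeTerm, hstar q hc]
    · rfl
  obtain ⟨b, hb⟩ : ∃ b, (K.frac v).erase a = {b} := by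
    rw [← Finset.card_eq_one, Finset.card_erase_of_mem ha, hcard]
  have hbe : b ∈ (K.frac v).erase a := by rw [hb]; exact Finset.mem_singleton_self _
  obtain ⟨hba, hbf⟩ := Finset.mem_erase.1 hbe
  have hsplit : ∀ g : Pair X ⊕ Pair X → ℝ, ∑ c ∈ K.vars, g c =
      ∑ c ∈ K.vars \ K.frac v, g c + (g a + g b) := by
    intro g
    rw [K.sum_vars_split v, ← Finset.add_sum_erase _ g ha, hb, Finset.sum_singleton]
  obtain ⟨n, hn⟩ := K.exists_nat_eq_integral_size hreg
  have hab : v a + v b = 1 := by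
    rw [hsplit, hn, hterm v a ha, hterm v b hbf] at hsize
    obtain ⟨-, ha0, ha1⟩ := K.mem_frac.1 ha
    obtain ⟨-, hb0, hb1⟩ := K.mem_frac.1 hbf
    have h1 : (n : ℝ) < G.k' := by linarith
    have h2 : (G.k' : ℝ) < n + 2 := by linarith
    have h3 : n < G.k' := by exact_mod_cast h1
    have h4 : G.k' < n + 2 := by exact_mod_cast h2
    have h5 : G.k' = n + 1 := by omega
    rw [h5] at hsize
    push_cast at hsize
    linarith
  have hint : ∀ c ∈ K.vars \ K.frac v, u c = v c := fun c hc => hu c (Finset.mem_sdiff.1 hc).2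
  refine ⟨?_, fun c _ hcf => hu c hcf, fun q hq _ => hstar q hq, ?_, ?_⟩
  · intro c hc
    by_cases hcf : c ∈ K.frac v
    · by_cases hca : c = a
      · rw [hca]; exact Or.inr hua
      · exact Or.inl (hud c hcf hca)
    · rw [hu c hcf]; exact K.eq_zero_or_one_of_notMem_frac hreg hc hcf
  · rw [← hsize, hsplit, hsplit, hterm u a ha, hterm u b hbf, hterm v a ha, hterm v b hbf, hua,
      hud b hbf hba, Finset.sum_congr rfl fun c hc => K.sizeTerm_congr (hint c hc)]
    linarith
  · have h4 := hreg.2.2.2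
    rw [hsplit] at h4 ⊢
    rw [hua, hud b hbf hba, Finset.sum_congr rfl fun c hc => by rw [hint c hc]]
    have h5 : (K.outCoef b : ℝ) ≤ K.outCoef a := by exact_mod_cast hmax b hbf
    obtain ⟨-, ha0, ha1⟩ := K.mem_frac.1 ha
    have h6 : v b = 1 - v a := by linarith
    rw [h6] at h4
    nlinarith [mul_le_mul_of_nonneg_left h5 (by linarith : 0 ≤ 1 - v a)]

theorem IsRounding.spec {v u : Pair X ⊕ Pair X → ℝ} (hv : v ∈ Set.extremePoints ℝ K.region)
    (h : K.IsRounding v u) : K.RoundSpec v u := by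
  rcases h with ⟨hup, hu⟩ | ⟨hup, hu, a, ha, hmax, hua, hud⟩
  · exact K.roundSpec_of_roundsUp hv hup hu
  · exact K.roundSpec_of_not_roundsUp hv hup hu ha hmax hua hud

theorem exists_isRounding (v : Pair X ⊕ Pair X → ℝ) : ∃ u, K.IsRounding v u := by
  by_cases hup : K.RoundsUp v
  · exact ⟨fun c => (⌈v c⌉ : ℝ), Or.inl ⟨hup, fun _ => rfl⟩⟩
  · have hne : (K.frac v).Nonempty := by
      rw [← Finset.card_pos]
      unfold RoundsUp at hup
      push Not at hup
      omega
    obtain ⟨a, ha, hmax⟩ := Finset.exists_max_image (K.frac v) K.outCoef hne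
    refine ⟨fun c => if c ∈ K.frac v then if c = a then 1 else 0 else v c, Or.inr ⟨hup,
      fun c hc => by simp [hc], a, ha, hmax, by simp [ha], fun d hd hda => by simp [hd, hda]⟩⟩

/-! ### Cost of the extracted solution -/

theorem costTerm_nonneg (h₁ : ∀ p ∈ F₁, 0 ≤ p.2) (h₂ : ∀ q ∈ F₂, 0 ≤ q.2)
    {v : Pair X ⊕ Pair X → ℝ} (hv : v ∈ K.region) {c : Pair X ⊕ Pair X} (hc : c ∈ K.vars) :
    0 ≤ K.costTerm v c := by
  obtain ⟨h0, h1⟩ := hv.1 c hc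
  rcases c with q | p
  · have hq := h₂ q (Finset.inl_mem_disjSum.1 hc)
    have hs : 0 ≤ ∑ p ∈ K.star q, p.2 :=
      Finset.sum_nonneg fun p hp => h₁ p (K.mem_star.1 hp).1
    have hs2 : 0 ≤ ∑ p ∈ K.star q, 2 * p.2 := by rw [← Finset.mul_sum]; positivity
    exact add_nonneg (mul_nonneg h0 (by positivity)) (mul_nonneg (by linarith) hs)
  · exact mul_nonneg h0 (h₁ p (Finset.mem_filter.1 (Finset.inr_mem_disjSum.1 hc)).1)

theorem extractCost_le_costTerm (h₁ : ∀ p ∈ F₁, 0 ≤ p.2) (h₂ : ∀ q ∈ F₂, 0 ≤ q.2)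
    {rep : Pair X → Pair X} (hrep : ∀ q ∈ F₂, (K.star q).Nonempty → rep q ∈ K.star q)
    {v u : Pair X ⊕ Pair X → ℝ} {c : Pair X ⊕ Pair X} (hc : c ∈ K.vars)
    (hv : v c = 0 ∨ v c = 1) (hu : u c = v c) :
    K.extractCost u rep c ≤ K.costTerm v c := by
  rcases c with q | p
  · have hqF := Finset.inl_mem_disjSum.1 hc
    have hq := h₂ q hqF
    have hs : 0 ≤ ∑ p ∈ K.star q, p.2 :=
      Finset.sum_nonneg fun p hp => h₁ p (K.mem_star.1 hp).1
    rcases hv with h | h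
    · simp [extractCost, costTerm, hu, h]
    · simp only [extractCost, costTerm, hu, h, one_ne_zero, if_false]
      split_ifs with he
      · simp [he]
      · have hr := hrep q hqF (Finset.nonempty_iff_ne_empty.2 he)
        have hr0 := h₁ _ (K.mem_star.1 hr).1
        -- The merged radius uses a maximum, the LP objective a sum; this is where the
        -- representative's own radius is needed only once.
        have hfold : ((K.star q).erase (rep q)).fold max 0 (fun p' => 2 * p'.2) ≤
            ∑ p ∈ (K.star q).erase (rep q), 2 * p.2 := by
          have hnn : ∀ p ∈ (K.star q).erase (rep q), 0 ≤ 2 * p.2 := fun p hp => by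
            have := h₁ p (K.mem_star.1 (Finset.mem_of_mem_erase hp)).1
            positivity
          exact (Finset.fold_max_le _).2 ⟨Finset.sum_nonneg hnn, fun p hp =>
            Finset.single_le_sum (f := fun p : Pair X => 2 * p.2) hnn hp⟩
        rw [← Finset.add_sum_erase _ (fun p : Pair X => 2 * p.2) hr]
        simp only [merged]
        linarith
  · simp [extractCost, costTerm, hu]

theorem extractCost_le {r : ℝ} (hr0 : 0 ≤ r) (h₁ : ∀ p ∈ F₁, p.2 ≤ r)
    (h₂ : ∀ q ∈ F₂, q.2 ≤ r)
    {rep : Pair X → Pair X} (hrep : ∀ q ∈ F₂, (K.star q).Nonempty → rep q ∈ K.star q)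
    {u : Pair X ⊕ Pair X → ℝ} {c : Pair X ⊕ Pair X} (hc : c ∈ K.vars)
    (hu : u c = 0 ∨ u c = 1) (hstar : ∀ q, c = .inl q → u c = 0 → K.star q = ∅) :
    K.extractCost u rep c ≤ 5 * r := by
  rcases c with q | p
  · have hqF := Finset.inl_mem_disjSum.1 hc
    have hq := h₂ q hqF
    simp only [extractCost]
    split_ifs with h0 he
    · rw [hstar q rfl h0]; simp; linarith
    · linarith
    · have hr := hrep q hqF (Finset.nonempty_iff_ne_empty.2 he)
      have hr1 := h₁ _ (K.mem_star.1 hr).1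
      have hfold : ((K.star q).erase (rep q)).fold max 0 (fun p' => 2 * p'.2) ≤ 2 * r :=
        (Finset.fold_max_le _).2 ⟨by positivity, fun p hp => by
          linarith [h₁ p (K.mem_star.1 (Finset.mem_of_mem_erase hp)).1]⟩
      simp only [merged]
      linarith
  · have hp := h₁ p (Finset.mem_filter.1 (Finset.inr_mem_disjSum.1 hc)).1
    rcases hu with h | h <;> simp [extractCost, h] <;> linarith

/-- Integral variables are paid for by the LP objective. Each of the at most two fractional ones
yields a radius of at most `2r + r + 2r`; an unselected star is empty by `RoundSpec`. -/
theorem sum_extractCost_le {r : ℝ} (hr0 : 0 ≤ r) (h₁ : ∀ p ∈ F₁, 0 ≤ p.2 ∧ p.2 ≤ r)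
    (h₂ : ∀ q ∈ F₂, 0 ≤ q.2 ∧ q.2 ≤ r)
    {rep : Pair X → Pair X} (hrep : ∀ q ∈ F₂, (K.star q).Nonempty → rep q ∈ K.star q)
    {v u : Pair X ⊕ Pair X → ℝ} (hv : v ∈ Set.extremePoints ℝ K.region) (hu : K.RoundSpec v u) :
    ∑ c ∈ K.vars, K.extractCost u rep c ≤ K.obj v + 10 * r := by
  have hreg := (mem_extremePoints_iff_left.1 hv).1
  rw [obj, K.sum_vars_split v, K.sum_vars_split v (K.costTerm v)]
  have h3 : ∑ c ∈ K.vars \ K.frac v, K.extractCost u rep c ≤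
      ∑ c ∈ K.vars \ K.frac v, K.costTerm v c := by
    refine Finset.sum_le_sum fun c hc => ?_
    obtain ⟨hc1, hc2⟩ := Finset.mem_sdiff.1 hc
    exact K.extractCost_le_costTerm (fun p hp => (h₁ p hp).1) (fun p hp => (h₂ p hp).1) hrep hc1
      (K.eq_zero_or_one_of_notMem_frac hreg hc1 hc2) (hu.eq_of_notMem_frac c hc1 hc2)
  have h4 : ∑ c ∈ K.frac v, K.extractCost u rep c ≤ ∑ c ∈ K.frac v, 5 * r := by
    refine Finset.sum_le_sum fun c hc => ?_
    have hc1 := (K.mem_frac.1 hc).1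
    refine K.extractCost_le hr0 (fun p hp => (h₁ p hp).2) (fun p hp => (h₂ p hp).2) hrep hc1
      (hu.zero_or_one c hc1) ?_
    rintro q rfl h
    exact hu.star_eq_empty q hc h
  have h5 : ∑ c ∈ K.frac v, 5 * r ≤ 10 * r := by
    rw [Finset.sum_const, nsmul_eq_mul]
    have : ((K.frac v).card : ℝ) ≤ 2 := by exact_mod_cast K.card_frac_le_two hv
    nlinarith
  have h6 : 0 ≤ ∑ c ∈ K.frac v, K.costTerm v c :=
    Finset.sum_nonneg fun c hc => K.costTerm_nonneg (fun p hp => (h₁ p hp).1)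
      (fun p hp => (h₂ p hp).1) hreg (K.mem_frac.1 hc).1
  linarith

/-- The fractional solution that mixes the two given ones. -/
def mix (a b : ℝ) (c : Pair X ⊕ Pair X) : ℝ :=
  if c ∈ K.vars then Sum.elim (fun _ => b) (fun _ => a) c else 0

theorem sum_uc₁ : ∑ q ∈ F₂, ((K.uc₁ q).card : ℝ) = (G.uncov F₁ \ G.uncov F₂).card := by
  rw [← K.uc₁_union, Finset.card_biUnion K.uc₁_disj]; push_cast; rfl

theorem sum_uc₂_le :
    ∑ p ∈ K.unclustered, ((K.uc₂ p).card : ℝ) ≤ (G.uncov F₂ \ G.uncov F₁).card := by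
  rw [← K.uc₂_union, Finset.card_biUnion K.uc₂_disj]; push_cast
  exact Finset.sum_le_sum_of_subset_of_nonneg (Finset.filter_subset _ _) fun _ _ _ => by positivity

/-- Stars and unclustered pairs partition `F₁`, so the size row is the average number of pairs. The
outlier row is at most the average number of uncovered clients. -/
theorem mix_mem_region {a b : ℝ} (ha : 0 ≤ a) (hb : 0 ≤ b) (hab : a + b = 1)
    (hk : a * F₁.card + b * F₂.card ≤ G.k') (hm₁ : (G.uncov F₁).card ≤ I.m)
    (hm₂ : (G.uncov F₂).card ≤ I.m) : K.mix a b ∈ K.region := by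
  have hl : ∀ q ∈ F₂, K.mix a b (.inl q) = b := fun q hq => by simp [mix, K.vars_inl hq]
  have hr : ∀ p ∈ K.unclustered, K.mix a b (.inr p) = a := fun p hp => by
    simp [mix, K.vars_inr hp]
  refine ⟨fun c hc => ?_, fun c hc => by simp [mix, hc], ?_, ?_⟩
  · rcases c with q | p
    · rw [hl q (Finset.inl_mem_disjSum.1 hc)]; constructor <;> linarith
    · rw [hr p (Finset.inr_mem_disjSum.1 hc)]; constructor <;> linarith
  · rw [vars, Finset.sum_disjSum]
    have h1 := K.sum_star_add_sum_unclustered (fun _ => a)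
    have h2 : ∑ q ∈ F₂, K.sizeTerm (K.mix a b) (.inl q) =
        ∑ q ∈ F₂, (b + ∑ p ∈ K.star q, a) := by
      refine Finset.sum_congr rfl fun q hq => ?_
      simp only [sizeTerm, hl q hq, Finset.sum_const, nsmul_eq_mul]
      rw [← hab]; ring
    have h3 : ∑ p ∈ K.unclustered, K.sizeTerm (K.mix a b) (.inr p) =
        ∑ p ∈ K.unclustered, a := Finset.sum_congr rfl fun p hp => hr p hp
    rw [h2, h3, Finset.sum_add_distrib]
    simp only [Finset.sum_const, nsmul_eq_mul] at h1 ⊢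
    linarith
  · rw [vars, Finset.sum_disjSum]
    have h1 := K.sum_uc₁
    have h2 := K.sum_uc₂_le
    have h3 : ∑ q ∈ F₂, (1 - K.mix a b (.inl q)) * (K.outCoef (.inl q) : ℝ) =
        a * ∑ q ∈ F₂, ((K.uc₁ q).card : ℝ) := by
      rw [Finset.mul_sum]
      refine Finset.sum_congr rfl fun q hq => ?_
      rw [hl q hq]; simp only [outCoef]; rw [← hab]; ring
    have h4 : ∑ p ∈ K.unclustered, (1 - K.mix a b (.inr p)) * (K.outCoef (.inr p) : ℝ) =
        b * ∑ p ∈ K.unclustered, ((K.uc₂ p).card : ℝ) := by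
      rw [Finset.mul_sum]
      refine Finset.sum_congr rfl fun p hp => ?_
      rw [hr p hp]; simp only [outCoef]; rw [← hab]; ring
    rw [h3, h4, h1]
    have h5 := mul_le_mul_of_nonneg_left h2 hb
    have h6 := Finset.card_sdiff_add_card_inter (G.uncov F₁) (G.uncov F₂)
    have h7 := Finset.card_sdiff_add_card_inter (G.uncov F₂) (G.uncov F₁)
    rw [Finset.inter_comm] at h7
    have h8 : ((G.uncov F₁ \ G.uncov F₂).card : ℝ) + (G.uncov F₁ ∩ G.uncov F₂).card ≤ I.m := by
      exact_mod_cast h6.trans_le hm₁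
    have h9 : ((G.uncov F₂ \ G.uncov F₁).card : ℝ) + (G.uncov F₁ ∩ G.uncov F₂).card ≤ I.m := by
      exact_mod_cast h7.trans_le hm₂
    have h10 := mul_le_mul_of_nonneg_left h8 ha
    have h11 := mul_le_mul_of_nonneg_left h9 hb
    have h12 : a = 1 - b := by linarith
    rw [h12] at h10 ⊢
    linarith

/-- A clustered pair has coefficient `2b + (1 - b) = 1 + b`, an unclustered one only `a ≤ 1 + b`. -/
theorem obj_mix_le {a b : ℝ} (hb : 0 ≤ b) (hab : a + b = 1) (h₁ : ∀ p ∈ F₁, 0 ≤ p.2) :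
    K.obj (K.mix a b) ≤ 2 * b * cost F₂ + (1 + b) * cost F₁ := by
  have hl : ∀ q ∈ F₂, K.mix a b (.inl q) = b := fun q hq => by simp [mix, K.vars_inl hq]
  have hr : ∀ p ∈ K.unclustered, K.mix a b (.inr p) = a := fun p hp => by
    simp [mix, K.vars_inr hp]
  rw [obj, vars, Finset.sum_disjSum, cost, cost, ← K.sum_star_add_sum_unclustered Prod.snd]
  have h2 : ∑ q ∈ F₂, K.costTerm (K.mix a b) (.inl q) =
      2 * b * ∑ q ∈ F₂, q.2 + (1 + b) * ∑ q ∈ F₂, ∑ p ∈ K.star q, p.2 := by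
    rw [Finset.mul_sum, Finset.mul_sum, ← Finset.sum_add_distrib]
    refine Finset.sum_congr rfl fun q hq => ?_
    simp only [costTerm, hl q hq, ← Finset.mul_sum]
    ring
  have h3 : ∑ p ∈ K.unclustered, K.costTerm (K.mix a b) (.inr p) =
      a * ∑ p ∈ K.unclustered, p.2 := by
    rw [Finset.mul_sum]
    exact Finset.sum_congr rfl fun p hp => by simp only [costTerm, hr p hp]
  have h4 : 0 ≤ ∑ p ∈ K.unclustered, p.2 :=
    Finset.sum_nonneg fun p hp => h₁ p (Finset.mem_filter.1 hp).1
  rw [h2, h3]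
  nlinarith

/-! ### Existence of optimal vertices -/

theorem obj_affine {x y : Pair X ⊕ Pair X → ℝ} {a b : ℝ} (hab : a + b = 1) :
    K.obj (a • x + b • y) = a * K.obj x + b * K.obj y := by
  simp only [obj, Finset.mul_sum, ← Finset.sum_add_distrib]
  refine Finset.sum_congr rfl fun c _ => ?_
  obtain rfl : b = 1 - a := by linarith
  rcases c with q | p <;> simp [costTerm] <;> ring

theorem continuous_sizeTerm (c : Pair X ⊕ Pair X) : Continuous fun v => K.sizeTerm v c := by
  rcases c with q | p <;> simp only [sizeTerm] <;> fun_prop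

theorem continuous_obj : Continuous K.obj := by
  unfold obj
  refine continuous_finsetSum _ fun c _ => ?_
  rcases c with q | p <;> simp only [costTerm] <;> fun_prop

theorem isCompact_region : IsCompact K.region := by
  refine IsCompact.of_isClosed_subset
    (isCompact_univ_pi fun _ : Pair X ⊕ Pair X => isCompact_Icc (a := (0 : ℝ)) (b := 1)) ?_ ?_
  · have h1 : IsClosed {v : Pair X ⊕ Pair X → ℝ | ∀ c ∈ K.vars, 0 ≤ v c ∧ v c ≤ 1} := by
      simp only [Set.ofPred_forall]
      refine isClosed_iInter fun c => isClosed_iInter fun _ => ?_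
      exact (isClosed_le continuous_const (continuous_apply c)).inter
        (isClosed_le (continuous_apply c) continuous_const)
    have h2 : IsClosed {v : Pair X ⊕ Pair X → ℝ | ∀ c, c ∉ K.vars → v c = 0} := by
      simp only [Set.ofPred_forall]
      refine isClosed_iInter fun c => isClosed_iInter fun _ => ?_
      exact isClosed_eq (continuous_apply c) continuous_const
    have h3 : IsClosed {v : Pair X ⊕ Pair X → ℝ | ∑ c ∈ K.vars, K.sizeTerm v c ≤ (G.k' : ℝ)} :=
      isClosed_le (continuous_finsetSum _ fun c _ => K.continuous_sizeTerm c) continuous_const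
    have h4 : IsClosed {v : Pair X ⊕ Pair X → ℝ | ∑ c ∈ K.vars, (1 - v c) * K.outCoef c ≤
        (I.m : ℝ) - (G.uncov F₁ ∩ G.uncov F₂).card} :=
      isClosed_le (by fun_prop) continuous_const
    exact h1.inter (h2.inter (h3.inter h4))
  · intro v hv c _
    by_cases hc : c ∈ K.vars
    · exact hv.1 c hc
    · rw [hv.2.1 c hc]; exact ⟨le_rfl, zero_le_one⟩

/-- The minimisers form a non-empty compact extreme subset of the region, and an extreme point of it
is one of the region. Compactness holds in the product topology because coordinates lie in `[0, 1]`.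
-/
theorem exists_isOptVertex (hne : K.region.Nonempty) : ∃ v, K.IsOptVertex v := by
  set B := {v ∈ K.region | ∀ u ∈ K.region, K.obj v ≤ K.obj u} with hB
  have hBne : B.Nonempty := by
    obtain ⟨v, hv, hmin⟩ := K.isCompact_region.exists_isMinOn hne K.continuous_obj.continuousOn
    exact ⟨v, hv, fun u hu => hmin hu⟩
  have hBc : IsCompact B := by
    refine K.isCompact_region.of_isClosed_subset ?_ fun v hv => hv.1
    refine K.isCompact_region.isClosed.inter ?_
    change IsClosed {v | ∀ u ∈ K.region, K.obj v ≤ K.obj u}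
    simp only [Set.ofPred_forall]
    exact isClosed_iInter fun u => isClosed_iInter fun _ =>
      isClosed_le K.continuous_obj continuous_const
  have hext : IsExtreme ℝ K.region B := by
    refine ⟨fun v hv => hv.1, fun x hx y hy z hz hzs => ⟨hx, fun u hu => ?_⟩⟩
    obtain ⟨a, b, ha, hb, hab, rfl⟩ := hzs
    have h1 := hz.2 y hy
    have h2 := hz.2 u hu
    rw [K.obj_affine hab] at h1 h2
    obtain rfl : b = 1 - a := by linarith
    have h3 : a * K.obj x ≤ a * K.obj y := by linarith
    have h4 : K.obj x ≤ K.obj y := le_of_mul_le_mul_left h3 ha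
    have h5 := mul_le_mul_of_nonneg_left h4 hb.le
    linarith
  obtain ⟨v, hv⟩ := hBc.extremePoints_nonempty hBne
  exact ⟨v, hext.extremePoints_subset_extremePoints hv, (extremePoints_subset hv).2⟩

theorem exists_isExtracted (rad₁ rad₂ : X → ℝ) (u : Pair X ⊕ Pair X → ℝ)
    (h₁ : ∀ p ∈ F₁, 0 ≤ p.2) (h₂ : ∀ q ∈ F₂, 0 ≤ q.2) : ∃ A, K.IsExtracted rad₁ rad₂ u A := by
  have hrep : ∀ q : Pair X, ∃ p, (K.star q).Nonempty → p ∈ K.star q := by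
    intro q
    by_cases h : (K.star q).Nonempty
    · exact ⟨h.choose, fun _ => h.choose_spec⟩
    · exact ⟨q, fun h' => absurd h' h⟩
  choose rep hrep using hrep
  set S := K.selected u rep with hS
  have hhit : ∀ q : Pair X, ∃ p, q ∈ K.extra u \ K.isolated u S → p ∈ S ∧ Intersects q p := by
    intro q
    by_cases h : q ∈ K.extra u \ K.isolated u S
    · obtain ⟨h1, h2⟩ := Finset.mem_sdiff.1 h
      have h3 : ¬ ∀ p ∈ S, ¬ Intersects q p := fun h3 => h2 (Finset.mem_filter.2 ⟨h1, h3⟩)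
      push Not at h3
      obtain ⟨p, hp⟩ := h3
      exact ⟨p, fun _ => hp⟩
    · exact ⟨q, fun h' => absurd h' h⟩
  choose hit hhit using hhit
  -- An isolated pair intersects no selected one, so it cannot share a centre with it, and the two
  -- prescriptions for the radii are compatible.
  refine ⟨⟨_, fun i => if ∃ p ∈ S, p.1 = i then rad₁ i else rad₂ i⟩, rep, hit, S,
    fun q _ => hrep q, rfl, hhit, rfl, fun p hp => if_pos ⟨p, hp, rfl⟩, fun q hq => if_neg ?_⟩
  rintro ⟨p, hp, hpq⟩
  obtain ⟨hqE, hno⟩ := Finset.mem_filter.1 hq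
  obtain ⟨p', hp', -, hle⟩ := K.origin_of_mem_selected h₂ (fun q _ => hrep q) hp
  exact hno p hp (intersects_of_fst_eq hpq.symm (h₂ q (Finset.mem_filter.1 hqE).1)
    ((h₁ p' hp').trans hle))

end Clustering

/-- A partition of clients covered by `F` but not by `F'`. -/
theorem exists_uncov_partition {G : Guess I} (F F' : Finset (Pair X)) :
    ∃ uc : Pair X → Finset X, (∀ q ∈ F, uc q ⊆ I.ball q) ∧
      (F : Set (Pair X)).PairwiseDisjoint uc ∧ F.biUnion uc = G.uncov F' \ G.uncov F := by
  have hpick : ∀ j, ∃ q, j ∈ G.uncov F' \ G.uncov F → q ∈ F ∧ j ∈ I.ball q := by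
    intro j
    by_cases h : ∃ q ∈ F, j ∈ I.ball q
    · obtain ⟨q, hq⟩ := h
      exact ⟨q, fun _ => hq⟩
    · refine ⟨(j, 0), fun hj => ?_⟩
      obtain ⟨h1, h2⟩ := Finset.mem_sdiff.1 hj
      push Not at h
      exact absurd (Guess.mem_uncov.2 ⟨(Guess.mem_uncov.1 h1).1, h⟩) h2
  choose pick hpick using hpick
  refine ⟨fun q => (G.uncov F' \ G.uncov F).filter (fun j => pick j = q), fun q _ j hj => ?_,
    fun q _ q' _ hne => Finset.disjoint_left.2 fun j hj hj' => ?_, ?_⟩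
  · obtain ⟨h1, rfl⟩ := Finset.mem_filter.1 hj
    exact (hpick j h1).2
  · exact hne ((Finset.mem_filter.1 hj).2.symm.trans (Finset.mem_filter.1 hj').2)
  · ext j
    simp only [Finset.mem_biUnion, Finset.mem_filter]
    exact ⟨fun ⟨q, _, h, _⟩ => h, fun h => ⟨pick j, (hpick j h).1, h, rfl⟩⟩

theorem exists_clustering (G : Guess I) (F₁ F₂ : Finset (Pair X)) :
    Nonempty (Clustering G F₁ F₂) := by
  obtain ⟨uc₁, a1, a2, a3⟩ := exists_uncov_partition (G := G) F₂ F₁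
  obtain ⟨uc₂, b1, b2, b3⟩ := exists_uncov_partition (G := G) F₁ F₂
  refine ⟨⟨fun p => if h : ∃ q ∈ F₂, Intersects p q then some h.choose else none,
    fun p _ h => ⟨h.choose, h.choose_spec.1, dif_pos h, h.choose_spec.2⟩, fun p _ h => dif_neg ?_,
    uc₁, a1, a2, a3, uc₂, b1, b2, b3⟩⟩
  push Not
  exact h

/-! ### The first combination subroutine -/

/-- The trade-off between the two given solutions; the worst case is `b = √2 - 1`. -/
theorem le_mul_of_le_of_le {a b x y M : ℝ} (ha : 0 ≤ a) (hb : 0 ≤ b) (hab : a + b = 1)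
    (hx : 0 ≤ x) (hy : 0 ≤ y) (h1 : M ≤ y) (h2 : M ≤ 2 * b * y + (1 + b) * x) :
    M ≤ 2.0608 * (a * x + b * y) := by
  obtain rfl : a = 1 - b := by linarith
  have hW : 0 ≤ (1 - b) * x + b * y := by positivity
  rcases le_or_gt (1 / 3) b with h | h
  · have hq : 0 < 3 * b ^ 2 - 2 * b + 1 := by nlinarith [sq_nonneg (3 * b - 1)]
    -- Weights `3b² - b` and `1 - b` make the combined bound proportional to `(1 - b) x + b y`. The
    -- first weight is non-negative exactly when `b ≥ 1/3`, given `b > 0`; for smaller `b` the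
    -- second bound alone gives the factor `2`.
    have h3 : (3 * b ^ 2 - 2 * b + 1) * M ≤ (1 + b) * ((1 - b) * x + b * y) := by
      have e1 := mul_le_mul_of_nonneg_left h1 (by nlinarith : 0 ≤ 3 * b ^ 2 - b)
      have e2 := mul_le_mul_of_nonneg_left h2 ha
      nlinarith
    have h4 : 1 + b ≤ 2.0608 * (3 * b ^ 2 - 2 * b + 1) := by
      nlinarith [sq_nonneg (b - 0.41421)]
    have h5 := mul_le_mul_of_nonneg_right h4 hW
    have h6 : (3 * b ^ 2 - 2 * b + 1) * M ≤
        (3 * b ^ 2 - 2 * b + 1) * (2.0608 * ((1 - b) * x + b * y)) := by linarith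
    exact le_of_mul_le_mul_left h6 hq
  · have e1 : (1 + b) * x ≤ 2 * ((1 - b) * x) := by nlinarith
    linarith

namespace Guess

variable {G : Guess I}

theorem exists_cert_of_card {z : ℝ} (hz : 0 ≤ z) {o : PDOut X} (h : G.IsPDOut z o)
    (hk : G.k' < o.F.card) : Nonempty (G.PDCert z o) := by
  rcases h.trivial_or_cert hz with ⟨h, -⟩ | h
  · rw [h] at hk; simp at hk
  · exact h

theorem exists_cert_of_cert {z z' : ℝ} (hz : 0 ≤ z) {o : PDOut X} (h : G.IsPDOut z o)
    (c : G.DualCert z') : Nonempty (G.PDCert z o) := by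
  rcases h.trivial_or_cert hz with ⟨-, h⟩ | h
  · have := c.act_card
    have := Finset.card_le_card c.act_sub
    omega
  · exact h

theorem exists_weights {k k₁ k₂ : ℕ} (h₂ : k₂ ≤ k) (h₁ : k < k₁) :
    ∃ a b : ℝ, 0 ≤ a ∧ 0 ≤ b ∧ a + b = 1 ∧ a * k₁ + b * k₂ = k := by
  have e1 : (k₂ : ℝ) ≤ k := by exact_mod_cast h₂
  have e2 : (k : ℝ) < k₁ := by exact_mod_cast h₁
  have e3 : (0 : ℝ) < k₁ - k₂ := by linarith
  refine ⟨(k - k₂) / (k₁ - k₂), (k₁ - k) / (k₁ - k₂), div_nonneg (by linarith) e3.le,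
    div_nonneg (by linarith) e3.le, ?_, ?_⟩
  · field_simp; ring
  · field_simp; ring

/-- The convex combination of the costs of the two solutions that uses `k'` pairs on average. -/
theorem weighted_cost_le (hG : G.LPFeasible) {ε z₁ z₂ : ℝ} (hε : 0 < ε) (hz₁ : 0 ≤ z₁)
    (hz : z₁ ≤ z₂) (hδ : z₂ - z₁ ≤ G.δ ε) {o₁ o₂ : PDOut X} (h₁ : G.IsPDOut z₁ o₁)
    (h₂ : G.IsPDOut z₂ o₂) (hk₁ : G.k' < o₁.F.card) {a b : ℝ}
    (ha : 0 ≤ a) (hb : 0 ≤ b) (hab : a + b = 1) (hk : a * o₁.F.card + b * o₂.F.card = G.k') :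
    a * cost o₁.F + b * cost o₂.F ≤ 3 * G.OPT + 3 * z₁ + ε * G.OPT + 3 * G.R := by
  obtain ⟨c₁⟩ := exists_cert_of_card hz₁ h₁ hk₁
  obtain ⟨c₂⟩ := exists_cert_of_cert (hz₁.trans hz) h₂ c₁.toDualCert
  have e1 := c₁.cost_F
  have e2 := c₂.cost_F
  have f1 := c₁.sum_TI_le_OPT hz₁ hG
  have f2 := c₂.sum_TI_le_OPT (hz₁.trans hz) hG
  -- The lost unit is the pair `f`, for which the dual bound pays no penalty.
  have g1 : (o₁.F.card : ℝ) - 1 ≤ c₁.TI.card := by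
    have := c₁.card_F_le
    have : (o₁.F.card : ℝ) ≤ c₁.TI.card + 1 := by exact_mod_cast this
    linarith
  have g2 : (o₂.F.card : ℝ) - 1 ≤ c₂.TI.card := by
    have := c₂.card_F_le
    have : (o₂.F.card : ℝ) ≤ c₂.TI.card + 1 := by exact_mod_cast this
    linarith
  have g1' := mul_le_mul_of_nonneg_right g1 hz₁
  have g2' := mul_le_mul_of_nonneg_right g2 (hz₁.trans hz)
  have s1 : cost o₁.F ≤ 3 * (G.OPT + (G.k' + 1 - o₁.F.card) * z₁) + 3 * G.R := by linarith
  have s2 : cost o₂.F ≤ 3 * (G.OPT + (G.k' + 1 - o₂.F.card) * z₂) + 3 * G.R := by linarith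
  have t1 := mul_le_mul_of_nonneg_left s1 ha
  have t2 := mul_le_mul_of_nonneg_left s2 hb
  have hn : (o₁.F.card : ℝ) ≤ I.size := by
    have := c₁.card_F_le_facilities
    exact_mod_cast this.trans (Nat.le_add_right _ _)
  have hkk : (G.k' : ℝ) + 1 ≤ o₁.F.card := by exact_mod_cast hk₁
  have hd := size_mul_δ_le (G := G) hε
  have hd0 : 0 ≤ z₂ - z₁ := by linarith
  -- This is the coefficient with which `z₂` is replaced by `z₁`; being at most `n`, it costs at
  -- most `n * δ ≤ ε / 3 * OPT`.
  have hcoef : b * (G.k' + 1 - o₂.F.card) ≤ I.size := by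
    have : b * (G.k' + 1 - o₂.F.card) = a * (o₁.F.card - (G.k' + 1)) + 1 := by
      have hb' : b = 1 - a := by linarith
      have : (G.k' : ℝ) = a * o₁.F.card + (1 - a) * o₂.F.card := by rw [← hk, hb']
      rw [hb']
      linear_combination this
    rw [this]
    have ha1 : a ≤ 1 := by linarith
    have hk0 : (0 : ℝ) ≤ G.k' := by positivity
    nlinarith
  have hcoef2 : b * (G.k' + 1 - o₂.F.card) * (z₂ - z₁) ≤ ε / 3 * G.OPT := by
    refine le_trans (mul_le_mul_of_nonneg_right hcoef hd0) ?_
    refine le_trans (mul_le_mul_of_nonneg_left hδ (by positivity)) hd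
  -- The terms `k' + 1 - |F_p|` average to exactly `1`, which leaves the single summand `3 * z₁`.
  have hfin : a * (3 * (G.OPT + (G.k' + 1 - o₁.F.card) * z₁) + 3 * G.R) +
      b * (3 * (G.OPT + (G.k' + 1 - o₂.F.card) * z₂) + 3 * G.R) =
      3 * G.OPT + 3 * z₁ + 3 * (b * (G.k' + 1 - o₂.F.card) * (z₂ - z₁)) + 3 * G.R := by
    have hb' : b = 1 - a := by linarith
    have : (G.k' : ℝ) = a * o₁.F.card + (1 - a) * o₂.F.card := by rw [← hk, hb']
    rw [hb']
    linear_combination 3 * z₁ * this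
  linarith

section CombineA

variable {z₁ z₂ : ℝ} {o₁ o₂ : PDOut X} {A : Sol X}

theorem exists_isCombineA (hz₁ : 0 ≤ z₁) (hz₂ : 0 ≤ z₂) (h₁ : G.IsPDOut z₁ o₁)
    (h₂ : G.IsPDOut z₂ o₂) (hk₁ : G.k' < o₁.F.card) (hk₂ : o₂.F.card ≤ G.k') :
    ∃ A, G.IsCombineA o₁ o₂ A := by
  obtain ⟨K⟩ := exists_clustering G o₁.F o₂.F
  obtain ⟨a, b, ha, hb, hab, hk⟩ := exists_weights hk₂ hk₁
  obtain ⟨v, hv⟩ := K.exists_isOptVertex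
    ⟨_, K.mix_mem_region ha hb hab hk.le (h₁.card_uncov hz₁) (h₂.card_uncov hz₂)⟩
  obtain ⟨u, hu⟩ := K.exists_isRounding v
  obtain ⟨E, hE⟩ := K.exists_isExtracted o₁.rad o₂.rad u
    (fun p hp => (h₁.isValid hz₁).nonneg hp) fun p hp => (h₂.isValid hz₂).nonneg hp
  exact ⟨_, K, v, u, E, hv, hu, hE, rfl⟩

theorem IsCombineA.spec (hz₁ : 0 ≤ z₁) (hz₂ : 0 ≤ z₂) (h₁ : G.IsPDOut z₁ o₁)
    (h₂ : G.IsPDOut z₂ o₂) (hk₂ : o₂.F.card ≤ G.k') (hA : G.IsCombineA o₁ o₂ A) :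
    G.IsValid A ∧ A.F.card ≤ G.k' ∧ (G.uncov A.F).card ≤ I.m := by
  obtain ⟨K, v, u, E, hv, hu, hE, rfl⟩ := hA
  have hspec := hu.spec K hv.1
  have v₁ := h₁.isValid hz₁
  have v₂ := h₂.isValid hz₂
  split_ifs
  · exact ⟨v₂, hk₂, h₂.card_uncov hz₂⟩
  · refine ⟨Clustering.IsExtracted.isValid K v₁ v₂ hE, ?_, ?_⟩
    · exact_mod_cast (Clustering.IsExtracted.card_le K hspec.zero_or_one hE).trans hspec.size_le
    · exact_mod_cast (Clustering.IsExtracted.card_uncov_le K (fun p hp => v₂.nonneg hp)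
        hspec.zero_or_one hE).trans hspec.out_le

theorem IsCombineA.cost_le (hG : G.LPFeasible) {ε : ℝ} (hε : 0 < ε) (hz₁ : 0 ≤ z₁)
    (hz : z₁ ≤ z₂) (hδ : z₂ - z₁ ≤ G.δ ε) (h₁ : G.IsPDOut z₁ o₁)
    (h₂ : G.IsPDOut z₂ o₂) (hk₁ : G.k' < o₁.F.card) (hk₂ : o₂.F.card ≤ G.k')
    (hA : G.IsCombineA o₁ o₂ A) (hzO : z₁ ≤ (1 + ε) * G.OPT) :
    cost A.F ≤ (12.365 + 9 * ε) * G.OPT + 40 * G.R := by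
  have hz₂ := hz₁.trans hz
  have hR := R_nonneg (G := G)
  have hO := OPT_nonneg (G := G)
  have v₁ := h₁.isValid hz₁
  have v₂ := h₂.isValid hz₂
  obtain ⟨K, v, u, E, hv, hu, hE, rfl⟩ := hA
  have hspec := hu.spec K hv.1
  obtain ⟨a, b, ha, hb, hab, hk⟩ := exists_weights hk₂ hk₁
  obtain ⟨rep, hrep, hcost⟩ := Clustering.IsExtracted.cost_le K (fun p hp => v₁.nonneg hp)
    (fun p hp => v₂.nonneg hp) hspec.zero_or_one hE
  have e1 := K.sum_extractCost_le (r := 3 * G.R) (by positivity)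
    (fun p hp => ⟨v₁.nonneg hp, h₁.le_R hz₁ p hp⟩)
    (fun p hp => ⟨v₂.nonneg hp, h₂.le_R hz₂ p hp⟩) hrep hv.1 hspec
  have e2 := hv.2 _ (K.mix_mem_region ha hb hab hk.le (h₁.card_uncov hz₁) (h₂.card_uncov hz₂))
  have e3 := K.obj_mix_le hb hab fun p hp => v₁.nonneg hp
  have e4 := weighted_cost_le hG hε hz₁ hz hδ h₁ h₂ hk₁ ha hb hab hk
  set M := cost (if cost o₂.F ≤ cost E.F then o₂.toSol else E).F with hM
  have m1 : M ≤ cost o₂.F := by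
    rw [hM]; split_ifs with h
    · exact le_rfl
    · exact (not_le.1 h).le
  have m2 : M ≤ cost E.F := by
    rw [hM]; split_ifs with h
    · exact h
    · exact le_rfl
  have c1 : 0 ≤ cost o₁.F := Finset.sum_nonneg fun p hp => v₁.nonneg hp
  have c2 : 0 ≤ cost o₂.F := Finset.sum_nonneg fun p hp => v₂.nonneg hp
  -- Rounding cost `10 * (3 * G.R)`. The average is at most `(6 + 4 * ε) * OPT + 3 * G.R`, and
  -- `2.0608 * 6 = 12.3648`, `2.0608 * 4 < 9`, `30 + 2.0608 * 3 < 40`.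
  have e5 := le_mul_of_le_of_le (M := M - 30 * G.R) ha hb hab c1 c2 (by linarith) (by linarith)
  have e6 : 0 ≤ ε * G.OPT := by positivity
  nlinarith

end CombineA

end Guess

/-! ### The second combination subroutine -/

namespace Guess

variable {G : Guess I}

theorem core_subset {Y : Type*} (o : PDOut Y) : o.core ⊆ o.F := Finset.sdiff_subset

/-- The case of `packing_two` in which the balls are given by the recorded radii of some output
pairs of two runs. -/
theorem PDCert.packing_mixed (hG : G.LPFeasible) {ε z₁ z₂ : ℝ} (hε : 0 < ε) (hz₁ : 0 ≤ z₁)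
    (hz : z₁ ≤ z₂) (hδ : z₂ - z₁ ≤ G.δ ε) {o₁ o₂ : PDOut X} (c₁ : G.PDCert z₁ o₁)
    (c₂ : G.PDCert z₂ o₂) {P Q : Finset (Pair X)} (hP : P ⊆ o₁.F) (hQ : Q ⊆ o₂.F)
    (hPQ : ∀ q ∈ Q, ∀ p ∈ P, ¬ Intersects q p) {U : Finset X}
    (hU : ∀ j ∈ U, j ∈ c₁.act ∨ j ∈ c₂.act) (hUm : I.m < U.card)
    (hUP : ∀ p ∈ P, ∀ j ∈ U, j ∉ I.ball p) (hUQ : ∀ q ∈ Q, ∀ j ∈ U, j ∉ I.ball q) :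
    ∑ p ∈ P, o₁.rad p.1 + ∑ q ∈ Q, o₂.rad q.1 + (P.card + Q.card) * z₁ ≤
      (1 + ε / 3) * G.OPT + G.k' * z₁ := by
  have hPr : ∀ p ∈ P, o₁.rad p.1 ≤ p.2 := fun p hp => (c₁.mem_F (hP hp)).2.1
  have hQr : ∀ q ∈ Q, o₂.rad q.1 ≤ q.2 := fun q hq => (c₂.mem_F (hQ hq)).2.1
  have hmix : ∀ q ∈ Q, ∀ p ∈ P, ¬ Intersects (q.1, o₂.rad q.1) (p.1, o₁.rad p.1) :=
    fun q hq p hp h => hPQ q hq p hp (h.mono rfl rfl (hQr q hq) (hPr p hp))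
  have h := DualCert.packing_two hG hz₁ hz hδ c₁.toDualCert c₂.toDualCert (P.disjSum Q)
    (Sum.elim (fun p => (p.1, o₁.rad p.1)) (fun q => (q.1, o₂.rad q.1))) ?_ ?_ U hU hUm ?_
  · rw [Finset.sum_disjSum, Finset.card_disjSum] at h
    simp only [Sum.elim_inl, Sum.elim_inr] at h
    push_cast at h
    linarith [card_mul_pow_mul_δ_le (G := G) hε]
  · intro i hi
    rcases i with p | q
    · exact Or.inl (c₁.rad_tight (hP (Finset.inl_mem_disjSum.1 hi)))
    · exact Or.inr (c₂.rad_tight (hQ (Finset.inr_mem_disjSum.1 hi)))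
  · intro i hi i' hi' hne
    rcases i with p | q <;> rcases i' with p' | q'
    · exact c₁.rad_disj (hP (Finset.inl_mem_disjSum.1 hi)) (hP (Finset.inl_mem_disjSum.1 hi'))
        fun h => hne (h ▸ rfl)
    · exact fun h => hmix q' (Finset.inr_mem_disjSum.1 hi') p (Finset.inl_mem_disjSum.1 hi) h.symm
    · exact hmix q (Finset.inr_mem_disjSum.1 hi) p' (Finset.inl_mem_disjSum.1 hi')
    · exact c₂.rad_disj (hQ (Finset.inr_mem_disjSum.1 hi)) (hQ (Finset.inr_mem_disjSum.1 hi'))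
        fun h => hne (h ▸ rfl)
  · intro i hi j hj hji
    rcases i with p | q
    · have hp := Finset.inl_mem_disjSum.1 hi
      exact hUP p hp j hj (ball_subset_of_fst_eq (p := (p.1, o₁.rad p.1)) (q := p) rfl (hPr p hp) hji)
    · have hq := Finset.inr_mem_disjSum.1 hi
      exact hUQ q hq j hj (ball_subset_of_fst_eq (p := (q.1, o₂.rad q.1)) (q := q) rfl (hQr q hq) hji)

/-- `ψ` matches every pair of the second solution injectively, and those that intersect a core pair
of the first solution to the only such pair. -/
structure SwapHyp (G : Guess I) (o₁ o₂ : PDOut X) (ψ : Pair X → Pair X) : Prop where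
  valid₁ : G.IsValid o₁.toSol
  valid₂ : G.IsValid o₂.toSol
  maps : ∀ q ∈ o₂.F, ψ q ∈ o₁.core
  inj : Set.InjOn ψ (o₂.F : Set (Pair X))
  eq_of_intersects : ∀ q ∈ o₂.F, ∀ p ∈ o₁.core, Intersects q p → ψ q = p

/-- The pair that is swapped in for `ψ q`. -/
def newPair (o₁ o₂ : PDOut X) (ψ : Pair X → Pair X) (q : Pair X) : Pair X :=
  (q.1, if q ∈ matched o₁ o₂ then q.2 + 2 * (ψ q).2 else q.2)

/-- The solution after the pairs of `Q` have been swapped in. -/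
def swapState (o₁ o₂ : PDOut X) (ψ : Pair X → Pair X) (Q : Finset (Pair X)) : Sol X where
  F := (o₁.core \ Q.image ψ) ∪ Q.image (newPair o₁ o₂ ψ)
  rad := fun i => if i ∈ centers Q then o₂.rad i else o₁.rad i

namespace SwapHyp

variable {o₁ o₂ : PDOut X} {ψ : Pair X → Pair X} {Q : Finset (Pair X)}

theorem nonneg₁ (h : G.SwapHyp o₁ o₂ ψ) {p : Pair X} (hp : p ∈ o₁.core) : 0 ≤ p.2 :=
  h.valid₁.nonneg (core_subset o₁ hp)

theorem nonneg₂ (h : G.SwapHyp o₁ o₂ ψ) {q : Pair X} (hq : q ∈ o₂.F) : 0 ≤ q.2 :=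
  h.valid₂.nonneg hq

theorem newPair_bounds (h : G.SwapHyp o₁ o₂ ψ) {q : Pair X} (hq : q ∈ o₂.F) :
    q.2 ≤ (newPair o₁ o₂ ψ q).2 ∧ (newPair o₁ o₂ ψ q).2 ≤ q.2 + 2 * (ψ q).2 := by
  have := h.nonneg₁ (h.maps q hq)
  simp only [newPair]
  split_ifs <;> constructor <;> linarith

theorem eq_of_fst_eq (h : G.SwapHyp o₁ o₂ ψ) {p q : Pair X} (hq : q ∈ o₂.F) (hp : p ∈ o₁.core)
    (hpq : q.1 = p.1) : ψ q = p :=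
  h.eq_of_intersects q hq p hp (intersects_of_fst_eq hpq (h.nonneg₂ hq) (h.nonneg₁ hp))

/-- The state depends only on the set of pairs swapped in, not on their order. The pair `ψ p` to be
removed is never one that was swapped in: a common centre would give `ψ q = ψ p`, against
injectivity. -/
theorem swap_swapState (h : G.SwapHyp o₁ o₂ ψ) (hQ : Q ⊆ o₂.F) {p : Pair X} (hp : p ∈ o₂.F)
    (hpQ : p ∉ Q) : swap o₁ o₂ ψ (swapState o₁ o₂ ψ Q) p = swapState o₁ o₂ ψ (insert p Q) := by
  have hF : (swap o₁ o₂ ψ (swapState o₁ o₂ ψ Q) p).F = (swapState o₁ o₂ ψ (insert p Q)).F := by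
    change insert (newPair o₁ o₂ ψ p)
      (((o₁.core \ Q.image ψ) ∪ Q.image (newPair o₁ o₂ ψ)).erase (ψ p)) =
      (o₁.core \ (insert p Q).image ψ) ∪ (insert p Q).image (newPair o₁ o₂ ψ)
    have hψ : ψ p ∉ Q.image (newPair o₁ o₂ ψ) := by
      intro hc
      obtain ⟨q, hq, hqp⟩ := Finset.mem_image.1 hc
      have h1 := h.eq_of_fst_eq (hQ hq) (h.maps p hp) (by rw [← hqp]; rfl)
      exact hpQ (h.inj (hQ hq) hp h1 ▸ hq)
    ext x
    simp only [Finset.mem_insert, Finset.mem_erase, Finset.mem_union, Finset.mem_sdiff,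
      Finset.image_insert]
    have hx : x ∈ Q.image (newPair o₁ o₂ ψ) → x ≠ ψ p := fun hx h => hψ (h ▸ hx)
    tauto
  have hr : (swap o₁ o₂ ψ (swapState o₁ o₂ ψ Q) p).rad =
      (swapState o₁ o₂ ψ (insert p Q)).rad := by
    funext i
    simp only [swap, swapState, centers, Finset.image_insert, Finset.mem_insert]
    by_cases hi : i = p.1
    · subst hi; simp
    · simp [hi]
  revert hF hr
  generalize swap o₁ o₂ ψ (swapState o₁ o₂ ψ Q) p = A
  generalize swapState o₁ o₂ ψ (insert p Q) = B
  cases A; cases B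
  rintro rfl rfl
  rfl

/-- The only core pair that a swapped-in pair can intersect is its partner, which has been removed.
-/
theorem isValid_swapState (h : G.SwapHyp o₁ o₂ ψ) (hQ : Q ⊆ o₂.F) :
    G.IsValid (swapState o₁ o₂ ψ Q) := by
  have hmix : ∀ q ∈ Q, ∀ p ∈ o₁.core \ Q.image ψ, ¬ Intersects q p := by
    intro q hq p hp hint
    obtain ⟨hp1, hp2⟩ := Finset.mem_sdiff.1 hp
    exact hp2 (Finset.mem_image.2 ⟨q, hq, h.eq_of_intersects q (hQ hq) p hp1 hint⟩)
  have hcase : ∀ x ∈ (swapState o₁ o₂ ψ Q).F,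
      (x ∈ o₁.core \ Q.image ψ ∧ (swapState o₁ o₂ ψ Q).rad x.1 = o₁.rad x.1) ∨
      ∃ q ∈ Q, q.1 = x.1 ∧ q.2 ≤ x.2 ∧ (swapState o₁ o₂ ψ Q).rad x.1 = o₂.rad q.1 := by
    intro x hx
    rcases Finset.mem_union.1 hx with hx | hx
    · refine Or.inl ⟨hx, if_neg fun hc => ?_⟩
      obtain ⟨q, hq, hqx⟩ := Finset.mem_image.1 hc
      exact hmix q hq x hx (intersects_of_fst_eq hqx (h.nonneg₂ (hQ hq))
        (h.nonneg₁ (Finset.mem_sdiff.1 hx).1))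
    · obtain ⟨q, hq, rfl⟩ := Finset.mem_image.1 hx
      exact Or.inr ⟨q, hq, rfl, (h.newPair_bounds (hQ hq)).1,
        if_pos (Finset.mem_image.2 ⟨q, hq, rfl⟩)⟩
  have hcore : ∀ x ∈ o₁.core \ Q.image ψ, x ∈ o₁.F := fun x hx =>
    core_subset o₁ (Finset.mem_sdiff.1 hx).1
  have hmix' : ∀ q ∈ Q, ∀ p ∈ o₁.core \ Q.image ψ,
      ¬ Intersects (q.1, o₂.rad q.1) (p.1, o₁.rad p.1) := fun q hq p hp hint =>
    hmix q hq p hp (hint.mono rfl rfl (h.valid₂.1 q (hQ hq)).2 (h.valid₁.1 p (hcore p hp)).2)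
  refine ⟨fun x hx => ?_, fun x hx y hy hne => ?_⟩
  · rcases hcase x hx with ⟨hx', hr⟩ | ⟨q, hq, hqx, hle, hr⟩
    · rw [hr]; exact h.valid₁.1 x (hcore x hx')
    · rw [hr, ← hqx]
      exact ⟨(h.valid₂.1 q (hQ hq)).1, (h.valid₂.1 q (hQ hq)).2.trans hle⟩
  · rcases hcase x hx with ⟨hx', hr⟩ | ⟨q, hq, hqx, -, hr⟩ <;>
      rcases hcase y hy with ⟨hy', hr'⟩ | ⟨q', hq', hqy, -, hr'⟩ <;> rw [hr, hr']
    · exact h.valid₁.2 x (hcore x hx') y (hcore y hy') hne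
    · rw [← hqy]; exact fun hint => hmix' q' hq' x hx' hint.symm
    · rw [← hqx]; exact hmix' q hq y hy'
    · rw [← hqx, ← hqy]
      exact h.valid₂.2 q (hQ hq) q' (hQ hq') (by rw [hqx, hqy]; exact hne)

theorem card_add_card (h : G.SwapHyp o₁ o₂ ψ) (hQ : Q ⊆ o₂.F) :
    (o₁.core \ Q.image ψ).card + Q.card = o₁.core.card := by
  have h1 : Q.image ψ ⊆ o₁.core := fun p hp => by
    obtain ⟨q, hq, rfl⟩ := Finset.mem_image.1 hp
    exact h.maps q (hQ hq)
  rw [Finset.card_sdiff_of_subset h1, Finset.card_image_of_injOn (h.inj.mono (by exact_mod_cast hQ))]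
  have := Finset.card_le_card h1
  rw [Finset.card_image_of_injOn (h.inj.mono (by exact_mod_cast hQ))] at this
  omega

theorem card_swapState_le (h : G.SwapHyp o₁ o₂ ψ) (hQ : Q ⊆ o₂.F) :
    (swapState o₁ o₂ ψ Q).F.card ≤ o₁.core.card := by
  rw [← h.card_add_card hQ]
  exact (Finset.card_union_le _ _).trans (add_le_add le_rfl Finset.card_image_le)

theorem cost_swapState_le (h : G.SwapHyp o₁ o₂ ψ) (hQ : Q ⊆ o₂.F) :
    cost (swapState o₁ o₂ ψ Q).F ≤
      ∑ p ∈ o₁.core \ Q.image ψ, p.2 + ∑ q ∈ Q, (q.2 + 2 * (ψ q).2) := by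
  refine (cost_union_le fun p hp => h.nonneg₁ (Finset.mem_sdiff.1 hp).1).trans
    (add_le_add le_rfl ?_)
  refine (cost_image_le _ _ fun q hq => ?_).trans (Finset.sum_le_sum fun q hq => ?_)
  · exact (h.nonneg₂ (hQ hq)).trans (h.newPair_bounds (hQ hq)).1
  · exact (h.newPair_bounds (hQ hq)).2

theorem cost_swapState_insert_le (h : G.SwapHyp o₁ o₂ ψ) (hQ : Q ⊆ o₂.F) {p : Pair X}
    (hp : p ∈ o₂.F) (hpQ : p ∉ Q) : cost (swapState o₁ o₂ ψ (insert p Q)).F ≤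
      cost (swapState o₁ o₂ ψ Q).F + (p.2 + 2 * (ψ p).2) := by
  rw [← h.swap_swapState hQ hp hpQ]
  have h1 := h.newPair_bounds hp
  have h2 : cost ((swapState o₁ o₂ ψ Q).F.erase (ψ p)) ≤ cost (swapState o₁ o₂ ψ Q).F :=
    cost_mono (Finset.erase_subset _ _) fun x hx => (h.isValid_swapState hQ).nonneg hx
  have h3 : cost (swap o₁ o₂ ψ (swapState o₁ o₂ ψ Q) p).F ≤
      (newPair o₁ o₂ ψ p).2 + cost ((swapState o₁ o₂ ψ Q).F.erase (ψ p)) :=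
    cost_insert_le ((h.nonneg₂ hp).trans h1.1)
  linarith

/-- A feasible state other than the start is one swap away from an infeasible one; the cost bound is
available for the latter. -/
theorem swapLoop_spec (h : G.SwapHyp o₁ o₂ ψ) {E : Finset (Pair X)} (hE : E ⊆ o₂.F)
    (l : List (Pair X)) (Q : Finset (Pair X)) (hl : l.Nodup) (hlQ : ∀ x ∈ l, x ∉ Q)
    (hQE : Q ∪ l.toFinset = E) :
    (∃ Q' ⊆ E, G.swapLoop o₁ o₂ ψ l (swapState o₁ o₂ ψ Q) = some (swapState o₁ o₂ ψ Q') ∧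
      (G.uncov (swapState o₁ o₂ ψ Q').F).card ≤ I.m ∧
      (Q' = Q ∨ ∃ Q'' ⊆ E, ∃ p ∈ E, p ∉ Q'' ∧ Q' = insert p Q'' ∧
        I.m < (G.uncov (swapState o₁ o₂ ψ Q'').F).card)) ∨
    (G.swapLoop o₁ o₂ ψ l (swapState o₁ o₂ ψ Q) = none ∧
      I.m < (G.uncov (swapState o₁ o₂ ψ E).F).card) := by
  induction l generalizing Q with
  | nil =>
    have hQ : Q = E := by simpa using hQE
    subst hQ
    by_cases hm : (G.uncov (swapState o₁ o₂ ψ Q).F).card ≤ I.m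
    · exact Or.inl ⟨Q, subset_rfl, by simp [swapLoop, hm], hm, Or.inl rfl⟩
    · exact Or.inr ⟨by simp [swapLoop, hm], not_le.1 hm⟩
  | cons p l ih =>
    have hQ : Q ⊆ E := hQE ▸ Finset.subset_union_left
    have hpE : p ∈ E := by rw [← hQE]; simp
    have hpQ : p ∉ Q := hlQ p (List.mem_cons_self ..)
    rw [List.nodup_cons] at hl
    by_cases hm : (G.uncov (swapState o₁ o₂ ψ Q).F).card ≤ I.m
    · exact Or.inl ⟨Q, hQ, by simp [swapLoop, hm], hm, Or.inl rfl⟩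
    · have hstep : G.swapLoop o₁ o₂ ψ (p :: l) (swapState o₁ o₂ ψ Q) =
          G.swapLoop o₁ o₂ ψ l (swapState o₁ o₂ ψ (insert p Q)) := by
        rw [swapLoop, if_neg hm, h.swap_swapState (hQ.trans hE) (hE hpE) hpQ]
      rw [hstep]
      rcases ih (insert p Q) hl.2 (by
          intro x hx hxQ
          rcases Finset.mem_insert.1 hxQ with rfl | hxQ
          · exact hl.1 hx
          · exact hlQ x (List.mem_cons_of_mem _ hx) hxQ)
        (by rw [← hQE, List.toFinset_cons]; ext x; simp only [Finset.mem_union,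
              Finset.mem_insert]; tauto) with ⟨Q', hQ', h1, h2, h3⟩ | h1
      · refine Or.inl ⟨Q', hQ', h1, h2, Or.inr ?_⟩
        rcases h3 with rfl | h3
        · exact ⟨Q, hQ, p, hpE, hpQ, rfl, not_le.1 hm⟩
        · exact h3
      · exact Or.inr h1

end SwapHyp

/-! ### Consequences of a large penalty and of the absence of shortcuts. -/

section NoShortcut

variable {ε z₁ z₂ : ℝ} {o₁ o₂ : PDOut X}

/-- If `z₁ > OPT`, then the first solution consists of `k'` pruned pairs and `f₁`. -/
theorem PDCert.of_OPT_lt (hG : G.LPFeasible) (hz₁ : 0 ≤ z₁) (c₁ : G.PDCert z₁ o₁)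
    (hzO : G.OPT < z₁) (hk₁ : G.k' < o₁.F.card) :
    o₁.core = c₁.pruned ∧ o₁.core.card = G.k' ∧ I.m < (G.uncov o₁.core).card := by
  have hTI : c₁.TI.card ≤ G.k' := by
    by_contra hc
    exact absurd (c₁.le_OPT_of_card_TI hz₁ hG (not_le.1 hc)) (not_le.2 hzO)
  rcases c₁.card_F_le_or with h | ⟨h1, h2, -, h3⟩
  · omega
  · refine ⟨h2, ?_, h2 ▸ h3⟩
    rw [h2, c₁.card_pruned]; omega

theorem dist_gt_of_no_shortcut (hns : ¬ ∃ A, G.IsShortcut o₁ A) {p p' : Pair X}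
    (hp : p ∈ o₁.F) (hp' : p' ∈ o₁.F) (hne : p ≠ p') : 12 * G.R < dist p.1 p'.1 := by
  by_contra hc
  exact hns ⟨⟨insert (p.1, coverRadius p.1 p.2 (I.ball p')) ((o₁.F.erase p).erase p'), o₁.rad⟩, rfl, Or.inr ⟨p, hp, p', hp', hne, not_lt.1 hc, rfl⟩⟩

theorem card_uncov_of_no_shortcut (hns : ¬ ∃ A, G.IsShortcut o₁ A) {p : Pair X}
    (hp : p ∈ o₁.core) :
    I.m < (G.uncov (insert (p.1, p.2 + 12 * G.R) (o₁.core.erase p))).card := by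
  by_contra hc
  exact hns ⟨⟨insert (p.1, p.2 + 12 * G.R) (o₁.core.erase p), o₁.rad⟩, rfl, Or.inl ⟨p, hp, rfl, not_lt.1 hc⟩⟩

/-- All radii are at most `3 * G.R`, so two core pairs meeting the same pair would have centres
within `12 * G.R`; hence the threshold for merging. -/
theorem eq_of_intersects_of_no_shortcut (hns : ¬ ∃ A, G.IsShortcut o₁ A)
    (h₁ : ∀ p ∈ o₁.F, p.2 ≤ 3 * G.R) {q p p' : Pair X} (hq : q.2 ≤ 3 * G.R)
    (hp : p ∈ o₁.core) (hp' : p' ∈ o₁.core) (h : Intersects q p) (h' : Intersects q p') :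
    p = p' := by
  by_contra hne
  have h1 := dist_gt_of_no_shortcut hns (core_subset o₁ hp) (core_subset o₁ hp') hne
  have h2 := h₁ p (core_subset o₁ hp)
  have h3 := h₁ p' (core_subset o₁ hp')
  have h4 := dist_triangle_left p.1 p'.1 q.1
  unfold Intersects at h h'
  linarith

/-- Otherwise replacing `p` by `q` and `q'` gives `k' + 1` disjoint balls, each tight in one of the
runs. They avoid the clients missed when `p` is enlarged by `12 * G.R`, more than `m` in number as
the first shortcut fails. Packing then yields `z₁ ≤ (1 + ε / 3) * OPT`. -/
theorem PDCert.eq_of_intersects_core (hG : G.LPFeasible) (hε : 0 < ε) (hz₁ : 0 ≤ z₁)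
    (hz : z₁ ≤ z₂) (hδ : z₂ - z₁ ≤ G.δ ε) (c₁ : G.PDCert z₁ o₁) (c₂ : G.PDCert z₂ o₂)
    (hzO : (1 + ε) * G.OPT < z₁) (hk₁ : G.k' < o₁.F.card) (hns : ¬ ∃ A, G.IsShortcut o₁ A)
    {p q q' : Pair X} (hp : p ∈ o₁.core) (hq : q ∈ o₂.F) (hq' : q' ∈ o₂.F)
    (h : Intersects q p) (h' : Intersects q' p) : q = q' := by
  by_contra hne
  have hO := OPT_nonneg (G := G)
  have hεO : 0 ≤ ε * G.OPT := by positivity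
  obtain ⟨hcore, hcard, -⟩ := c₁.of_OPT_lt hG hz₁ (by linarith) hk₁
  have hsub : ∀ x ∈ o₂.F, Intersects x p → I.ball x ⊆ I.ball (p.1, p.2 + 12 * G.R) := by
    intro x hx hint
    refine ball_subset_ball ?_
    have h1 := (c₂.mem_F hx).2.2
    have hR := R_nonneg (G := G)
    unfold Intersects at hint
    simp only
    linarith
  have hQF : ({q, q'} : Finset (Pair X)) ⊆ o₂.F := by
    intro x hx
    rcases Finset.mem_insert.1 hx with rfl | hx
    · exact hq
    · rw [Finset.mem_singleton.1 hx]; exact hq'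
  have hQint : ∀ x ∈ ({q, q'} : Finset (Pair X)), Intersects x p := by
    intro x hx
    rcases Finset.mem_insert.1 hx with rfl | hx
    · exact h
    · rw [Finset.mem_singleton.1 hx]; exact h'
  set U := G.uncov (insert (p.1, p.2 + 12 * G.R) (o₁.core.erase p)) with hU
  have hpack := PDCert.packing_mixed hG hε hz₁ hz hδ c₁ c₂ (P := o₁.core.erase p) (Q := {q, q'})
    ((Finset.erase_subset _ _).trans (core_subset o₁)) hQF
    (fun x hx y hy hint => (Finset.mem_erase.1 hy).1 (eq_of_intersects_of_no_shortcut hns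
      (fun p hp => (c₁.mem_F hp).2.2) (c₂.mem_F (hQF hx)).2.2 (Finset.mem_erase.1 hy).2 hp hint
      (hQint x hx)))
    (U := U) ?_ (card_uncov_of_no_shortcut hns hp)
    (fun y hy j hj => (mem_uncov.1 hj).2 y (Finset.mem_insert_of_mem hy))
    (fun x hx j hj hjx => (mem_uncov.1 hj).2 _ (Finset.mem_insert_self _ _)
      (hsub x (hQF hx) (hQint x hx) hjx))
  · have e1 : 0 ≤ ∑ p ∈ o₁.core.erase p, o₁.rad p.1 := Finset.sum_nonneg fun y hy =>
      nonneg_of_mem_L' (c₁.rad_mem_L' (core_subset o₁ (Finset.mem_of_mem_erase hy)))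
    have e2 : 0 ≤ ∑ q ∈ ({q, q'} : Finset (Pair X)), o₂.rad q.1 := Finset.sum_nonneg fun x hx =>
      nonneg_of_mem_L' (c₂.rad_mem_L' (hQF hx))
    have e3 := Finset.card_erase_add_one hp
    rw [hcard] at e3
    have e4 : ((o₁.core.erase p).card : ℝ) + 1 = G.k' := by exact_mod_cast e3
    rw [Finset.card_pair hne] at hpack
    push_cast at hpack
    have e5 : ((o₁.core.erase p).card + 2 : ℝ) * z₁ = G.k' * z₁ + z₁ := by rw [← e4]; ring
    rw [e5] at hpack
    linarith
  · intro j hj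
    left
    refine c₁.uncov_pruned ?_
    rw [← hcore]
    refine uncov_subset_of_cover (fun y hy => ?_) hj
    by_cases hyp : y = p
    · subst hyp
      refine ⟨_, Finset.mem_insert_self _ _, ball_subset_of_fst_eq rfl ?_⟩
      have hR := R_nonneg (G := G)
      simp only; linarith
    · exact ⟨y, Finset.mem_insert_of_mem (Finset.mem_erase.2 ⟨hyp, hy⟩), subset_rfl⟩

/-- Matched pairs have distinct images by `eq_of_intersects_core`, and unmatched pairs are sent
injectively to core pairs not used by them. -/
theorem IsMatching.swapHyp (hG : G.LPFeasible) (hε : 0 < ε) (hz₁ : 0 ≤ z₁)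
    (hz : z₁ ≤ z₂) (hδ : z₂ - z₁ ≤ G.δ ε) (c₁ : G.PDCert z₁ o₁) (c₂ : G.PDCert z₂ o₂)
    (h₁ : G.IsPDOut z₁ o₁) (h₂ : G.IsPDOut z₂ o₂)
    (hzO : (1 + ε) * G.OPT < z₁) (hk₁ : G.k' < o₁.F.card) (hns : ¬ ∃ A, G.IsShortcut o₁ A)
    {ψ : Pair X → Pair X} (hψ : IsMatching o₁ o₂ ψ) : G.SwapHyp o₁ o₂ ψ := by
  obtain ⟨hm1, hm2, hm3⟩ := hψ
  have hun : ∀ q ∈ o₂.F, q ∉ matched o₁ o₂ → ψ q ∈ o₁.core \ (matched o₁ o₂).image ψ :=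
    fun q hq hqm => hm2 q (Finset.mem_sdiff.2 ⟨hq, hqm⟩)
  refine ⟨h₁.isValid hz₁, h₂.isValid (hz₁.trans hz), fun q hq => ?_, fun q hq q' hq' heq => ?_,
    fun q hq p hp hint => ?_⟩
  · by_cases hqm : q ∈ matched o₁ o₂
    · exact (hm1 q hqm).1
    · exact (Finset.mem_sdiff.1 (hun q hq hqm)).1
  · by_cases hqm : q ∈ matched o₁ o₂ <;> by_cases hqm' : q' ∈ matched o₁ o₂
    · exact PDCert.eq_of_intersects_core hG hε hz₁ hz hδ c₁ c₂ hzO hk₁ hns (hm1 q hqm).1 hq hq'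
        (hm1 q hqm).2 (heq ▸ (hm1 q' hqm').2)
    · exact absurd (Finset.mem_image.2 ⟨q, hqm, heq⟩) (Finset.mem_sdiff.1 (hun q' hq' hqm')).2
    · exact absurd (Finset.mem_image.2 ⟨q', hqm', heq.symm⟩)
        (Finset.mem_sdiff.1 (hun q hq hqm)).2
    · exact hm3 (Finset.mem_coe.2 (Finset.mem_sdiff.2 ⟨hq, hqm⟩))
        (Finset.mem_coe.2 (Finset.mem_sdiff.2 ⟨hq', hqm'⟩)) heq
  · have hqm : q ∈ matched o₁ o₂ := Finset.mem_filter.2 ⟨hq, p, hp, hint⟩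
    exact eq_of_intersects_of_no_shortcut hns (fun p hp => (c₁.mem_F hp).2.2) (c₂.mem_F hq).2.2
      (hm1 q hqm).1 hp (hm1 q hqm).2 hint

/-- As long as too many clients are uncovered, the pairs in use are cheap. -/
theorem SwapHyp.weight_le {ψ : Pair X → Pair X} (h : G.SwapHyp o₁ o₂ ψ) (hG : G.LPFeasible)
    (hε : 0 < ε) (hz₁ : 0 ≤ z₁) (hz : z₁ ≤ z₂) (hδ : z₂ - z₁ ≤ G.δ ε) (c₁ : G.PDCert z₁ o₁)
    (c₂ : G.PDCert z₂ o₂) (hzO : (1 + ε) * G.OPT < z₁) (hk₁ : G.k' < o₁.F.card)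
    {Q : Finset (Pair X)} (hQ : Q ⊆ o₂.F.filter (fun p => (ψ p).2 < p.2))
    (hm : I.m < (G.uncov (swapState o₁ o₂ ψ Q).F).card) :
    ∑ p ∈ o₁.core \ Q.image ψ, p.2 + ∑ q ∈ Q, (q.2 + 2 * (ψ q).2) ≤
      (9 + 3 * ε) * G.OPT + 9 * G.R := by
  have hO := OPT_nonneg (G := G)
  have hR := R_nonneg (G := G)
  have hεO : 0 ≤ ε * G.OPT := by positivity
  have hQF : Q ⊆ o₂.F := hQ.trans (Finset.filter_subset _ _)
  obtain ⟨hcore, hcard, -⟩ := c₁.of_OPT_lt hG hz₁ (by linarith) hk₁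
  set P := o₁.core \ Q.image ψ with hP
  have hPF : P ⊆ o₁.F := Finset.sdiff_subset.trans (core_subset o₁)
  have hnewF : ∀ q ∈ Q, newPair o₁ o₂ ψ q ∈ (swapState o₁ o₂ ψ Q).F := fun q hq =>
    Finset.mem_union_right _ (Finset.mem_image_of_mem _ hq)
  have hPS : ∀ p ∈ P, p ∈ (swapState o₁ o₂ ψ Q).F := fun p hp => Finset.mem_union_left _ hp
  have hnewball : ∀ q ∈ Q, I.ball q ⊆ I.ball (newPair o₁ o₂ ψ q) := fun q hq =>
    ball_subset_of_fst_eq rfl (h.newPair_bounds (hQF hq)).1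
  have hpack := PDCert.packing_mixed hG hε hz₁ hz hδ c₁ c₂ hPF hQF
    (fun q hq p hp hint => (Finset.mem_sdiff.1 hp).2 (Finset.mem_image.2
      ⟨q, hq, h.eq_of_intersects q (hQF hq) p (Finset.mem_sdiff.1 hp).1 hint⟩))
    (U := G.uncov (swapState o₁ o₂ ψ Q).F) ?_ hm
    (fun p hp j hj => (mem_uncov.1 hj).2 p (hPS p hp))
    (fun q hq j hj hjq => (mem_uncov.1 hj).2 _ (hnewF q hq) (hnewball q hq hjq))
  -- Each swap replaces one ball by one ball, so there are exactly `k'` of them and the penalty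
  -- terms cancel.
  · have e1 : ((P.card : ℝ) + Q.card) = G.k' := by
      rw [← hcard]; exact_mod_cast h.card_add_card hQF
    rw [e1] at hpack
    obtain ⟨e, he⟩ := c₂.exists_exceptional
    have e2 : ∑ p ∈ P, p.2 ≤ ∑ p ∈ P, 9 * o₁.rad p.1 := by
      refine Finset.sum_le_sum fun p hp => ?_
      have hp' : p ∈ c₁.pruned := hcore ▸ (Finset.mem_sdiff.1 hp).1
      obtain ⟨a1, a2, a3⟩ := c₁.pruned_spec hp'
      have a4 : 0 ≤ o₁.rad p.1 := nonneg_of_mem_L' (c₁.rad_mem_L' (hPF hp))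
      linarith
    -- Swapped pairs satisfy `(ψ q).2 < q.2`, so the summand is below `3 * q.2`, at most nine
    -- recorded radii. The one exceptional pair is charged `3 * (3 * G.R)` instead.
    have e3 : ∑ q ∈ Q, (q.2 + 2 * (ψ q).2) ≤
        ∑ q ∈ Q, (9 * o₂.rad q.1 + if q = e then 9 * G.R else 0) := by
      refine Finset.sum_le_sum fun q hq => ?_
      have a1 := (Finset.mem_filter.1 (hQ hq)).2
      have a2 := (c₂.mem_F (hQF hq)).2.2
      have a4 : 0 ≤ o₂.rad q.1 := nonneg_of_mem_L' (c₂.rad_mem_L' (hQF hq))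
      split_ifs with hqe
      · linarith
      · linarith [he q (hQF hq) hqe]
    have e4 : ∑ q ∈ Q, (if q = e then 9 * G.R else 0) ≤ 9 * G.R := by
      rw [Finset.sum_ite_eq']
      split_ifs <;> linarith
    have e5 : ∑ q ∈ Q, (9 * o₂.rad q.1 + if q = e then 9 * G.R else 0) =
        9 * ∑ q ∈ Q, o₂.rad q.1 + ∑ q ∈ Q, (if q = e then 9 * G.R else 0) := by
      rw [Finset.sum_add_distrib, Finset.mul_sum]
    rw [← Finset.mul_sum] at e2
    linarith
  · intro j hj
    obtain ⟨hjD, hjA⟩ := mem_uncov.1 hj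
    by_cases hj1 : ∀ p ∈ o₁.core, j ∉ I.ball p
    · left
      exact c₁.uncov_pruned (hcore ▸ mem_uncov.2 ⟨hjD, hj1⟩)
    · by_cases hj2 : ∀ q ∈ o₂.F, j ∉ I.ball q
      · right
        exact c₂.uncov_F_subset (mem_uncov.2 ⟨hjD, hj2⟩)
      · push Not at hj1 hj2
        obtain ⟨p, hp, hjp⟩ := hj1
        obtain ⟨q, hq, hjq⟩ := hj2
        -- A client in both a core ball and an `F₂`-ball is covered in every state: those balls are
        -- partners, and one of the two is present.
        have hψq := h.eq_of_intersects q hq p hp (intersects_of_mem_ball hjq hjp)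
        by_cases hpQ : p ∈ Q.image ψ
        · obtain ⟨d, hd, hdp⟩ := Finset.mem_image.1 hpQ
          have hdq : d = q := h.inj (hQF hd) hq (hdp.trans hψq.symm)
          subst hdq
          exact absurd (hnewball d hd hjq) (hjA _ (hnewF d hd))
        · exact absurd hjp (hjA p (hPS p (Finset.mem_sdiff.2 ⟨hp, hpQ⟩)))

theorem IsCombineB.spec (hG : G.LPFeasible) (hε : 0 < ε) (hz₁ : 0 ≤ z₁)
    (hz : z₁ ≤ z₂) (hδ : z₂ - z₁ ≤ G.δ ε)
    (h₁ : G.IsPDOut z₁ o₁) (h₂ : G.IsPDOut z₂ o₂)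
    (hzO : (1 + ε) * G.OPT < z₁) (hk₁ : G.k' < o₁.F.card) (hk₂ : o₂.F.card ≤ G.k')
    (hns : ¬ ∃ A, G.IsShortcut o₁ A) {B : Sol X} (hB : G.IsCombineB o₁ o₂ B) :
    G.IsValid B ∧ B.F.card ≤ G.k' ∧ (G.uncov B.F).card ≤ I.m ∧
      cost B.F ≤ (9 + 3 * ε) * G.OPT + 18 * G.R := by
  obtain ⟨c₁⟩ := exists_cert_of_card hz₁ h₁ hk₁
  obtain ⟨c₂⟩ := exists_cert_of_cert (hz₁.trans hz) h₂ c₁.toDualCert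
  obtain ⟨ψ, l, hψ, hl, hlE, rfl⟩ := hB
  have hR := R_nonneg (G := G)
  have hεO : 0 ≤ ε * G.OPT := mul_nonneg hε.le OPT_nonneg
  have hO := OPT_nonneg (G := G)
  have h := hψ.swapHyp hG hε hz₁ hz hδ c₁ c₂ h₁ h₂ hzO hk₁ hns
  obtain ⟨hcore, hcard, hmcore⟩ := c₁.of_OPT_lt hG hz₁ (by linarith) hk₁
  set E := o₂.F.filter (fun p => (ψ p).2 < p.2) with hE
  have hEF : E ⊆ o₂.F := Finset.filter_subset _ _
  have hinit : (⟨o₁.core, o₁.rad⟩ : Sol X) = swapState o₁ o₂ ψ ∅ := by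
    simp [swapState, centers]
  rw [hinit]
  rcases h.swapLoop_spec hEF l ∅ hl (by simp) (by simpa using hlE) with
    ⟨Q', hQ', heq, hm, hor⟩ | ⟨heq, hm⟩
  · rw [heq, Option.getD_some]
    refine ⟨h.isValid_swapState (hQ'.trans hEF),
      hcard ▸ h.card_swapState_le (hQ'.trans hEF), hm, ?_⟩
    rcases hor with rfl | ⟨Q'', hQ'', p, hpE, hpQ, rfl, hm''⟩
    -- The loop cannot stop before the first swap, since the core alone leaves more than `m` clients
    -- uncovered.
    · rw [← hinit] at hm
      exact absurd hm (not_le.2 hmcore)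
    · have e1 := h.cost_swapState_insert_le (hQ''.trans hEF) (hEF hpE) hpQ
      have e2 := h.cost_swapState_le (hQ''.trans hEF)
      have e3 := h.weight_le hG hε hz₁ hz hδ c₁ c₂ hzO hk₁ hQ'' hm''
      have e4 := (c₂.mem_F (hEF hpE)).2.2
      have e5 := (Finset.mem_filter.1 hpE).2
      linarith
  · rw [heq, Option.getD_none]
    refine ⟨h.valid₂, hk₂, c₂.card_uncov_F, ?_⟩
    have e3 := h.weight_le hG hε hz₁ hz hδ c₁ c₂ hzO hk₁ subset_rfl hm
    -- Pairs outside `E` are no larger than their partners, and these partners are distinct core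
    -- pairs still in use, so the final infeasible state bounds the cost of the second solution.
    have e4 : ∑ q ∈ o₂.F \ E, q.2 ≤ ∑ p ∈ o₁.core \ E.image ψ, p.2 := by
      calc ∑ q ∈ o₂.F \ E, q.2 ≤ ∑ q ∈ o₂.F \ E, (ψ q).2 := by
            refine Finset.sum_le_sum fun q hq => ?_
            obtain ⟨a1, a2⟩ := Finset.mem_sdiff.1 hq
            by_contra hc
            exact a2 (Finset.mem_filter.2 ⟨a1, not_le.1 hc⟩)
        _ = ∑ p ∈ (o₂.F \ E).image ψ, p.2 := by
            rw [Finset.sum_image]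
            exact h.inj.mono (by exact_mod_cast Finset.sdiff_subset)
        _ ≤ _ := by
            refine Finset.sum_le_sum_of_subset_of_nonneg ?_ fun p hp _ =>
              h.nonneg₁ (Finset.mem_sdiff.1 hp).1
            intro p hp
            obtain ⟨q, hq, rfl⟩ := Finset.mem_image.1 hp
            obtain ⟨a1, a2⟩ := Finset.mem_sdiff.1 hq
            refine Finset.mem_sdiff.2 ⟨h.maps q a1, fun hc => ?_⟩
            obtain ⟨d, hd, hdq⟩ := Finset.mem_image.1 hc
            exact a2 (h.inj (hEF hd) a1 hdq ▸ hd)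
    have e5 : ∑ q ∈ E, q.2 ≤ ∑ q ∈ E, (q.2 + 2 * (ψ q).2) := by
      refine Finset.sum_le_sum fun q hq => ?_
      have := h.nonneg₁ (h.maps q (hEF hq))
      linarith
    have e6 : cost o₂.F = ∑ q ∈ o₂.F \ E, q.2 + ∑ q ∈ E, q.2 :=
      (Finset.sum_sdiff hEF).symm
    rw [e6]
    linarith

/-- There is room for the unmatched pairs: `|F₂| ≤ k' ≤ |core|`, and the image of the matched pairs
is no larger than their number. -/
theorem exists_isCombineB (hk₁ : G.k' < o₁.F.card) (hcore : o₁.F.card ≤ o₁.core.card + 1)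
    (hk₂ : o₂.F.card ≤ G.k') : ∃ B, G.IsCombineB o₁ o₂ B := by
  have hM : ∀ q : Pair X, ∃ p, q ∈ matched o₁ o₂ → p ∈ o₁.core ∧ Intersects q p := by
    intro q
    by_cases h : q ∈ matched o₁ o₂
    · obtain ⟨p, hp⟩ := (Finset.mem_filter.1 h).2
      exact ⟨p, fun _ => hp⟩
    · exact ⟨q, fun h' => absurd h' h⟩
  choose ψ₁ hψ₁ using hM
  have hcard : (o₂.F \ matched o₁ o₂).card ≤ (o₁.core \ (matched o₁ o₂).image ψ₁).card := by
    have h1 : matched o₁ o₂ ⊆ o₂.F := Finset.filter_subset _ _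
    have h2 := Finset.card_sdiff_add_card_eq_card h1
    have h3 := Finset.le_card_sdiff ((matched o₁ o₂).image ψ₁) o₁.core
    have h4 : ((matched o₁ o₂).image ψ₁).card ≤ (matched o₁ o₂).card := Finset.card_image_le
    omega
  obtain ⟨ψ₂, hψ₂, hinj⟩ : ∃ ψ₂ : Pair X → Pair X,
      Set.MapsTo ψ₂ (o₂.F \ matched o₁ o₂ : Finset (Pair X))
        (o₁.core \ (matched o₁ o₂).image ψ₁ : Finset (Pair X)) ∧
      Set.InjOn ψ₂ (o₂.F \ matched o₁ o₂ : Finset (Pair X)) := by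
    obtain ⟨T, hT, hTc⟩ := Finset.exists_subset_card_eq hcard
    obtain ⟨e⟩ : Nonempty ((o₂.F \ matched o₁ o₂ : Finset (Pair X)) ≃ T) :=
      ⟨Finset.equivOfCardEq hTc.symm⟩
    refine ⟨fun q => if h : q ∈ o₂.F \ matched o₁ o₂ then (e ⟨q, h⟩ : Pair X) else q,
      fun q hq => ?_, fun q hq q' hq' heq => ?_⟩
    · rw [Finset.mem_coe] at hq
      simp only [Finset.mem_coe, dif_pos hq]
      exact hT (e ⟨q, hq⟩).2
    · rw [Finset.mem_coe] at hq hq'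
      simp only [dif_pos hq, dif_pos hq'] at heq
      exact congrArg Subtype.val (e.injective (Subtype.ext heq))
  set ψ : Pair X → Pair X := fun q => if q ∈ matched o₁ o₂ then ψ₁ q else ψ₂ q with hψ
  have h1 : ∀ q ∈ matched o₁ o₂, ψ q = ψ₁ q := fun q hq => if_pos hq
  have h2 : ∀ q ∈ o₂.F \ matched o₁ o₂, ψ q = ψ₂ q := fun q hq =>
    if_neg (Finset.mem_sdiff.1 hq).2
  refine ⟨_, ψ, (o₂.F.filter (fun p => (ψ p).2 < p.2)).toList, ⟨fun q hq => ?_, fun q hq => ?_,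
    fun q hq q' hq' heq => ?_⟩, Finset.nodup_toList _, Finset.toList_toFinset _, rfl⟩
  · rw [h1 q hq]; exact hψ₁ q hq
  · rw [h2 q hq, Finset.image_congr (g := ψ₁) fun q hq => h1 q hq]
    exact hψ₂ (Finset.mem_coe.2 hq)
  · rw [h2 q hq, h2 q' hq'] at heq
    exact hinj hq hq' heq

end NoShortcut

end Guess

/-! ### The modified ball-selection algorithm -/

namespace Guess

variable {G : Guess I}

theorem IsValid.of_origin {A B : Sol X} (hB : G.IsValid B) (hrad : A.rad = B.rad)
    (h : ∀ x ∈ A.F, ∃ y ∈ B.F, y.1 = x.1 ∧ y.2 ≤ x.2) : G.IsValid A := by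
  refine ⟨fun x hx => ?_, fun x hx x' hx' hne => ?_⟩
  · obtain ⟨y, hy, h1, h2⟩ := h x hx
    rw [hrad, ← h1]
    exact ⟨(hB.1 y hy).1, (hB.1 y hy).2.trans h2⟩
  · obtain ⟨y, hy, h1, -⟩ := h x hx
    obtain ⟨y', hy', h1', -⟩ := h x' hx'
    rw [hrad, ← h1, ← h1']
    exact hB.2 y hy y' hy' (by rw [h1, h1']; exact hne)

/-- More than `k'` output pairs mean at least `k'` kept ones, so the cost is at most `3 OPT + 3 R*`
whatever the penalty. A shortcut removes one pair and adds at most `12 R*`; the core having at most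
`k'` pairs, one removal is enough. -/
theorem IsShortcut.spec (hG : G.LPFeasible) {z : ℝ} (hz : 0 ≤ z) {o : PDOut X}
    (ho : G.IsPDOut z o) (hk : G.k' < o.F.card) (hcore : o.core.card ≤ G.k') {A : Sol X}
    (hA : G.IsShortcut o A) :
    G.IsValid A ∧ A.F.card ≤ G.k' ∧ (G.uncov A.F).card ≤ I.m ∧
      cost A.F ≤ 3 * G.OPT + 18 * G.R := by
  obtain ⟨c⟩ := exists_cert_of_card hz ho hk
  have hR := R_nonneg (G := G)
  have hvalid := ho.isValid hz
  have hcost : cost o.F ≤ 3 * G.OPT + 3 * G.R :=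
    c.cost_F_le_of_card_TI hz hG (by have := c.card_F_le; omega)
  obtain ⟨hrad, ⟨p, hp, hF, hm⟩ | ⟨p, hp, p', hp', hne, hd, hF⟩⟩ := hA
  · have hpF := core_subset o hp
    have hp0 : 0 ≤ p.2 := hvalid.nonneg hpF
    refine ⟨hvalid.of_origin hrad fun x hx => ?_, ?_, hm, ?_⟩
    · rw [hF, Finset.mem_insert] at hx
      rcases hx with rfl | hx
      · exact ⟨p, hpF, rfl, by simp only; linarith⟩
      · exact ⟨x, core_subset o (Finset.mem_of_mem_erase hx), rfl, le_rfl⟩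
    · rw [hF]
      have h1 := Finset.card_insert_le (p.1, p.2 + 12 * G.R) (o.core.erase p)
      have h2 := Finset.card_erase_add_one hp
      omega
    · rw [hF]
      have h1 : cost (insert (p.1, p.2 + 12 * G.R) (o.core.erase p)) ≤
          (p.2 + 12 * G.R) + cost (o.core.erase p) := cost_insert_le (by simp only; linarith)
      rw [cost_erase hp] at h1
      have h2 := cost_mono (core_subset o) fun x hx => hvalid.nonneg hx
      linarith
  · have hp'e : p' ∈ o.F.erase p := Finset.mem_erase.2 ⟨hne.symm, hp'⟩
    refine ⟨hvalid.of_origin hrad fun x hx => ?_, ?_, ?_, ?_⟩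
    · rw [hF, Finset.mem_insert] at hx
      rcases hx with rfl | hx
      · exact ⟨p, hp, rfl, le_coverRadius _ _ _⟩
      · exact ⟨x, Finset.mem_of_mem_erase (Finset.mem_of_mem_erase hx), rfl, le_rfl⟩
    · rw [hF]
      have h1 := Finset.card_insert_le (p.1, coverRadius p.1 p.2 (I.ball p'))
        ((o.F.erase p).erase p')
      have h2 := Finset.card_erase_add_one hp
      have h3 := Finset.card_erase_add_one hp'e
      have h4 := c.card_F_le_core
      omega
    · refine (Finset.card_le_card (uncov_subset_of_cover fun x hx => ?_)).trans (ho.card_uncov hz)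
      rw [hF]
      by_cases hxp : x = p
      · subst hxp
        exact ⟨(x.1, coverRadius x.1 x.2 (I.ball p')), Finset.mem_insert_self _ _,
          ball_subset_of_fst_eq rfl (le_coverRadius _ _ _)⟩
      · by_cases hxp' : x = p'
        · subst hxp'
          exact ⟨_, Finset.mem_insert_self _ _, fun j hj =>
            mem_ball.2 ⟨(mem_ball.1 hj).1, dist_le_coverRadius hj⟩⟩
        · exact ⟨x, Finset.mem_insert_of_mem
            (Finset.mem_erase.2 ⟨hxp', Finset.mem_erase.2 ⟨hxp, hx⟩⟩), subset_rfl⟩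
    · rw [hF]
      have hp0 : 0 ≤ p.2 := hvalid.nonneg hp
      have h0 : coverRadius p.1 p.2 (I.ball p') ≤ p.2 + p'.2 + 12 * G.R := by
        have hp'0 : 0 ≤ p'.2 := hvalid.nonneg hp'
        refine coverRadius_le (by linarith) fun j hj => ?_
        have h1 := (mem_ball.1 hj).2
        have h2 := dist_triangle p.1 p'.1 j
        linarith
      have h1 : cost (insert (p.1, coverRadius p.1 p.2 (I.ball p')) ((o.F.erase p).erase p')) ≤
          coverRadius p.1 p.2 (I.ball p') + cost ((o.F.erase p).erase p') :=
        cost_insert_le (hp0.trans (le_coverRadius _ _ _))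
      rw [cost_erase hp'e, cost_erase hp] at h1
      linarith

/-- Invariants of the binary search. -/
theorem searchStep_iterate (hG : G.LPFeasible) {pd : ℝ → PDOut X} (hpd : G.IsPD pd)
    (h0 : G.k' < (pd 0).F.card) (N : ℕ) :
    let z := (G.searchStep pd)^[N] G.searchInit
    0 ≤ z.1 ∧ z.1 ≤ z.2 ∧ G.k' < (pd z.1).F.card ∧ (pd z.2).F.card ≤ G.k' ∧
      z.2 - z.1 = G.searchInit.2 / 2 ^ N := by
  have hc0 := cmax_nonneg (I := I)
  have hz : 0 ≤ G.searchInit.2 := by unfold searchInit; positivity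
  induction N with
  | zero =>
    exact ⟨le_rfl, hz, h0, (hpd _ hz).card_le_of_searchInit hG, by simp [searchInit]⟩
  | succ N ih =>
    intro z
    have hzdef : z = G.searchStep pd ((G.searchStep pd)^[N] G.searchInit) :=
      Function.iterate_succ_apply' _ _ _
    obtain ⟨h1, h2, h3, h4, h5⟩ := ih
    set y := (G.searchStep pd)^[N] G.searchInit with hy
    rw [hzdef, searchStep, pow_succ, ← div_div, ← h5]
    split_ifs with h
    · exact ⟨by simp only; linarith, by simp only; linarith, h, h4, by simp only; ring⟩
    · exact ⟨h1, by simp only; linarith, h3, not_lt.1 h, by simp only; ring⟩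

/-- A positive optimum makes the target width positive, and the interval is halved in each step. -/
theorem exists_isSearchResult {pd : ℝ → PDOut X} {ε : ℝ} (hε : 0 < ε) (hO : 0 < G.OPT)
    (hG : G.LPFeasible) (hpd : G.IsPD pd) (h0 : G.k' < (pd 0).F.card) :
    ∃ z, G.IsSearchResult pd ε z := by
  have hδ : 0 < G.δ ε := by
    have := card_D'_lt_size (G := G)
    have hs : (0 : ℝ) < I.size := by exact_mod_cast (by omega : 0 < I.size)
    unfold δ; positivity
  have hex : ∃ N, ((G.searchStep pd)^[N] G.searchInit).2 -
      ((G.searchStep pd)^[N] G.searchInit).1 ≤ G.δ ε := by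
    obtain ⟨N, hN⟩ := pow_unbounded_of_one_lt (G.searchInit.2 / G.δ ε) one_lt_two
    refine ⟨N, ?_⟩
    rw [(searchStep_iterate hG hpd h0 N).2.2.2.2, div_le_iff₀ (by positivity), mul_comm]
    exact ((div_lt_iff₀ hδ).1 hN).le
  refine ⟨_, Nat.find hex, rfl, Nat.find_spec hex, fun n hn => ?_⟩
  exact not_le.1 (Nat.find_min hex hn)

theorem exists_isOutput {pd : ℝ → PDOut X} {ε : ℝ} (hε : 0 < ε) (hO : 0 < G.OPT)
    (hG : G.LPFeasible) (hpd : G.IsPD pd) : ∃ A, G.IsOutput pd ε A := by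
  by_cases h0 : (pd 0).F.card ≤ G.k'
  · exact ⟨_, Or.inl ⟨h0, rfl⟩⟩
  rw [not_le] at h0
  obtain ⟨z, hz⟩ := exists_isSearchResult hε hO hG hpd h0
  obtain ⟨N, hzN, -⟩ := id hz
  obtain ⟨h1, h2, h3, h4, -⟩ := searchStep_iterate hG hpd h0 N
  rw [← hzN] at h1 h2 h3 h4
  obtain ⟨FA, hFA⟩ := exists_isCombineA h1 (h1.trans h2) (hpd _ h1) (hpd _ (h1.trans h2)) h3 h4
  by_cases hc : G.k' < (pd z.1).core.card
  · exact ⟨FA, Or.inr ⟨h0, z, FA, hz, hFA, Or.inl ⟨hc, rfl⟩⟩⟩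
  rw [not_lt] at hc
  by_cases hs : ∃ A, G.IsShortcut (pd z.1) A
  · obtain ⟨A, hA⟩ := hs
    exact ⟨A, Or.inr ⟨h0, z, FA, hz, hFA, Or.inr ⟨hc, Or.inl hA⟩⟩⟩
  by_cases hzO : z.1 ≤ (1 + ε) * G.OPT
  · exact ⟨FA, Or.inr ⟨h0, z, FA, hz, hFA, Or.inr ⟨hc, Or.inr ⟨hs, Or.inl ⟨hzO, rfl⟩⟩⟩⟩⟩
  · obtain ⟨c⟩ := exists_cert_of_card h1 (hpd _ h1) h3
    obtain ⟨FB, hFB⟩ := exists_isCombineB h3 c.card_F_le_core h4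
    exact ⟨_, Or.inr ⟨h0, z, FA, hz, hFA, Or.inr ⟨hc, Or.inr ⟨hs, Or.inr
      ⟨not_le.1 hzO, FB, hFB, rfl⟩⟩⟩⟩⟩

theorem IsOutput.spec {pd : ℝ → PDOut X} {ε : ℝ} (hε : 0 < ε) (hG : G.LPFeasible)
    (hpd : G.IsPD pd) {A : Sol X} (hA : G.IsOutput pd ε A) :
    G.IsValid A ∧ A.F.card ≤ G.k' ∧ (G.uncov A.F).card ≤ I.m ∧
      cost A.F ≤ (12.365 + 9 * ε) * G.OPT + 40 * G.R := by
  have hR := R_nonneg (G := G)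
  have hO := OPT_nonneg (G := G)
  have hεO : 0 ≤ ε * G.OPT := by positivity
  rcases hA with ⟨h0, rfl⟩ | ⟨h0, z, FA, ⟨N, hzN, hδ, -⟩, hFA, hA⟩
  · have ho := hpd 0 le_rfl
    refine ⟨ho.isValid le_rfl, h0, ho.card_uncov le_rfl, ?_⟩
    rcases ho.trivial_or_cert le_rfl with ⟨h, -⟩ | ⟨⟨c⟩⟩
    · rw [h]
      simp only [cost, Finset.sum_empty]
      positivity
    -- At penalty `0` the dual bound has no penalty terms and gives a factor 3 directly.
    · have h1 := c.sum_TI_le_OPT le_rfl hG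
      have h2 := c.cost_F
      linarith
  · obtain ⟨h1, h2, h3, h4, -⟩ := searchStep_iterate hG hpd h0 N
    rw [← hzN] at h1 h2 h3 h4
    have o₁ := hpd _ h1
    have o₂ := hpd _ (h1.trans h2)
    obtain ⟨a1, a2, a3⟩ := hFA.spec h1 (h1.trans h2) o₁ o₂ h4
    have acost := fun h => hFA.cost_le hG hε h1 h2 hδ o₁ o₂ h3 h4 h
    rcases hA with ⟨hc, rfl⟩ | ⟨hc, hs | ⟨hns, ⟨hzO, rfl⟩ | ⟨hzO, FB, hFB, rfl⟩⟩⟩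
    -- More than `k'` core pairs mean more than `k'` kept pairs, hence `z₁ ≤ OPT`, and the bound for
    -- the first combination applies.
    · obtain ⟨c⟩ := exists_cert_of_card h1 o₁ h3
      have := c.le_OPT_of_card_TI h1 hG (hc.trans_le c.card_core_le)
      exact ⟨a1, a2, a3, acost (by linarith)⟩
    · obtain ⟨b1, b2, b3, b4⟩ := hs.spec hG h1 o₁ h3 hc
      exact ⟨b1, b2, b3, by linarith⟩
    · exact ⟨a1, a2, a3, acost hzO⟩
    · obtain ⟨b1, b2, b3, b4⟩ := hFB.spec hG hε h1 h2 hδ o₁ o₂ hzO h3 h4 hns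
      split_ifs with hcmp
      · exact ⟨a1, a2, a3, by linarith⟩
      · exact ⟨b1, b2, b3, by linarith⟩

end Guess

end LBSRO

end

/-! ### The main theorem. -/

theorem theorem6 :
    ∃ C₁ C₂ : ℝ, ∀ (X : Type*) [PseudoMetricSpace X] (I : LBSRO.Inst X) (G : LBSRO.Guess I),
      G.LPFeasible →
      (∃ pd : ℝ → LBSRO.PDOut X, G.IsPD pd) ∧
      ∀ (pd : ℝ → LBSRO.PDOut X), G.IsPD pd → ∀ ε : ℝ, 0 < ε →
        (0 < G.OPT → ∃ A : LBSRO.Sol X, G.IsOutput pd ε A) ∧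
        ∀ A : LBSRO.Sol X, G.IsOutput pd ε A →
          (∀ p ∈ A.F, I.Admissible p) ∧
          A.F.card ≤ G.k' ∧
          (G.uncov A.F).card ≤ I.m ∧
          LBSRO.cost A.F ≤ (12.365 + C₁ * ε) * G.OPT + C₂ * G.R ∧
          (∀ i ∈ LBSRO.centers A.F, (i, A.rad i) ∈ G.L') ∧
          (∀ i ∈ LBSRO.centers A.F, ∀ i' ∈ LBSRO.centers A.F, i ≠ i' →
            ¬ LBSRO.Intersects (i, A.rad i) (i', A.rad i')) := by
  refine ⟨9, 40, fun X _ I G hG => ⟨?_, fun pd hpd ε hε => ⟨fun hO => ?_, fun A hA => ?_⟩⟩⟩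
  · have h : ∀ z : ℝ, ∃ o, 0 ≤ z → G.IsPDOut z o := by
      intro z
      by_cases hz : 0 ≤ z
      · obtain ⟨o, ho⟩ := LBSRO.Guess.exists_isPDOut hz hG
        exact ⟨o, fun _ => ho⟩
      -- Negative penalties are unconstrained, so any value will do.
      · exact ⟨⟨⟨∅, fun _ => 0⟩, none⟩, fun h => absurd h hz⟩
    choose pd hpd using h
    exact ⟨pd, hpd⟩
  · exact LBSRO.Guess.exists_isOutput hε hO hG hpd
  · obtain ⟨h1, h2, h3, h4⟩ := LBSRO.Guess.IsOutput.spec hε hG hpd hA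
    refine ⟨fun p hp => ?_, h2, h3, h4, fun i hi => ?_, fun i hi i' hi' hne => ?_⟩
    · exact (LBSRO.Guess.admissible_of_mem_L' (h1.1 p hp).1).mono rfl (h1.1 p hp).2
    · obtain ⟨p, hp, rfl⟩ := LBSRO.mem_centers.1 hi
      exact (h1.1 p hp).1
    · obtain ⟨p, hp, rfl⟩ := LBSRO.mem_centers.1 hi
      obtain ⟨p', hp', rfl⟩ := LBSRO.mem_centers.1 hi'
      exact h1.2 p hp p' hp' hne
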